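/- Let $(K,J,g)$ be a (non-empty) compact Kähler manifold of complex dimension $k$, and let $\psi:K\to K$ be a Kähler isometry, i.e. a holomorphic diffeomorphism with $\psi^*g=g$. Let $f=(\psi,\mathrm{Id}_{\mathbb S^3})$, acting on $K\times\mathbb S^3$, and let $M_f=(K\times\mathbb S^3)_f$ be its mapping torus, i.e. the smooth manifold obtained as the quotient of $K\times\mathbb S^3\times\mathbb R$ by the $\mathbb Z$-action $n\cdot(p,q,t)=(\psi^n(p),q,t+n)$. Then $M_f$ admits a split twisted generalized Kähler structure $(I_\pm,h,\Omega_\pm)$ for which, moreover, $I_+$ and $I_-$ induce opposite orientations on $M_f$. That is, there are a Riemannian metric $h$ and two (integrable) complex structures $I_+$, $I_-$ on $M_f$, both compatible with $h$ (that is, $h(I_\pm\cdot,I_\pm\cdot)=h$), such that, with $\Omega_\pm(X,Y)=h(I_\pm X,Y)$ and $d^c_\pm\Omega_\pm(X,Y,Z)=-d\Omega_\pm(I_\pm X,I_\pm Y,I_\pm Z)$: 1. (generalized Kähler) $d^c_+\Omega_+=-d^c_-\Omega_-$ and $dd^c_+\Omega_+=0$; 2. (split) $[I_+,I_-]=0$,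 and $I_+\neq\pm I_-$ at every point; 3. (twisted) the class $[d^c_+\Omega_+]$ in the de Rham cohomology $H^3(M_f,\mathbb R)$ is non-zero; 4. at every point of $M_f$, the orientations of the tangent space induced by $I_+$ and $I_-$ are opposite. -/

import Mathlib

set_option maxSynthPendingDepth 3

open Set Function
open scoped Manifold Topology ContDiff

noncomputable section

section MappingTorus

variable {E : Type*} [NormedAddCommGroup E] [NormedSpace ℝ E] {H : Type*} [TopologicalSpace H]
  {I : ModelWithCorners ℝ E H} {M : Type*} [TopologicalSpace M] [ChartedSpace H M]

/-- The action of `ℤ` on `M × ℝ` given by `n • (p, t) = (fⁿ p, t + n)`. -/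
@[reducible]
def suspensionAction (f : M ≃ₘ⟮I, I⟯ M) : AddAction ℤ (M × ℝ) where
  vadd n x := ((f.toEquiv ^ n : Equiv.Perm M) x.1, x.2 + n)
  zero_vadd x := Prod.ext rfl (by change x.2 + ((0 : ℤ) : ℝ) = x.2; simp)
  add_vadd m n x := by
    change (((f.toEquiv ^ (m + n) : Equiv.Perm M) x.1, x.2 + ((m + n : ℤ) : ℝ)) : M × ℝ)
      = ((f.toEquiv ^ m : Equiv.Perm M) ((f.toEquiv ^ n : Equiv.Perm M) x.1), x.2 + n + m)
    rw [zpow_add, Equiv.Perm.mul_apply]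
    refine Prod.ext rfl ?_
    push_cast
    ring

/-- The orbit equivalence relation of the action `n • (p, t) = (fⁿ p, t + n)` on `M × ℝ`. -/
@[reducible]
def suspensionSetoid (f : M ≃ₘ⟮I, I⟯ M) : Setoid (M × ℝ) :=
  @AddAction.orbitRel ℤ (M × ℝ) _ (suspensionAction f)

/-- The mapping torus `M_f`: the quotient of `M × ℝ` by the action `n • (p, t) = (fⁿ p, t + n)`. -/
def MappingTorus (f : M ≃ₘ⟮I, I⟯ M) : Type _ := Quotient (suspensionSetoid f)

namespace MappingTorus

variable (f : M ≃ₘ⟮I, I⟯ M)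

/-- The quotient topology. -/
instance : TopologicalSpace (MappingTorus f) :=
  inferInstanceAs (TopologicalSpace (Quotient (suspensionSetoid f)))

/-- The quotient map `M × ℝ → M_f`. -/
def mk (x : M × ℝ) : MappingTorus f := Quotient.mk (suspensionSetoid f) x

lemma contMDiff_zpow (n : ℤ) : ContMDiff I I ∞ ((f.toEquiv ^ n : Equiv.Perm M) : M → M) := by
  have hp : ContMDiff I I ∞ (f.toEquiv : M → M) := f.contMDiff_toFun
  have hm : ContMDiff I I ∞ (f.toEquiv.symm : M → M) := f.contMDiff_invFun
  induction n with
  | zero => exact contMDiff_id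
  | succ n ih =>
    rw [zpow_add_one]
    exact ih.comp hp
  | pred n ih =>
    rw [zpow_sub_one]
    exact ih.comp hm

lemma contMDiff_vadd (n : ℤ) :
    letI := suspensionAction f
    ContMDiff (I.prod 𝓘(ℝ, ℝ)) (I.prod 𝓘(ℝ, ℝ)) ∞ (fun x : M × ℝ => n +ᵥ x) := by
  refine ContMDiff.prodMk ((contMDiff_zpow f n).comp contMDiff_fst) ?_
  have h : ContMDiff 𝓘(ℝ, ℝ) 𝓘(ℝ, ℝ) ∞ (fun t : ℝ => t + (n : ℝ)) :=
    (contDiff_id.add contDiff_const).contMDiff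
  exact h.comp contMDiff_snd

lemma isAddQuotientCoveringMap_mk [T2Space M] [LocallyCompactSpace M] :
    letI := suspensionAction f
    IsAddQuotientCoveringMap (mk f) ℤ := by
  let := suspensionAction f
  have h0 : ∀ (n : ℤ) (x : M × ℝ), (n +ᵥ x).2 = x.2 + n := fun _ _ => rfl
  have : ContinuousConstVAdd ℤ (M × ℝ) := ⟨fun n => (contMDiff_vadd f n).continuous⟩
  have : IsCancelVAdd ℤ (M × ℝ) :=
    { left_cancel' := fun n x y h => (AddAction.injective n) h
      right_cancel' := fun m n x h => by
        have := congrArg Prod.snd h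
        rw [h0, h0] at this
        exact_mod_cast add_left_cancel this }
  have : ProperlyDiscontinuousVAdd ℤ (M × ℝ) := ⟨by
    intro K L hK hL
    have hD : IsCompact ((fun p : ℝ × ℝ => p.1 - p.2) '' ((Prod.snd '' L) ×ˢ (Prod.snd '' K))) :=
      ((hL.image continuous_snd).prod (hK.image continuous_snd)).image (by fun_prop)
    obtain ⟨r, hr⟩ := hD.isBounded.subset_closedBall 0
    refine (Set.finite_Icc (-⌈r⌉) ⌈r⌉).subset ?_
    rintro n ⟨_, ⟨x, hx, rfl⟩, hxL⟩
    have h1 := hr ⟨((n +ᵥ x).2, x.2), ⟨⟨_, hxL, rfl⟩, ⟨_, hx, rfl⟩⟩, rfl⟩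
    simp only [h0, Metric.mem_closedBall, dist_zero_right, Real.norm_eq_abs] at h1
    rw [add_sub_cancel_left, abs_le] at h1
    have h2 := Int.le_ceil r
    constructor
    · have : (-(⌈r⌉ : ℝ)) ≤ n := by linarith
      exact_mod_cast this
    · have : (n : ℝ) ≤ ⌈r⌉ := by linarith
      exact_mod_cast this⟩
  exact isAddQuotientCoveringMap_quotientMk_of_properlyDiscontinuousVAdd

lemma isLocalHomeomorph_mk [T2Space M] [LocallyCompactSpace M] : IsLocalHomeomorph (mk f) := by
  let := suspensionAction f
  exact (isAddQuotientCoveringMap_mk f).isCoveringMap.isLocalHomeomorph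

lemma surjective_mk : Surjective (mk f) := Quotient.mk_surjective

/-- The charts of `M_f` are the local inverses of the quotient map `M × ℝ → M_f` followed by charts
of `M × ℝ`. -/
instance [T2Space M] [LocallyCompactSpace M] : ChartedSpace (ModelProd H ℝ) (MappingTorus f) :=
  (isLocalHomeomorph_mk f).chartedSpaceOfRightInverse (rightInverse_surjInv (surjective_mk f))

lemma contMDiffOn_localInverse_comp_mk [T2Space M] [LocallyCompactSpace M] (x : M × ℝ) :
    ContMDiffOn (I.prod 𝓘(ℝ, ℝ)) (I.prod 𝓘(ℝ, ℝ)) ∞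
      (fun y => (isLocalHomeomorph_mk f).localInverseAt x (mk f y))
      (mk f ⁻¹' ((isLocalHomeomorph_mk f).localInverseAt x).source) := by
  let := suspensionAction f
  intro y hy
  set s := (isLocalHomeomorph_mk f).localInverseAt x with hs
  have hsymm : ∀ z, s.symm z = mk f z := fun z => by rw [hs, IsLocalHomeomorph.localInverseAt_symm]
  have hz : mk f (s (mk f y)) = mk f y := by rw [← hsymm]; exact s.left_inv hy
  obtain ⟨n, hn⟩ := (isAddQuotientCoveringMap_mk f).apply_eq_iff_mem_orbit.mp hz
  have hn' : n +ᵥ y = s (mk f y) := hn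
  have hev : ∀ᶠ w in 𝓝 y, n +ᵥ w ∈ s.target := by
    refine (contMDiff_vadd f n).continuous.continuousAt.preimage_mem_nhds ?_
    refine s.open_target.mem_nhds ?_
    rw [hn']
    exact s.map_source hy
  refine (((contMDiff_vadd f n).contMDiffAt (x := y)).congr_of_eventuallyEq ?_).contMDiffWithinAt
  filter_upwards [hev] with w hw
  have : mk f w = mk f (n +ᵥ w) := ((isAddQuotientCoveringMap_mk f).map_vadd n).symm
  rw [this, ← hsymm, s.right_inv hw]

/-- The mapping torus of a diffeomorphism is a smooth manifold. -/
instance [T2Space M] [LocallyCompactSpace M] [IsManifold I ∞ M] :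
    IsManifold (I.prod 𝓘(ℝ, ℝ)) ∞ (MappingTorus f) := by
  refine isManifold_of_contDiffOn _ _ _ ?_
  rintro _ _ ⟨q, rfl⟩ ⟨q', rfl⟩
  set x := surjInv (surjective_mk f) q
  set x' := surjInv (surjective_mk f) q'
  rw [← contMDiffOn_iff_contDiffOn]
  have h1 := (contMDiffOn_chart_symm (I := I.prod 𝓘(ℝ, ℝ)) (n := ∞) (x := x))
  have h2 := (contMDiffOn_chart (I := I.prod 𝓘(ℝ, ℝ)) (n := ∞) (x := x'))
  have h3 := contMDiffOn_localInverse_comp_mk f x'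
  have h4 := (I.prod 𝓘(ℝ, ℝ)).contMDiffOn_symm (n := ∞)
  have h5 := (I.prod 𝓘(ℝ, ℝ)).contMDiff (n := ∞)
  have key := h5.comp_contMDiffOn ((h2.comp' h3).comp' (h1.comp' h4))
  refine key.congr_mono ?_ ?_
  · intro y hy
    simp [OpenPartialHomeomorph.trans_symm_eq_symm_trans_symm] 
  · rintro y ⟨hy, hy'⟩
    simp only [OpenPartialHomeomorph.trans_symm_eq_symm_trans_symm, mem_preimage,
      OpenPartialHomeomorph.trans_source, OpenPartialHomeomorph.symm_source, mem_inter_iff,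
      OpenPartialHomeomorph.coe_trans, IsLocalHomeomorph.localInverseAt_symm, comp_apply] at hy ⊢
    exact ⟨⟨hy', hy.1.1⟩, hy.2⟩

end MappingTorus

end MappingTorus

section Forms

variable {E : Type*} [NormedAddCommGroup E] [NormedSpace ℝ E] {H : Type*} [TopologicalSpace H]
  (I : ModelWithCorners ℝ E H) (M : Type*) [TopologicalSpace M] [ChartedSpace H M]

/-- (Not necessarily smooth) differential `n`-forms on a manifold `M`. -/
abbrev DiffForm (n : ℕ) : Type _ := ∀ x : M, TangentSpace I x [⋀^Fin n]→L[ℝ] ℝ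

namespace DiffForm

variable {I M} {n : ℕ}

/-- The expression of a differential form in the preferred chart at `x₀`: its pullback under the
inverse of the chart. It is meaningful on the target of the chart, for manifolds without boundary. -/
def inChart (α : DiffForm I M n) (x₀ : M) (y : E) : E [⋀^Fin n]→L[ℝ] ℝ :=
  (α ((extChartAt I x₀).symm y)).compContinuousLinearMap
    (mfderiv 𝓘(ℝ, E) I (extChartAt I x₀).symm y)

/-- A differential form is smooth if its expressions in charts are. -/
def IsSmooth (α : DiffForm I M n) : Prop :=
  ∀ x₀ : M, ContDiffOn ℝ ∞ (α.inChart x₀) (extChartAt I x₀).target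

/-- The exterior derivative of a differential form on a manifold, computed at each point in the
preferred chart at that point. -/
def extDeriv (α : DiffForm I M n) : DiffForm I M (n + 1) := fun x =>
  (_root_.extDeriv (α.inChart x) (extChartAt I x x)).compContinuousLinearMap
    (mfderiv I 𝓘(ℝ, E) (extChartAt I x) x)

lemma inChart_add (α β : DiffForm I M n) (x₀ : M) :
    (α + β).inChart x₀ = α.inChart x₀ + β.inChart x₀ := rfl

lemma inChart_smul (c : ℝ) (α : DiffForm I M n) (x₀ : M) :
    (c • α).inChart x₀ = c • α.inChart x₀ := rfl

lemma inChart_zero (x₀ : M) : (0 : DiffForm I M n).inChart x₀ = 0 := rfl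

lemma isSmooth_zero : (0 : DiffForm I M n).IsSmooth := fun x₀ => by
  rw [inChart_zero]
  exact contDiffOn_const

lemma IsSmooth.add {α β : DiffForm I M n} (hα : α.IsSmooth) (hβ : β.IsSmooth) :
    (α + β).IsSmooth := fun x₀ => (hα x₀).add (hβ x₀)

lemma IsSmooth.smul (c : ℝ) {α : DiffForm I M n} (hα : α.IsSmooth) : (c • α).IsSmooth :=
  fun x₀ => (hα x₀).const_smul c

lemma extDeriv_zero : (0 : DiffForm I M n).extDeriv = 0 := by
  funext x
  simp only [extDeriv, inChart_zero]
  have : _root_.extDeriv (0 : E → E [⋀^Fin n]→L[ℝ] ℝ) (extChartAt I x x) = 0 := by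
    simpa using _root_.extDeriv_smul (0 : ℝ) (0 : E → E [⋀^Fin n]→L[ℝ] ℝ) (x := extChartAt I x x)
  rw [this]
  rfl

lemma extDeriv_smul (c : ℝ) (α : DiffForm I M n) : (c • α).extDeriv = c • α.extDeriv := by
  funext x
  simp only [extDeriv, inChart_smul, _root_.extDeriv_smul]
  rfl

section

variable [I.Boundaryless]

lemma IsSmooth.differentiableAt {α : DiffForm I M n} (hα : α.IsSmooth) (x : M) :
    DifferentiableAt ℝ (α.inChart x) (extChartAt I x x) :=
  ((hα x).contDiffAt (extChartAt_target_mem_nhds x)).differentiableAt (by simp)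

lemma extDeriv_add {α β : DiffForm I M n} (hα : α.IsSmooth) (hβ : β.IsSmooth) :
    (α + β).extDeriv = α.extDeriv + β.extDeriv := by
  funext x
  simp only [extDeriv, inChart_add, _root_.extDeriv_add (hα.differentiableAt x)
    (hβ.differentiableAt x)]
  rfl

variable (I M)

/-- The space of smooth closed `n`-forms. -/
def closedForms (n : ℕ) : Submodule ℝ (DiffForm I M n) where
  carrier := {α | α.IsSmooth ∧ α.extDeriv = 0}
  add_mem' := by
    rintro α β ⟨hα, hα'⟩ ⟨hβ, hβ'⟩
    exact ⟨hα.add hβ, by rw [extDeriv_add hα hβ, hα', hβ', add_zero]⟩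
  zero_mem' := ⟨isSmooth_zero, extDeriv_zero⟩
  smul_mem' := by
    rintro c α ⟨hα, hα'⟩
    exact ⟨hα.smul c, by rw [extDeriv_smul, hα', smul_zero]⟩

/-- The space of exact `n`-forms, i.e. of exterior derivatives of smooth `(n-1)`-forms. -/
def exactForms : (n : ℕ) → Submodule ℝ (DiffForm I M n)
  | 0 => ⊥
  | n + 1 =>
    { carrier := {η | ∃ α : DiffForm I M n, α.IsSmooth ∧ α.extDeriv = η}
      add_mem' := by
        rintro _ _ ⟨α, hα, rfl⟩ ⟨β, hβ, rfl⟩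
        exact ⟨α + β, hα.add hβ, extDeriv_add hα hβ⟩
      zero_mem' := ⟨0, isSmooth_zero, extDeriv_zero⟩
      smul_mem' := by
        rintro c _ ⟨α, hα, rfl⟩
        exact ⟨c • α, hα.smul c, extDeriv_smul c α⟩ }

/-- The `n`-th de Rham cohomology of `M`: closed forms modulo exact forms. -/
abbrev deRhamCohomology (n : ℕ) : Type _ :=
  closedForms I M n ⧸ (exactForms I M n).comap (closedForms I M n).subtype

end

end DiffForm

end Forms

section Hermitian

variable {E : Type*} [NormedAddCommGroup E] [NormedSpace ℝ E] {H : Type*} [TopologicalSpace H]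
  (I : ModelWithCorners ℝ E H) (M : Type*) [TopologicalSpace M] [ChartedSpace H M]
  [IsManifold I ∞ M]

/-- A complex structure on a smooth manifold `M`: a smooth field `J` of endomorphisms of the tangent
spaces with `J² = -1` that is integrable, i.e. around each point there are smooth coordinates with
values in some `ℂⁿ` whose differential turns `J` into multiplication by `i`. -/
structure ComplexStructure where
  J (x : M) : TangentSpace I x →L[ℝ] TangentSpace I x
  J_J (x : M) (v : TangentSpace I x) : J x (J x v) = -v
  contMDiff : ContMDiff I (I.prod 𝓘(ℝ, E →L[ℝ] E)) ∞
    (fun x => Bundle.TotalSpace.mk' (E →L[ℝ] E)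
      (E := fun x : M => TangentSpace I x →L[ℝ] TangentSpace I x) x (J x))
  integrable (x : M) : ∃ (n : ℕ) (φ : OpenPartialHomeomorph M (Fin n → ℂ)), x ∈ φ.source ∧
    ContMDiffOn I 𝓘(ℝ, Fin n → ℂ) ∞ φ φ.source ∧
    ContMDiffOn 𝓘(ℝ, Fin n → ℂ) I ∞ φ.symm φ.target ∧
    ∀ y ∈ φ.source, ∀ v : TangentSpace I y,
      (mfderiv I 𝓘(ℝ, Fin n → ℂ) φ y (J y v) : Fin n → ℂ)
        = Complex.I • (show Fin n → ℂ from mfderiv I 𝓘(ℝ, Fin n → ℂ) φ y v)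

/-- A smooth Riemannian metric on `M`. -/
abbrev SmoothMetric : Type _ :=
  Bundle.ContMDiffRiemannianMetric I ∞ E (fun x : M => TangentSpace I x)

/-- A Hermitian structure on `M`: a Riemannian metric `g` and a complex structure `J` with
`g(J·, J·) = g`. -/
structure HermitianStructure where
  metric : SmoothMetric I M
  cplx : ComplexStructure I M
  compatible (x : M) (v w : TangentSpace I x) :
    metric.inner x (cplx.J x v) (cplx.J x w) = metric.inner x v w

namespace HermitianStructure

variable {I M} (S : HermitianStructure I M)

lemma inner_J_self (x : M) (v : TangentSpace I x) : S.metric.inner x (S.cplx.J x v) v = 0 := by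
  have h := S.compatible x (S.cplx.J x v) v
  rw [S.cplx.J_J, map_neg, neg_apply, S.metric.symm] at h
  linarith

/-- The fundamental form `ω(v, w) = g(J v, w)`. -/
def fundamentalForm : DiffForm I M 2 := fun x =>
  { toFun := fun v => S.metric.inner x (S.cplx.J x (v 0)) (v 1)
    map_update_add' := by
      intro inst v i a b
      rw [Subsingleton.elim inst (instDecidableEqFin 2)]
      fin_cases i <;> simp [Function.update]
    map_update_smul' := by
      intro inst v i c a
      rw [Subsingleton.elim inst (instDecidableEqFin 2)]
      fin_cases i <;> simp [Function.update]
    cont := by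
      have h : Continuous fun p : E × E =>
          (show E →L[ℝ] E →L[ℝ] ℝ from (S.metric.inner x).comp (S.cplx.J x)) p.1 p.2 :=
        ContinuousLinearMap.continuous₂ _
      have h' : Continuous fun v : Fin 2 → E => (v 0, v 1) := by fun_prop
      exact h.comp h'
    map_eq_zero_of_eq' := by
      intro v i j hv hij
      have h01 : v 0 = v 1 := by
        fin_cases i <;> fin_cases j <;> simp_all
      change S.metric.inner x (S.cplx.J x (v 0)) (v 1) = 0
      rw [← h01, inner_J_self] }

lemma fundamentalForm_apply (x : M) (v : Fin 2 → TangentSpace I x) :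
    S.fundamentalForm x v = S.metric.inner x (S.cplx.J x (v 0)) (v 1) := rfl

/-- The three-form `dᶜω = -J dω`, i.e. `(dᶜω)(u, v, w) = -dω(J u, J v, J w)`. -/
def dcFundamentalForm : DiffForm I M 3 := fun x =>
  -(S.fundamentalForm.extDeriv x).compContinuousLinearMap (S.cplx.J x)

end HermitianStructure

/-- A Kähler structure: a Hermitian structure whose fundamental form is closed. -/
structure KahlerStructure extends HermitianStructure I M where
  closed : toHermitianStructure.fundamentalForm.extDeriv = 0

/-- A diffeomorphism is holomorphic for the complex structure of `S` and an isometry for its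
metric. -/
structure KahlerStructure.IsHolomorphicIsometry {I : ModelWithCorners ℝ E H} {M : Type*}
    [TopologicalSpace M] [ChartedSpace H M] [IsManifold I ∞ M] (S : KahlerStructure I M)
    (ψ : M ≃ₘ⟮I, I⟯ M) : Prop where
  holomorphic (x : M) (v : TangentSpace I x) :
    mfderiv I I ψ x (S.cplx.J x v) = S.cplx.J (ψ x) (mfderiv I I ψ x v)
  isometry (x : M) (v w : TangentSpace I x) :
    S.metric.inner (ψ x) (mfderiv I I ψ x v) (mfderiv I I ψ x w) = S.metric.inner x v w

/-- A generalized Kähler structure `(I₊, I₋, h)`: a Riemannian metric `h` and two complex structures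
`I₊`, `I₋` compatible with `h` such that `d₊ᶜ Ω₊ = -d₋ᶜ Ω₋` and `d d₊ᶜ Ω₊ = 0`. -/
structure GeneralizedKahlerStructure where
  metric : SmoothMetric I M
  Iplus : ComplexStructure I M
  Iminus : ComplexStructure I M
  compatible_plus (x : M) (v w : TangentSpace I x) :
    metric.inner x (Iplus.J x v) (Iplus.J x w) = metric.inner x v w
  compatible_minus (x : M) (v w : TangentSpace I x) :
    metric.inner x (Iminus.J x v) (Iminus.J x w) = metric.inner x v w
  dc_plus_eq : (HermitianStructure.mk metric Iplus compatible_plus).dcFundamentalForm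
    = -(HermitianStructure.mk metric Iminus compatible_minus).dcFundamentalForm
  ddc_plus : (HermitianStructure.mk metric Iplus compatible_plus).dcFundamentalForm.extDeriv = 0

namespace GeneralizedKahlerStructure

variable {I M} (G : GeneralizedKahlerStructure I M)

/-- The torsion `d₊ᶜ Ω₊ = -d₋ᶜ Ω₋`. -/
def torsion : DiffForm I M 3 :=
  (HermitianStructure.mk G.metric G.Iplus G.compatible_plus).dcFundamentalForm

/-- The structure is split: `[I₊, I₋] = 0` and, at every point, `I₊ ≠ ± I₋`. Then the tangent bundle
is the direct sum of the two nonzero eigenbundles of the involution `I₊ I₋`. -/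
def IsSplit : Prop :=
  ∀ x : M, (G.Iplus.J x).comp (G.Iminus.J x) = (G.Iminus.J x).comp (G.Iplus.J x) ∧
    G.Iplus.J x ≠ G.Iminus.J x ∧ G.Iplus.J x ≠ -G.Iminus.J x

/-- The structure is twisted: the class of the torsion in the third de Rham cohomology is
nonzero. -/
def IsTwisted [I.Boundaryless] : Prop :=
  ∃ hT : G.torsion ∈ DiffForm.closedForms I M 3,
    (Submodule.Quotient.mk ⟨G.torsion, hT⟩ : DiffForm.deRhamCohomology I M 3) ≠ 0

end GeneralizedKahlerStructure

/-- `o` is the orientation of the real vector space `V` induced by the complex structure `J` on `V`: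
the one for which `v₁, J v₁, …, vₙ, J vₙ` is a positive basis whenever `v₁, …, vₙ` is a complex
basis. (All such real bases define the same orientation, so it suffices to have one.) -/
def IsInducedOrientation {V : Type*} [AddCommGroup V] [Module ℝ V] (J : V → V) {n : ℕ}
    (o : Orientation ℝ V (Fin n × Fin 2)) : Prop :=
  ∃ b : Module.Basis (Fin n × Fin 2) ℝ V, (∀ i, b (i, 1) = J (b (i, 0))) ∧ b.orientation = o

/-- `I₊` and `I₋` induce opposite orientations on (each tangent space of) `M`. -/
def GeneralizedKahlerStructure.InducesOppositeOrientations {I : ModelWithCorners ℝ E H} {M : Type*}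
    [TopologicalSpace M] [ChartedSpace H M] [IsManifold I ∞ M] (G : GeneralizedKahlerStructure I M) : Prop :=
  ∀ x : M, ∃ (n : ℕ) (o : Orientation ℝ (TangentSpace I x) (Fin n × Fin 2)),
    IsInducedOrientation (G.Iplus.J x) o ∧ IsInducedOrientation (G.Iminus.J x) (-o)

end Hermitian

/-- The unit sphere `S³` in `ℝ⁴`. -/
abbrev Sphere3 : Type := Metric.sphere (0 : EuclideanSpace ℝ (Fin (3 + 1))) 1

/-! The map `(p, q, t) ↦ (p, eᵗ q)` identifies `K × S³ × ℝ` with `K × (ℝ⁴ \ {0})`. The deck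
transformations become products of a power of `ψ` and a dilation by `eⁿ`, so tensors on `K × (ℝ⁴ \
{0})` that are invariant under holomorphic isometries of `K` and under dilations descend to `M_f`.
Take the metric `g + |z|⁻² ⟪·, ·⟫` and the complex structures `J ⊕ i_s`, `s = ±1`, where `i_1` and
`i_{-1}` are left and right multiplication by `i` on the quaternions. The latter commute, agree on
the plane spanned by `1, i` and are opposite on the plane spanned by `j, k`; hence the structure is
split and the two orientations are opposite.

Since `g` is Kähler, only the factor `ℝ⁴ \ {0}` contributes to `dΩ`. There `ω_s = |z|⁻² ⟪i_s ·, ·⟫`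
satisfies `dᶜω_s = s τ` with `τ = -2 |z|⁻⁴ det (z, ·, ·, ·)` (`R4.extDeriv_conformalForm_mulI`), and
`τ` is closed (`R4.extDeriv_sphereForm`). The factor `s` is exactly the sign required by the
generalized Kähler equations.

The torsion restricts to a slice `{p} × S³ × {0}` as a nonzero multiple of the volume form, so by
Stokes it is not exact. The integral is taken over a box parametrizing `S³`
(`sphereForm_sphereParam`, `integral_extDeriv_eq_zero`).

Descent is organized by `HopfAtlas`: tensors are defined chart by chart, and
`HopfAtlas.localJ_eq_of_transition` and `HopfAtlas.localMetric_eq_of_transition` make them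
independent of the chart. Exterior derivatives are then computed in a single chart, using that `d`
commutes with pullback (`DiffForm.extDeriv_pullback`). -/

section AlternatingMaps

/-! ### Smooth families of alternating maps. -/

variable {E : Type*} [NormedAddCommGroup E] [NormedSpace ℝ E] [FiniteDimensional ℝ E] {n : ℕ}

instance : FiniteDimensional ℝ (E [⋀^Fin n]→L[ℝ] ℝ) := by
  let b := Module.finBasis ℝ E
  let ev : (E [⋀^Fin n]→L[ℝ] ℝ) →ₗ[ℝ] ((Fin n → Fin (Module.finrank ℝ E)) → ℝ) :=
    { toFun := fun f s => f (fun i => b (s i))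
      map_add' := fun _ _ => rfl
      map_smul' := fun _ _ => rfl }
  refine FiniteDimensional.of_injective ev fun f g h => ?_
  apply ContinuousAlternatingMap.toAlternatingMap_injective
  exact Module.Basis.ext_alternating b fun s _ => congrFun h s

/-- A family of alternating maps on a finite-dimensional space is smooth if its values on all
constant vectors are. -/
lemma contDiffAt_alternatingMap_of_apply {X : Type*} [NormedAddCommGroup X] [NormedSpace ℝ X]
    {r : WithTop ℕ∞} {f : X → E [⋀^Fin n]→L[ℝ] ℝ} {x : X}
    (h : ∀ v : Fin n → E, ContDiffAt ℝ r (fun y => f y v) x) : ContDiffAt ℝ r f x := by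
  let b := Module.finBasis ℝ E
  let ev : (E [⋀^Fin n]→L[ℝ] ℝ) →ₗ[ℝ] ((Fin n → Fin (Module.finrank ℝ E)) → ℝ) :=
    { toFun := fun f s => f (fun i => b (s i))
      map_add' := fun _ _ => rfl
      map_smul' := fun _ _ => rfl }
  have hev : LinearMap.ker ev = ⊥ := LinearMap.ker_eq_bot.2 fun f g h =>
    ContinuousAlternatingMap.toAlternatingMap_injective
      (Module.Basis.ext_alternating b fun s _ => congrFun h s)
  -- A linear left inverse of the evaluation on basis tuples recovers `f` from finitely many smooth
  -- scalar functions.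
  obtain ⟨g, hg⟩ := ev.exists_leftInverse_of_injective hev
  have h1 : ContDiffAt ℝ r (fun y => ev (f y)) x := contDiffAt_pi.2 fun s => h _
  have h2 : f = fun y => LinearMap.toContinuousLinearMap g (ev (f y)) := by
    funext y
    exact (LinearMap.congr_fun hg (f y)).symm
  rw [h2]
  exact (LinearMap.toContinuousLinearMap g).contDiff.contDiffAt.comp x h1

/-- Tested on fixed vectors, the pullback is the evaluation `(f, w) ↦ f w` along a smooth path of
pairs, and that evaluation is analytic because it is multilinear in `w` and linear in `f`. -/
lemma contDiffAt_compContinuousLinearMap {X F : Type*} [NormedAddCommGroup X] [NormedSpace ℝ X]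
    [NormedAddCommGroup F] [NormedSpace ℝ F]
    {r : WithTop ℕ∞} {f : X → F [⋀^Fin n]→L[ℝ] ℝ} {g : X → E →L[ℝ] F} {x : X}
    (hf : ContDiffAt ℝ r f x) (hg : ContDiffAt ℝ r g x) :
    ContDiffAt ℝ r (fun y => (f y).compContinuousLinearMap (g y)) x := by
  refine contDiffAt_alternatingMap_of_apply fun v => ?_
  have h1 : ContDiffAt ℝ r (fun y => (f y).toContinuousMultilinearMap) x :=
    (ContinuousAlternatingMap.toContinuousMultilinearMapCLM ℝ :
      (F [⋀^Fin n]→L[ℝ] ℝ) →L[ℝ] _).contDiff.contDiffAt.comp x hf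
  have h2 : ContDiffAt ℝ r (fun y => fun i : Fin n => g y (v i)) x :=
    contDiffAt_pi.2 fun i => hg.clm_apply contDiffAt_const
  have h3 := ((ContinuousLinearMap.id ℝ
    (ContinuousMultilinearMap ℝ (fun _ : Fin n => F) ℝ)).analyticAt_uncurry_of_multilinear
      (x := ((f x).toContinuousMultilinearMap, fun i => g x (v i)))).contDiffAt (n := r)
  exact h3.comp x (h1.prodMk h2)

end AlternatingMaps

/-! ### Pullback of differential forms and its commutation with `d`. -/

namespace DiffForm

variable {E : Type*} [NormedAddCommGroup E] [NormedSpace ℝ E] {H : Type*} [TopologicalSpace H]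
  {I : ModelWithCorners ℝ E H} {M : Type*} [TopologicalSpace M] [ChartedSpace H M]
  {E' : Type*} [NormedAddCommGroup E'] [NormedSpace ℝ E'] {H' : Type*} [TopologicalSpace H']
  {I' : ModelWithCorners ℝ E' H'} {N : Type*} [TopologicalSpace N] [ChartedSpace H' N]
  {n : ℕ}

/-- The pullback of a differential form. -/
def pullback (I : ModelWithCorners ℝ E H) (f : M → N) (α : DiffForm I' N n) : DiffForm I M n :=
  fun x => (α (f x)).compContinuousLinearMap (mfderiv I I' f x)

/-- The two values have different types, so they are compared in the model space `E`, to which every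
tangent space unfolds. -/
lemma apply_congr (α : DiffForm I M n) {x y : M} (h : x = y) :
    (α x : E [⋀^Fin n]→L[ℝ] ℝ) = α y := by
  subst h; rfl

lemma inChart_congr {α β : DiffForm I M n} {x x₀ : M} (hx : x ∈ (extChartAt I x₀).source)
    (h : ∀ᶠ y in 𝓝 x, α y = β y) :
    α.inChart x₀ =ᶠ[𝓝 (extChartAt I x₀ x)] β.inChart x₀ := by
  have hc : ContinuousAt (extChartAt I x₀).symm (extChartAt I x₀ x) :=
    continuousAt_extChartAt_symm' hx
  have h' : ∀ᶠ y in 𝓝 ((extChartAt I x₀).symm (extChartAt I x₀ x)), α y = β y := by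
    rwa [(extChartAt I x₀).left_inv hx]
  filter_upwards [hc.eventually h'] with y hy
  simp only [inChart, hy]

lemma extDeriv_congr {α β : DiffForm I M n} {x : M} (h : ∀ᶠ y in 𝓝 x, α y = β y) :
    α.extDeriv x = β.extDeriv x := by
  simp only [extDeriv, (inChart_congr (mem_extChartAt_source x) h).extDeriv_eq]

/-- The pointwise form is needed because pullbacks by a local chart are controlled only on its
source. -/
lemma extDeriv_add_of_differentiableAt {α β : DiffForm I M n} {x : M}
    (hα : DifferentiableAt ℝ (α.inChart x) (extChartAt I x x))
    (hβ : DifferentiableAt ℝ (β.inChart x) (extChartAt I x x)) :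
    (α + β).extDeriv x = α.extDeriv x + β.extDeriv x := by
  simp only [extDeriv, inChart_add, _root_.extDeriv_add hα hβ]
  rfl

lemma pullback_comp {E'' : Type*} [NormedAddCommGroup E''] [NormedSpace ℝ E''] {H'' : Type*}
    [TopologicalSpace H''] {I'' : ModelWithCorners ℝ E'' H''} {Q : Type*} [TopologicalSpace Q]
    [ChartedSpace H'' Q] {f : M → N} {g : N → Q} {α : DiffForm I'' Q n} {x : M}
    (hg : MDifferentiableAt I' I'' g (f x)) (hf : MDifferentiableAt I I' f x) :
    pullback I (fun y => g (f y)) α x = pullback I f (pullback I' g α) x := by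
  ext v
  have := mfderiv_comp x hg hf
  change (α (g (f x))) (fun i => mfderiv I I'' (g ∘ f) x (v i)) = _
  rw [this]
  rfl

lemma pullback_congr {f g : M → N} {α : DiffForm I' N n} {x : M} (h : f =ᶠ[𝓝 x] g) :
    pullback I f α x = pullback I g α x := by
  ext v
  have e1 : (mfderiv I I' f x : E →L[ℝ] E') = mfderiv I I' g x := h.mfderiv_eq
  have e2 := apply_congr α h.self_of_nhds
  change (α (f x) : E' [⋀^Fin n]→L[ℝ] ℝ) (fun i => (mfderiv I I' f x : E →L[ℝ] E') (v i)) = _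
  rw [e1, e2]
  rfl

section

variable [I.Boundaryless] [IsManifold I ∞ M] [I'.Boundaryless] [IsManifold I' ∞ N]

/-- The expression of a pullback in charts is the pullback of the expression in charts by the
expression of the map in charts. -/
lemma inChart_pullback_eventuallyEq {f : M → N} {x x₀ : M} {y₀ : N} (α : DiffForm I' N n)
    (hx : x ∈ (extChartAt I x₀).source) (hfx : f x ∈ (extChartAt I' y₀).source)
    (hf : ContMDiffAt I I' ∞ f x) :
    (pullback I f α).inChart x₀ =ᶠ[𝓝 (extChartAt I x₀ x)] fun y =>
      (α.inChart y₀ (extChartAt I' y₀ (f ((extChartAt I x₀).symm y)))).compContinuousLinearMap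
        (fderiv ℝ (fun y => extChartAt I' y₀ (f ((extChartAt I x₀).symm y))) y) := by
  have hc : ContinuousAt (extChartAt I x₀).symm (extChartAt I x₀ x) :=
    continuousAt_extChartAt_symm' hx
  have hleft := (extChartAt I x₀).left_inv hx
  have hf1 : ∀ᶠ z in 𝓝 x, ContMDiffAt I I' 1 f z :=
    (contMDiffAt_iff_contMDiffAt_nhds (by simp)).1 (hf.of_le (by simp))
  -- The identity `e1` below is to be differentiated, so it has to hold on a neighbourhood of each
  -- nearby point, not just at the point.
  have hf2 : ∀ᶠ z in 𝓝 x, ∀ᶠ w in 𝓝 z, f w ∈ (extChartAt I' y₀).source :=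
    (hf.continuousAt.eventually (extChartAt_source_mem_nhds' hfx)).eventually_nhds
  have ht : ∀ᶠ y in 𝓝 (extChartAt I x₀ x), y ∈ (extChartAt I x₀).target :=
    extChartAt_target_mem_nhds' ((extChartAt I x₀).map_source hx)
  rw [← hleft] at hf1 hf2
  filter_upwards [hc.eventually hf1, hc.eventually hf2, ht] with y h1 h2 h3
  have hφ : MDifferentiableAt 𝓘(ℝ, E) I (extChartAt I x₀).symm y :=
    ((contMDiffOn_extChartAt_symm (n := 1) x₀).contMDiffAt
      ((isOpen_extChartAt_target x₀).mem_nhds h3)).mdifferentiableAt one_ne_zero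
  set z := (extChartAt I x₀).symm y with hz
  have hfz : f z ∈ (extChartAt I' y₀).source := h2.self_of_nhds
  have hψ : MDifferentiableAt I' 𝓘(ℝ, E') (extChartAt I' y₀) (f z) :=
    (contMDiffAt_extChartAt' (n := 1) (by simpa using hfz)).mdifferentiableAt one_ne_zero
  have hψ' : MDifferentiableAt 𝓘(ℝ, E') I' (extChartAt I' y₀).symm (extChartAt I' y₀ (f z)) :=
    ((contMDiffOn_extChartAt_symm (n := 1) y₀).contMDiffAt
      ((isOpen_extChartAt_target y₀).mem_nhds
        ((extChartAt I' y₀).map_source hfz))).mdifferentiableAt one_ne_zero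
  have hfd := h1.mdifferentiableAt one_ne_zero
  have hg : MDifferentiableAt 𝓘(ℝ, E) 𝓘(ℝ, E')
      (fun y => extChartAt I' y₀ (f ((extChartAt I x₀).symm y))) y :=
    hψ.comp y (hfd.comp y hφ)
  have e1 : (fun y => f ((extChartAt I x₀).symm y)) =ᶠ[𝓝 y]
      fun y => (extChartAt I' y₀).symm (extChartAt I' y₀ (f ((extChartAt I x₀).symm y))) := by
    have : ContinuousAt (extChartAt I x₀).symm y := hφ.continuousAt
    filter_upwards [this.eventually h2] with w hw
    exact ((extChartAt I' y₀).left_inv hw).symm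
  -- Two factorizations of the derivative of `f` read in the source chart: directly, and through the
  -- target chart and its inverse.
  have e2 : (mfderiv I I' f z).comp (mfderiv 𝓘(ℝ, E) I (extChartAt I x₀).symm y)
      = (mfderiv 𝓘(ℝ, E') I' (extChartAt I' y₀).symm (extChartAt I' y₀ (f z))).comp
        (fderiv ℝ (fun y => extChartAt I' y₀ (f ((extChartAt I x₀).symm y))) y) := by
    have a1 := mfderiv_comp y hfd hφ
    have a2 := mfderiv_comp y hψ' hg
    have a3 := e1.mfderiv_eq (I := 𝓘(ℝ, E)) (I' := I')
    rw [mfderiv_eq_fderiv] at a2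
    exact a1.symm.trans (a3.trans a2)
  have e3 := apply_congr α ((extChartAt I' y₀).left_inv hfz)
  ext v
  change (α (f z) : E' [⋀^Fin n]→L[ℝ] ℝ) (fun i => ((mfderiv I I' f z).comp
    (mfderiv 𝓘(ℝ, E) I (extChartAt I x₀).symm y)) (v i)) = _
  rw [e2, ← e3]
  rfl

omit [I'.Boundaryless] in
lemma contDiffAt_inChart_comp {f : M → N} {x x₀ : M} {y₀ : N}
    (hx : x ∈ (extChartAt I x₀).source) (hfx : f x ∈ (extChartAt I' y₀).source)
    (hf : ContMDiffAt I I' ∞ f x) :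
    ContDiffAt ℝ ∞ (fun y => extChartAt I' y₀ (f ((extChartAt I x₀).symm y)))
      (extChartAt I x₀ x) := by
  rw [← contMDiffAt_iff_contDiffAt]
  have h1 : ContMDiffAt 𝓘(ℝ, E) I ∞ (extChartAt I x₀).symm (extChartAt I x₀ x) :=
    (contMDiffOn_extChartAt_symm x₀).contMDiffAt (extChartAt_target_mem_nhds' ((extChartAt I x₀).map_source hx))
  have h2 : ContMDiffAt I' 𝓘(ℝ, E') ∞ (extChartAt I' y₀) (f x) :=
    contMDiffAt_extChartAt' (by simpa using hfx)
  have hl := (extChartAt I x₀).left_inv hx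
  have h3 : ContMDiffAt I 𝓘(ℝ, E') ∞ (fun z => extChartAt I' y₀ (f z)) x := h2.comp x hf
  rw [← hl] at h3
  exact h3.comp _ h1

lemma contDiffAt_inChart_pullback [FiniteDimensional ℝ E] {f : M → N} {x x₀ : M} {y₀ : N}
    {α : DiffForm I' N n} (hx : x ∈ (extChartAt I x₀).source)
    (hfx : f x ∈ (extChartAt I' y₀).source) (hf : ContMDiffAt I I' ∞ f x)
    (hα : ContDiffAt ℝ ∞ (α.inChart y₀) (extChartAt I' y₀ (f x))) :
    ContDiffAt ℝ ∞ ((pullback I f α).inChart x₀) (extChartAt I x₀ x) := by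
  have h := contDiffAt_inChart_comp hx hfx hf
  refine ContDiffAt.congr_of_eventuallyEq ?_ (inChart_pullback_eventuallyEq α hx hfx hf)
  have hl := (extChartAt I x₀).left_inv hx
  refine contDiffAt_compContinuousLinearMap ?_ (h.fderiv_right (m := ∞) (by simp))
  refine ContDiffAt.comp (g := α.inChart y₀) _ ?_ h
  rwa [hl]

/-- The exterior derivative commutes with pullbacks. -/
lemma extDeriv_pullback {f : M → N} {x : M} {α : DiffForm I' N n}
    (hf : ContMDiffAt I I' ∞ f x)
    (hα : DifferentiableAt ℝ (α.inChart (f x)) (extChartAt I' (f x) (f x))) :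
    (pullback I f α).extDeriv x = pullback I f α.extDeriv x := by
  have hx := mem_extChartAt_source (I := I) x
  have hfx := mem_extChartAt_source (I := I') (f x)
  have h := contDiffAt_inChart_comp hx hfx hf
  have hl := (extChartAt I x).left_inv hx
  have e := (inChart_pullback_eventuallyEq α hx hfx hf).extDeriv_eq
  have hα' : DifferentiableAt ℝ (α.inChart (f x))
      ((fun y => extChartAt I' (f x) (f ((extChartAt I x).symm y))) (extChartAt I x x)) := by
    simpa only [hl] using hα
  -- In coordinates this is the vector space statement; over `ℝ` it asks for two derivatives of the
  -- map.
  have e' := _root_.extDeriv_pullback (r := ∞)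
    (f := fun y => extChartAt I' (f x) (f ((extChartAt I x).symm y))) hα' h
    (by rw [minSmoothness_of_isRCLikeNormedField]; exact WithTop.coe_le_coe.2 (le_top : (2 : ℕ∞) ≤ ⊤))
  rw [e'] at e
  have hfd := hf.mdifferentiableAt (by simp)
  have hg : MDifferentiableAt 𝓘(ℝ, E) 𝓘(ℝ, E')
      (fun y => extChartAt I' (f x) (f ((extChartAt I x).symm y))) (extChartAt I x x) :=
    (h.differentiableAt (by simp)).mdifferentiableAt
  have hφ : MDifferentiableAt I 𝓘(ℝ, E) (extChartAt I x) x :=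
    (contMDiffAt_extChartAt (n := 1)).mdifferentiableAt one_ne_zero
  have hψ : MDifferentiableAt I' 𝓘(ℝ, E') (extChartAt I' (f x)) (f x) :=
    (contMDiffAt_extChartAt (n := 1)).mdifferentiableAt one_ne_zero
  have e1 : (fun z => extChartAt I' (f x) (f ((extChartAt I x).symm (extChartAt I x z))))
      =ᶠ[𝓝 x] fun z => extChartAt I' (f x) (f z) := by
    filter_upwards [extChartAt_source_mem_nhds (I := I) x] with z hz
    rw [(extChartAt I x).left_inv hz]
  have e2 : (fderiv ℝ (fun y => extChartAt I' (f x) (f ((extChartAt I x).symm y)))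
        (extChartAt I x x)).comp (mfderiv I 𝓘(ℝ, E) (extChartAt I x) x)
      = (mfderiv I' 𝓘(ℝ, E') (extChartAt I' (f x)) (f x)).comp (mfderiv I I' f x) := by
    have a1 := mfderiv_comp x hg hφ
    have a2 := mfderiv_comp x hψ hfd
    have a3 := e1.mfderiv_eq (I := I) (I' := 𝓘(ℝ, E'))
    rw [mfderiv_eq_fderiv] at a1
    exact a1.symm.trans (a3.trans a2)
  ext v
  simp only [extDeriv, e]
  change (_root_.extDeriv (α.inChart (f x)) (extChartAt I' (f x) (f ((extChartAt I x).symm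
    (extChartAt I x x))))) (fun i => ((fderiv ℝ (fun y => extChartAt I' (f x)
      (f ((extChartAt I x).symm y))) (extChartAt I x x)).comp
        (mfderiv I 𝓘(ℝ, E) (extChartAt I x) x)) (v i)) = _
  rw [e2, hl]
  rfl

end

/-- A form on a vector space, as a differential form on the corresponding manifold. -/
def ofFun (β : E → E [⋀^Fin n]→L[ℝ] ℝ) : DiffForm 𝓘(ℝ, E) E n := β

lemma inChart_ofFun (β : E → E [⋀^Fin n]→L[ℝ] ℝ) (x₀ : E) : (ofFun β).inChart x₀ = β := by
  funext y
  ext v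
  have : mfderiv 𝓘(ℝ, E) 𝓘(ℝ, E) (extChartAt 𝓘(ℝ, E) x₀).symm y = ContinuousLinearMap.id ℝ E := by
    rw [extChartAt_model_space_eq_id]
    exact mfderiv_id
  change (β y) (fun i => mfderiv 𝓘(ℝ, E) 𝓘(ℝ, E) (extChartAt 𝓘(ℝ, E) x₀).symm y (v i)) = _
  rw [this]
  rfl

lemma extDeriv_ofFun (β : E → E [⋀^Fin n]→L[ℝ] ℝ) :
    (ofFun β).extDeriv = ofFun (_root_.extDeriv β) := by
  funext x
  ext v
  have : mfderiv 𝓘(ℝ, E) 𝓘(ℝ, E) (extChartAt 𝓘(ℝ, E) x) x = ContinuousLinearMap.id ℝ E := by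
    rw [extChartAt_model_space_eq_id]
    exact mfderiv_id
  simp only [extDeriv, this, inChart_ofFun]
  rfl

end DiffForm

/-! ### Smoothness of tensor fields in tangent trivializations. -/

section TangentCoordinates

open Bundle

variable {E : Type*} [NormedAddCommGroup E] [NormedSpace ℝ E] {H : Type*} [TopologicalSpace H]
  {I : ModelWithCorners ℝ E H} {M : Type*} [TopologicalSpace M] [ChartedSpace H M]
  [IsManifold I ∞ M]
  {E₁ : Type*} [NormedAddCommGroup E₁] [NormedSpace ℝ E₁] {H₁ : Type*} [TopologicalSpace H₁]
  {I₁ : ModelWithCorners ℝ E₁ H₁} {M₁ : Type*} [TopologicalSpace M₁] [ChartedSpace H₁ M₁]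
  [IsManifold I₁ ∞ M₁]
  {E₂ : Type*} [NormedAddCommGroup E₂] [NormedSpace ℝ E₂] {H₂ : Type*} [TopologicalSpace H₂]
  {I₂ : ModelWithCorners ℝ E₂ H₂} {M₂ : Type*} [TopologicalSpace M₂] [ChartedSpace H₂ M₂]
  [IsManifold I₂ ∞ M₂]
  {E₃ : Type*} [NormedAddCommGroup E₃] [NormedSpace ℝ E₃] {H₃ : Type*} [TopologicalSpace H₃]
  {I₃ : ModelWithCorners ℝ E₃ H₃} {M₃ : Type*} [TopologicalSpace M₃] [ChartedSpace H₃ M₃]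
  [IsManifold I₃ ∞ M₃]

/-- The intermediate trivialization cancels against its inverse, which requires `g x` to lie in the
chart domain at `g x₀`. -/
lemma inTangentCoordinates_comp {X : Type*} {f : X → M₁} {g : X → M₂} {k : X → M₃}
    (φ : ∀ b, TangentSpace I₁ (f b) →L[ℝ] TangentSpace I₂ (g b))
    (χ : ∀ b, TangentSpace I₂ (g b) →L[ℝ] TangentSpace I₃ (k b)) {x₀ x : X}
    (hx : g x ∈ (chartAt H₂ (g x₀)).source) :
    inTangentCoordinates I₁ I₃ f k (fun b => (χ b).comp (φ b)) x₀ x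
      = (inTangentCoordinates I₂ I₃ g k χ x₀ x).comp
        (inTangentCoordinates I₁ I₂ f g φ x₀ x) := by
  ext v
  simp only [inTangentCoordinates, ContinuousLinearMap.inCoordinates,
    ContinuousLinearMap.comp_apply]
  rw [Trivialization.symmL_continuousLinearMapAt _ (by simpa using hx)]
  rfl

omit [IsManifold I ∞ M] in
lemma ContMDiffAt.inTangentCoordinates_comp {f : M → M₁} {g : M → M₂} {k : M → M₃}
    {φ : ∀ b, TangentSpace I₁ (f b) →L[ℝ] TangentSpace I₂ (g b)}
    {χ : ∀ b, TangentSpace I₂ (g b) →L[ℝ] TangentSpace I₃ (k b)} {x₀ : M}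
    (hχ : ContMDiffAt I 𝓘(ℝ, E₂ →L[ℝ] E₃) ∞ (inTangentCoordinates I₂ I₃ g k χ x₀) x₀)
    (hφ : ContMDiffAt I 𝓘(ℝ, E₁ →L[ℝ] E₂) ∞ (inTangentCoordinates I₁ I₂ f g φ x₀) x₀)
    (hg : ContinuousAt g x₀) :
    ContMDiffAt I 𝓘(ℝ, E₁ →L[ℝ] E₃) ∞
      (inTangentCoordinates I₁ I₃ f k (fun b => (χ b).comp (φ b)) x₀) x₀ := by
  refine (hχ.clm_comp hφ).congr_of_eventuallyEq ?_
  filter_upwards [hg (chart_source_mem_nhds H₂ (g x₀))] with x hx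
  exact _root_.inTangentCoordinates_comp φ χ hx

lemma inTangentCoordinates_add {X : Type*} {f : X → M₁} {g : X → M₂}
    (φ χ : ∀ b, TangentSpace I₁ (f b) →L[ℝ] TangentSpace I₂ (g b)) (x₀ x : X) :
    inTangentCoordinates I₁ I₂ f g (fun b => φ b + χ b) x₀ x
      = inTangentCoordinates I₁ I₂ f g φ x₀ x + inTangentCoordinates I₁ I₂ f g χ x₀ x := by
  ext v
  simp only [inTangentCoordinates, ContinuousLinearMap.inCoordinates,
    ContinuousLinearMap.comp_apply, add_apply]
  exact map_add _ _ _

lemma contMDiffAt_endomorphism_iff {A : ∀ x : M, TangentSpace I x →L[ℝ] TangentSpace I x} {x₀ : M} :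
    ContMDiffAt I (I.prod 𝓘(ℝ, E →L[ℝ] E)) ∞ (fun x => TotalSpace.mk' (E →L[ℝ] E)
      (E := fun x : M => TangentSpace I x →L[ℝ] TangentSpace I x) x (A x)) x₀ ↔
    ContMDiffAt I 𝓘(ℝ, E →L[ℝ] E) ∞ (inTangentCoordinates I I id id A x₀) x₀ := by
  rw [contMDiffAt_hom_bundle]
  exact ⟨fun h => h.2, fun h => ⟨contMDiffAt_id, h⟩⟩

/-- A field of bilinear forms on the tangent spaces, in the coordinates around `x₀`. -/
def bilinInCoordinates (b : ∀ x : M, TangentSpace I x →L[ℝ] TangentSpace I x →L[ℝ] ℝ) (x₀ x : M) :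
    E →L[ℝ] E →L[ℝ] ℝ :=
  (show E →L[ℝ] E →L[ℝ] ℝ from b x).bilinearComp
    (show E →L[ℝ] E from (trivializationAt E (TangentSpace I) x₀).symmL ℝ x)
    (show E →L[ℝ] E from (trivializationAt E (TangentSpace I) x₀).symmL ℝ x)

lemma bilinInCoordinates_apply (b : ∀ x : M, TangentSpace I x →L[ℝ] TangentSpace I x →L[ℝ] ℝ)
    (x₀ x : M) (u v : E) : bilinInCoordinates b x₀ x u v =
      b x ((trivializationAt E (TangentSpace I) x₀).symmL ℝ x u)
        ((trivializationAt E (TangentSpace I) x₀).symmL ℝ x v) := rfl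

/-- The pullback of a bilinear form on a tangent space by a linear map between tangent spaces. -/
def bilinPullback {x : M} {y : M₁} (b : TangentSpace I₁ y →L[ℝ] TangentSpace I₁ y →L[ℝ] ℝ)
    (φ : TangentSpace I x →L[ℝ] TangentSpace I₁ y) :
    TangentSpace I x →L[ℝ] TangentSpace I x →L[ℝ] ℝ :=
  ContinuousLinearMap.bilinearComp (E := E₁) (F := E₁) (G := ℝ) (E' := E) (F' := E) b φ φ

/-- Near `x₀` the trivialization of the iterated hom bundle only transports the two arguments, since
the target bundle is trivial. -/
lemma contMDiffAt_bilin_iff {b : ∀ x : M, TangentSpace I x →L[ℝ] TangentSpace I x →L[ℝ] ℝ}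
    {x₀ : M} :
    ContMDiffAt I (I.prod 𝓘(ℝ, E →L[ℝ] E →L[ℝ] ℝ)) ∞ (fun x => TotalSpace.mk' (E →L[ℝ] E →L[ℝ] ℝ)
      (E := fun x : M => TangentSpace I x →L[ℝ] TangentSpace I x →L[ℝ] ℝ) x (b x)) x₀ ↔
    ContMDiffAt I 𝓘(ℝ, E →L[ℝ] E →L[ℝ] ℝ) ∞ (bilinInCoordinates b x₀) x₀ := by
  rw [contMDiffAt_hom_bundle]
  have : (fun x => ContinuousLinearMap.inCoordinates E (TangentSpace I) (E →L[ℝ] ℝ)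
      (fun x : M => TangentSpace I x →L[ℝ] ℝ) x₀ x x₀ x (b x)) =ᶠ[𝓝 x₀]
      bilinInCoordinates b x₀ := by
    filter_upwards [chart_source_mem_nhds H x₀] with x hx
    ext u v
    have h := inCoordinates_apply_eq₂ (F₁ := E) (E₁ := fun x : M => TangentSpace I x)
      (F₂ := E) (E₂ := fun x : M => TangentSpace I x) (F₃ := ℝ) (E₃ := Bundle.Trivial M ℝ)
      (x₀ := x₀) (x := x) (ϕ := b x) (v := u) (w := v) (by simpa using hx) (by simpa using hx)
      (by simp)
    refine h.trans ?_
    rw [bilinInCoordinates_apply, Trivialization.linearMapAt_apply]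
    have hs : ∀ w : E, (trivializationAt E (TangentSpace I) x₀).symmL ℝ x w
      = (trivializationAt E (TangentSpace I) x₀).symm x w := fun w =>
        Trivialization.symmL_apply _ (by simpa using hx) _
    rw [hs, hs]
    simp
  constructor
  · exact fun h => h.2.congr_of_eventuallyEq this.symm
  · exact fun h => ⟨contMDiffAt_id, h.congr_of_eventuallyEq this⟩

omit [IsManifold I ∞ M] in
-- Each argument is treated by a composition of linear maps; flipping, a continuous linear
-- operation, exchanges the arguments.
lemma ContMDiffAt.bilinearComp {b : M → E₁ →L[ℝ] E₁ →L[ℝ] ℝ} {φ χ : M → E₂ →L[ℝ] E₁} {x₀ : M}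
    (hb : ContMDiffAt I 𝓘(ℝ, E₁ →L[ℝ] E₁ →L[ℝ] ℝ) ∞ b x₀)
    (hφ : ContMDiffAt I 𝓘(ℝ, E₂ →L[ℝ] E₁) ∞ φ x₀) (hχ : ContMDiffAt I 𝓘(ℝ, E₂ →L[ℝ] E₁) ∞ χ x₀) :
    ContMDiffAt I 𝓘(ℝ, E₂ →L[ℝ] E₂ →L[ℝ] ℝ) ∞ (fun x => (b x).bilinearComp (φ x) (χ x)) x₀ := by
  have h1 := hb.clm_comp hφ
  have f1 : ContMDiffAt I 𝓘(ℝ, E₁ →L[ℝ] E₂ →L[ℝ] ℝ) ∞ (fun x => ((b x).comp (φ x)).flip) x₀ :=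
    (ContinuousLinearMap.flipₗᵢ ℝ E₂ E₁ ℝ).toContinuousLinearEquiv.contDiff.contMDiff.contMDiffAt.comp
      x₀ h1
  have h2 := f1.clm_comp hχ
  exact (ContinuousLinearMap.flipₗᵢ ℝ E₂ E₂ ℝ).toContinuousLinearEquiv.contDiff.contMDiff.contMDiffAt.comp
      x₀ h2

/-- The pullback of a smooth field of bilinear forms by a smooth bundle map is smooth. -/
lemma contMDiffAt_bilinInCoordinates_pullback
    {b : ∀ x : M₁, TangentSpace I₁ x →L[ℝ] TangentSpace I₁ x →L[ℝ] ℝ} {P : M → M₁}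
    {φ : ∀ x : M, TangentSpace I x →L[ℝ] TangentSpace I₁ (P x)} {x₀ : M}
    (hb : ContMDiffAt I₁ 𝓘(ℝ, E₁ →L[ℝ] E₁ →L[ℝ] ℝ) ∞ (bilinInCoordinates b (P x₀)) (P x₀))
    (hφ : ContMDiffAt I 𝓘(ℝ, E →L[ℝ] E₁) ∞ (inTangentCoordinates I I₁ id P φ x₀) x₀)
    (hP : ContMDiffAt I I₁ ∞ P x₀) :
    ContMDiffAt I 𝓘(ℝ, E →L[ℝ] E →L[ℝ] ℝ) ∞
      (bilinInCoordinates (fun x => bilinPullback (b (P x)) (φ x)) x₀) x₀ := by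
  refine (ContMDiffAt.bilinearComp (hb.comp x₀ hP) hφ hφ).congr_of_eventuallyEq ?_
  filter_upwards [hP.continuousAt (chart_source_mem_nhds H₁ (P x₀))] with x hx
  ext u v
  have hx' : P x ∈ (trivializationAt E₁ (TangentSpace I₁) (P x₀)).baseSet := by simpa using hx
  -- The trivialization at `P x₀`, followed by its inverse, may be inserted in front of both
  -- arguments of `b`.
  have key : ∀ w : TangentSpace I₁ (P x),
      (trivializationAt E₁ (TangentSpace I₁) (P x₀)).symmL ℝ (P x)
        ((trivializationAt E₁ (TangentSpace I₁) (P x₀)).continuousLinearMapAt ℝ (P x) w) = w :=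
    fun w => Trivialization.symmL_continuousLinearMapAt _ hx' w
  change b (P x) _ _ = b (P x) ((trivializationAt E₁ (TangentSpace I₁) (P x₀)).symmL ℝ (P x)
        ((trivializationAt E₁ (TangentSpace I₁) (P x₀)).continuousLinearMapAt ℝ (P x) _))
          ((trivializationAt E₁ (TangentSpace I₁) (P x₀)).symmL ℝ (P x)
        ((trivializationAt E₁ (TangentSpace I₁) (P x₀)).continuousLinearMapAt ℝ (P x) _))
  rw [key, key]
  rfl

/-- Smoothness at the centre of the preferred chart suffices, because `extDeriv` at a point is
computed in the chart at that same point. -/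
lemma HermitianStructure.contDiffAt_fundamentalForm_inChart [FiniteDimensional ℝ E]
    [I.Boundaryless] (S : HermitianStructure I M) (x₀ : M) :
    ContDiffAt ℝ ∞ (S.fundamentalForm.inChart x₀) (extChartAt I x₀ x₀) := by
  have hg := contMDiffAt_bilin_iff.1 (S.metric.contMDiff x₀)
  have hJ := contMDiffAt_endomorphism_iff.1 (S.cplx.contMDiff x₀)
  have hσ : ContMDiffAt 𝓘(ℝ, E) I ∞ (extChartAt I x₀).symm (extChartAt I x₀ x₀) :=
    (contMDiffOn_extChartAt_symm x₀).contMDiffAt (extChartAt_target_mem_nhds x₀)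
  have hl : (extChartAt I x₀).symm (extChartAt I x₀ x₀) = x₀ := extChartAt_to_inv x₀
  refine contDiffAt_alternatingMap_of_apply fun v => ?_
  have h1 : ContMDiffAt I 𝓘(ℝ, ℝ) ∞ (fun x => bilinInCoordinates S.metric.inner x₀ x
      (inTangentCoordinates I I id id S.cplx.J x₀ x (v 0)) (v 1)) x₀ :=
    (hg.clm_apply (hJ.clm_apply contMDiffAt_const)).clm_apply contMDiffAt_const
  rw [← contMDiffAt_iff_contDiffAt]
  refine (h1.comp_of_eq hσ hl).congr_of_eventuallyEq ?_
  filter_upwards [extChartAt_target_mem_nhds (I := I) x₀] with y hy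
  have hs : (extChartAt I x₀).symm y ∈ (chartAt H x₀).source := by
    simpa using (extChartAt I x₀).map_target hy
  -- The inverse trivialization of the tangent bundle is the derivative of the inverse chart, which
  -- links bundle coordinates to `inChart`.
  have e1 : (trivializationAt E (TangentSpace I) x₀).symmL ℝ ((extChartAt I x₀).symm y)
      = mfderiv 𝓘(ℝ, E) I (extChartAt I x₀).symm y := by
    rw [TangentBundle.symmL_trivializationAt hs, I.range_eq_univ, mfderivWithin_univ,
      (extChartAt I x₀).right_inv hy]
  have key : ∀ w : TangentSpace I ((extChartAt I x₀).symm y),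
      (trivializationAt E (TangentSpace I) x₀).symmL ℝ ((extChartAt I x₀).symm y)
        ((trivializationAt E (TangentSpace I) x₀).continuousLinearMapAt ℝ
          ((extChartAt I x₀).symm y) w) = w :=
    fun w => Trivialization.symmL_continuousLinearMapAt _ (by simpa using hs) w
  change S.metric.inner _ (S.cplx.J _ (mfderiv 𝓘(ℝ, E) I (extChartAt I x₀).symm y (v 0)))
      (mfderiv 𝓘(ℝ, E) I (extChartAt I x₀).symm y (v 1)) = S.metric.inner _
      ((trivializationAt E (TangentSpace I) x₀).symmL ℝ ((extChartAt I x₀).symm y)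
        ((trivializationAt E (TangentSpace I) x₀).continuousLinearMapAt ℝ
          ((extChartAt I x₀).symm y) _)) _
  rw [key, ← e1]
  rfl

end TangentCoordinates

/-! ### The dilation-invariant model on `ℝ⁴ \ {0}`. -/

section FlatModel

/-- The Euclidean space `ℝ⁴`, thought of as the quaternions. -/
abbrev R4 : Type := EuclideanSpace ℝ (Fin (3 + 1))

namespace R4

/-- For `s = 1`, the multiplication by `i` on the left of a quaternion; for `s = -1`, the
multiplication by `i` on the right. -/
def mulI (s : ℝ) : R4 →L[ℝ] R4 :=
  LinearMap.toContinuousLinearMap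
    { toFun := fun x => WithLp.toLp 2 ![-x 1, x 0, -(s * x 3), s * x 2]
      map_add' := fun x y => by ext i; fin_cases i <;> simp <;> ring
      map_smul' := fun c x => by ext i; fin_cases i <;> simp <;> ring }

@[simp] lemma mulI_apply_zero (s : ℝ) (x : R4) : mulI s x 0 = -x 1 := rfl
@[simp] lemma mulI_apply_one (s : ℝ) (x : R4) : mulI s x 1 = x 0 := rfl
@[simp] lemma mulI_apply_two (s : ℝ) (x : R4) : mulI s x 2 = -(s * x 3) := rfl
@[simp] lemma mulI_apply_three (s : ℝ) (x : R4) : mulI s x 3 = s * x 2 := rfl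

lemma ext4 {x y : R4} (h0 : x 0 = y 0) (h1 : x 1 = y 1) (h2 : x 2 = y 2) (h3 : x 3 = y 3) :
    x = y := by
  ext i
  fin_cases i <;> assumption

lemma inner_eq (x y : R4) : inner ℝ x y = x 0 * y 0 + x 1 * y 1 + x 2 * y 2 + x 3 * y 3 := by
  rw [PiLp.inner_apply, Fin.sum_univ_four]
  simp [mul_comm]

lemma norm_sq_eq (x : R4) : ‖x‖ ^ 2 = x 0 ^ 2 + x 1 ^ 2 + x 2 ^ 2 + x 3 ^ 2 := by
  rw [← real_inner_self_eq_norm_sq, inner_eq]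
  ring

variable {s : ℝ}

lemma mulI_mulI (hs : s * s = 1) (x : R4) : mulI s (mulI s x) = -x := by
  apply ext4
  · simp
  · simp
  · simp only [mulI_apply_two, mulI_apply_three, PiLp.neg_apply]
    linear_combination (-x 2) * hs
  · simp only [mulI_apply_two, mulI_apply_three, PiLp.neg_apply]
    linear_combination (-x 3) * hs

lemma inner_mulI_mulI (hs : s * s = 1) (x y : R4) :
    inner ℝ (mulI s x) (mulI s y) = (inner ℝ x y : ℝ) := by
  simp only [inner_eq, mulI_apply_zero, mulI_apply_one, mulI_apply_two, mulI_apply_three]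
  linear_combination (x 3 * y 3 + x 2 * y 2) * hs

/-- Both maps preserve the coordinate planes `(x₀, x₁)` and `(x₂, x₃)` and act on each by multiples
of the same rotation. For opposite signs this is the associativity `i (x i) = (i x) i`, the source
of `[I₊, I₋] = 0`. -/
lemma mulI_comm (s t : ℝ) (x : R4) : mulI s (mulI t x) = mulI t (mulI s x) := by
  apply ext4 <;> simp <;> ring

/-- The two-form `(u, v) ↦ ⟪i u, v⟫`. -/
def kahlerForm (s : ℝ) : R4 [⋀^Fin 2]→L[ℝ] ℝ :=
  { toFun := fun v => inner ℝ (mulI s (v 0)) (v 1)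
    map_update_add' := by
      intro inst v i a b
      rw [Subsingleton.elim inst (instDecidableEqFin 2)]
      fin_cases i <;> simp [Function.update, inner_add_left, inner_add_right]
    map_update_smul' := by
      intro inst v i c a
      rw [Subsingleton.elim inst (instDecidableEqFin 2)]
      fin_cases i <;> simp [Function.update, inner_smul_left, inner_smul_right]
    cont := by fun_prop
    map_eq_zero_of_eq' := by
      intro v i j hv hij
      have h01 : v 0 = v 1 := by
        fin_cases i <;> fin_cases j <;> simp_all
      rw [h01]
      simp only [inner_eq, mulI_apply_zero, mulI_apply_one, mulI_apply_two, mulI_apply_three]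
      ring }

/-- The determinant on `ℝ⁴`. -/
def detForm : R4 [⋀^Fin (3 + 1)]→L[ℝ] ℝ :=
  { (EuclideanSpace.basisFun (Fin (3 + 1)) ℝ).toBasis.det with
    cont := by
      change Continuous fun v : Fin (3 + 1) → R4 =>
        (EuclideanSpace.basisFun (Fin (3 + 1)) ℝ).toBasis.det v
      simp only [Module.Basis.det_apply]
      refine Continuous.matrix_det ?_
      refine continuous_pi fun i => continuous_pi fun j => ?_
      simp only [Module.Basis.toMatrix_apply, OrthonormalBasis.coe_toBasis_repr_apply,
        EuclideanSpace.basisFun_repr]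
      fun_prop }

lemma detForm_apply (v : Fin (3 + 1) → R4) :
    detForm v = Matrix.det (Matrix.of fun i j => v j i) := by
  change (EuclideanSpace.basisFun (Fin (3 + 1)) ℝ).toBasis.det v = _
  rw [Module.Basis.det_apply]
  congr 1

lemma detForm_eq (a b c d : R4) :
    detForm ![a, b, c, d] =
      a 0 * (b 1 * (c 2 * d 3 - d 2 * c 3) - c 1 * (b 2 * d 3 - d 2 * b 3)
        + d 1 * (b 2 * c 3 - c 2 * b 3))
      - b 0 * (a 1 * (c 2 * d 3 - d 2 * c 3) - c 1 * (a 2 * d 3 - d 2 * a 3)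
        + d 1 * (a 2 * c 3 - c 2 * a 3))
      + c 0 * (a 1 * (b 2 * d 3 - d 2 * b 3) - b 1 * (a 2 * d 3 - d 2 * a 3)
        + d 1 * (a 2 * b 3 - b 2 * a 3))
      - d 0 * (a 1 * (b 2 * c 3 - c 2 * b 3) - b 1 * (a 2 * c 3 - c 2 * a 3)
        + c 1 * (a 2 * b 3 - b 2 * a 3)) := by
  rw [detForm_apply, Matrix.det_succ_row_zero]
  simp [Fin.sum_univ_succ, Matrix.det_fin_three, Fin.succAbove, Matrix.submatrix]
  ring

/-- The two-form `|z|⁻² ⟪i ·, ·⟫`. -/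
def conformalForm (s : ℝ) (z : R4) : R4 [⋀^Fin 2]→L[ℝ] ℝ := (‖z‖ ^ 2)⁻¹ • kahlerForm s

lemma conformalForm_apply (s : ℝ) (z : R4) (v : Fin 2 → R4) :
    conformalForm s z v = (‖z‖ ^ 2)⁻¹ * inner ℝ (mulI s (v 0)) (v 1) := rfl

/-- The three-form `-2 |z|⁻⁴ det (z, ·, ·, ·)`. -/
def sphereForm (z : R4) : R4 [⋀^Fin 3]→L[ℝ] ℝ :=
  (-2 * ((‖z‖ ^ 2)⁻¹) ^ 2) • detForm.curryLeft z

lemma sphereForm_apply (z : R4) (v : Fin 3 → R4) :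
    sphereForm z v = -2 * ((‖z‖ ^ 2)⁻¹) ^ 2 * detForm ![z, v 0, v 1, v 2] := by
  change _ * detForm (Matrix.vecCons z v) = _
  congr 2
  ext i : 1
  fin_cases i <;> rfl

lemma hasFDerivAt_inv_norm_sq {z : R4} (hz : z ≠ 0) :
    HasFDerivAt (fun y : R4 => (‖y‖ ^ 2)⁻¹) (-((‖z‖ ^ 2) ^ 2)⁻¹ • (2 • innerSL ℝ z)) z := by
  have h1 : HasFDerivAt (fun y : R4 => ‖y‖ ^ 2) (2 • innerSL ℝ z) z :=
    (hasStrictFDerivAt_norm_sq z).hasFDerivAt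
  exact (hasDerivAt_inv (by positivity)).comp_hasFDerivAt z h1

lemma contDiffAt_inv_norm_sq {z : R4} (hz : z ≠ 0) :
    ContDiffAt ℝ ∞ (fun y : R4 => (‖y‖ ^ 2)⁻¹) z :=
  (contDiff_norm_sq ℝ).contDiffAt.inv (by positivity)

lemma contDiffAt_conformalForm (s : ℝ) {z : R4} (hz : z ≠ 0) :
    ContDiffAt ℝ ∞ (conformalForm s) z :=
  (contDiffAt_inv_norm_sq hz).smul contDiffAt_const

lemma contDiffAt_sphereForm {z : R4} (hz : z ≠ 0) :
    ContDiffAt ℝ ∞ sphereForm z :=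
  (contDiffAt_const.mul ((contDiffAt_inv_norm_sq hz).pow 2)).smul
    detForm.curryLeft.contDiff.contDiffAt

lemma contDiffAt_inChart_conformalForm (s : ℝ) {z : R4} (hz : z ≠ 0) :
    ContDiffAt ℝ ∞ ((DiffForm.ofFun (conformalForm s)).inChart z) (extChartAt 𝓘(ℝ, R4) z z) := by
  rw [DiffForm.inChart_ofFun]
  exact contDiffAt_conformalForm s hz

lemma contDiffAt_inChart_sphereForm {z : R4} (hz : z ≠ 0) :
    ContDiffAt ℝ ∞ ((DiffForm.ofFun sphereForm).inChart z) (extChartAt 𝓘(ℝ, R4) z z) := by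
  rw [DiffForm.inChart_ofFun, extChartAt_model_space_eq_id]
  exact contDiffAt_sphereForm hz

/-- `kahlerForm s` has constant coefficients, so only the conformal factor is differentiated: the
result is `-2 |z|⁻⁴ ⟪z, ·⟫ ∧ kahlerForm s`. -/
lemma extDeriv_conformalForm_apply (s : ℝ) {z : R4} (hz : z ≠ 0) (v : Fin 3 → R4) :
    extDeriv (conformalForm s) z v = -2 * ((‖z‖ ^ 2)⁻¹) ^ 2 *
      (inner ℝ z (v 0) * inner ℝ (mulI s (v 1)) (v 2)
        - inner ℝ z (v 1) * inner ℝ (mulI s (v 0)) (v 2)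
        + inner ℝ z (v 2) * inner ℝ (mulI s (v 0)) (v 1)) := by
  rw [extDeriv_apply
    ((contDiffAt_conformalForm s hz).differentiableAt (by simp))]
  have key : ∀ (w : Fin 2 → R4) (u : R4), fderiv ℝ (fun y => conformalForm s y w) z u
      = -((‖z‖ ^ 2) ^ 2)⁻¹ * (2 * inner ℝ z u) * inner ℝ (mulI s (w 0)) (w 1) := by
    intro w u
    simp only [conformalForm_apply]
    rw [((hasFDerivAt_inv_norm_sq hz).mul_const _).fderiv]
    simp
    ring
  simp only [key]
  refine (Fin.sum_univ_three _).trans ?_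
  simp [Fin.removeNth, Fin.succAbove]
  ring

/-- `dᶜ` of the form `|z|⁻² ⟪i ·, ·⟫`. -/
lemma extDeriv_conformalForm_mulI (hs : s * s = 1) {z : R4} (hz : z ≠ 0) (v : Fin 3 → R4) :
    -extDeriv (conformalForm s) z (fun i => mulI s (v i)) = s * sphereForm z v := by
  -- With `ω = kahlerForm s`: `ω` is invariant under `i`, and `⟪z, i ·⟫ = -⟪i z, ·⟫`. Moreover `⟪i
  -- z, ·⟫ ∧ ω` is half the contraction of `ω ∧ ω = 2 s det` with `z`, which produces the factor
  -- `s`. In coordinates this is a polynomial identity.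
  rw [extDeriv_conformalForm_apply s hz, sphereForm_apply, detForm_eq]
  simp only [mulI_mulI hs, inner_eq, mulI_apply_zero, mulI_apply_one, mulI_apply_two,
    mulI_apply_three, PiLp.neg_apply]
  ring_nf

/-- The derivative of `det (z, ·, ·, ·)` is `4 det`, the derivative of `|z|⁻⁴` is `-4 |z|⁻⁶ ⟪z, ·⟫`,
and the two contributions cancel because the exponent of `|z|` matches the dimension. -/
lemma extDeriv_sphereForm {z : R4} (hz : z ≠ 0) : extDeriv sphereForm z = 0 := by
  ext v
  rw [extDeriv_apply
    ((contDiffAt_sphereForm hz).differentiableAt (by simp))]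
  have hw : ∀ (y : R4) (w : Fin 3 → R4), Matrix.vecCons y w = ![y, w 0, w 1, w 2] := by
    intro y w
    ext i : 1
    fin_cases i <;> rfl
  have key : ∀ (w : Fin 3 → R4) (u : R4), fderiv ℝ (fun y => sphereForm y w) z u
      = -2 * (((‖z‖ ^ 2)⁻¹) ^ 2 * detForm ![u, w 0, w 1, w 2]
        - 4 * ((‖z‖ ^ 2)⁻¹) ^ 3 * inner ℝ z u * detForm ![z, w 0, w 1, w 2]) := by
    intro w u
    have h1 : HasFDerivAt (fun y => detForm ![y, w 0, w 1, w 2])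
        ((ContinuousAlternatingMap.apply ℝ R4 ℝ w).comp detForm.curryLeft) z := by
      have h0 : (fun y => detForm ![y, w 0, w 1, w 2])
          = (ContinuousAlternatingMap.apply ℝ R4 ℝ w).comp detForm.curryLeft := by
        funext y
        exact congrArg detForm (hw y w).symm
      rw [h0]
      exact ContinuousLinearMap.hasFDerivAt _
    simp only [sphereForm_apply]
    rw [((((hasFDerivAt_inv_norm_sq hz).pow 2).const_mul (-2)).fun_mul h1).fderiv]
    have h2 : (ContinuousAlternatingMap.apply ℝ R4 ℝ w).comp detForm.curryLeft u
        = detForm ![u, w 0, w 1, w 2] := congrArg detForm (hw u w)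
    simp only [add_apply, smul_apply, h2]
    simp
    ring
  have hn : (‖z‖ ^ 2)⁻¹ * (z 0 ^ 2 + z 1 ^ 2 + z 2 ^ 2 + z 3 ^ 2) = 1 := by
    rw [← norm_sq_eq]
    exact inv_mul_cancel₀ (by positivity)
  simp only [key]
  refine (Fin.sum_univ_four _).trans ?_
  generalize (‖z‖ ^ 2)⁻¹ = r at hn
  simp [Fin.removeNth, Fin.succAbove]
  -- This is `⟪z, ·⟫ ∧ det (z, ·, ·, ·) = |z|² det`, expanded on four vectors.
  have e1 : inner ℝ z (v 0) * detForm ![z, v 1, v 2, v 3]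
      - inner ℝ z (v 1) * detForm ![z, v 0, v 2, v 3]
      + inner ℝ z (v 2) * detForm ![z, v 0, v 1, v 3]
      - inner ℝ z (v 3) * detForm ![z, v 0, v 1, v 2]
      = (z 0 ^ 2 + z 1 ^ 2 + z 2 ^ 2 + z 3 ^ 2) * detForm ![v 0, v 1, v 2, v 3] := by
    simp only [detForm_eq, inner_eq]
    ring
  have e2 : detForm ![v 1, v 0, v 2, v 3] = - detForm ![v 0, v 1, v 2, v 3] := by
    simp only [detForm_eq]
    ring
  have e3 : detForm ![v 2, v 0, v 1, v 3] = detForm ![v 0, v 1, v 2, v 3] := by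
    simp only [detForm_eq]
    ring
  have e4 : detForm ![v 3, v 0, v 1, v 2] = - detForm ![v 0, v 1, v 2, v 3] := by
    simp only [detForm_eq]
    ring
  rw [e2, e3, e4]
  linear_combination 8 * r ^ 3 * e1 + 8 * r ^ 2 * detForm ![v 0, v 1, v 2, v 3] * hn

/-- Dilation invariance of the conformally flat metric, which lets it descend to the mapping torus.
-/
lemma inv_norm_sq_mul_inner_smul {c : ℝ} (hc : c ≠ 0) (z v w : R4) :
    (‖c • z‖ ^ 2)⁻¹ * inner ℝ (c • v) (c • w) = (‖z‖ ^ 2)⁻¹ * inner ℝ v w := by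
  rw [inner_smul_left, inner_smul_right, norm_smul, mul_pow, Real.norm_eq_abs, sq_abs]
  simp only [conj_trivial]
  field_simp

end R4

end FlatModel

/-! ### Transporting the product structure through a local chart. -/

section LocalModel

open Bundle

/-- The chain rule with vectors in the model spaces and a separate hypothesis `f a = b`, so that
base points that are only propositionally equal cause no transport. -/
lemma mfderiv_apply_mfderiv_of_eventuallyEq
    {E₁ : Type*} [NormedAddCommGroup E₁] [NormedSpace ℝ E₁] {H₁ : Type*} [TopologicalSpace H₁]
    {I₁ : ModelWithCorners ℝ E₁ H₁} {M₁ : Type*} [TopologicalSpace M₁] [ChartedSpace H₁ M₁]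
    {E₂ : Type*} [NormedAddCommGroup E₂] [NormedSpace ℝ E₂] {H₂ : Type*} [TopologicalSpace H₂]
    {I₂ : ModelWithCorners ℝ E₂ H₂} {M₂ : Type*} [TopologicalSpace M₂] [ChartedSpace H₂ M₂]
    {E₃ : Type*} [NormedAddCommGroup E₃] [NormedSpace ℝ E₃] {H₃ : Type*} [TopologicalSpace H₃]
    {I₃ : ModelWithCorners ℝ E₃ H₃} {M₃ : Type*} [TopologicalSpace M₃] [ChartedSpace H₃ M₃]
    {f : M₁ → M₂} {g : M₂ → M₃} {k : M₁ → M₃} {a : M₁} {b : M₂}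
    (hg : MDifferentiableAt I₂ I₃ g b) (hf : MDifferentiableAt I₁ I₂ f a) (hb : f a = b)
    (hk : g ∘ f =ᶠ[𝓝 a] k) (v : E₁) :
    (mfderiv I₂ I₃ g b : E₂ →L[ℝ] E₃) ((mfderiv I₁ I₂ f a : E₁ →L[ℝ] E₂) v)
      = (mfderiv I₁ I₃ k a : E₁ →L[ℝ] E₃) v := by
  subst hb
  have h := mfderiv_comp_apply a hg hf v
  rw [hk.mfderiv_eq] at h
  exact h.symm

variable {EK : Type*} [NormedAddCommGroup EK] [NormedSpace ℝ EK] {HK : Type*} [TopologicalSpace HK]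
  {IK : ModelWithCorners ℝ EK HK} {K : Type*} [TopologicalSpace K] [ChartedSpace HK K]
  {E : Type*} [NormedAddCommGroup E] [NormedSpace ℝ E] {H : Type*} [TopologicalSpace H]
  {I : ModelWithCorners ℝ E H} {M : Type*} [TopologicalSpace M] [ChartedSpace H M]

variable (IK I) in
/-- A diffeomorphism from an open subset of `M` to an open subset of `K × (ℝ⁴ \ {0})`. -/
structure IsSmoothChart (θ : OpenPartialHomeomorph M (K × R4)) : Prop where
  contMDiffOn : ContMDiffOn I (IK.prod 𝓘(ℝ, R4)) ∞ θ θ.source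
  contMDiffOn_symm : ContMDiffOn (IK.prod 𝓘(ℝ, R4)) I ∞ θ.symm θ.target
  ne_zero : ∀ y ∈ θ.source, (θ y).2 ≠ 0

namespace IsSmoothChart

variable (θ : OpenPartialHomeomorph M (K × R4))

variable (IK I) in
/-- The derivative of the first component of `θ`. -/
def dP (y : M) : TangentSpace I y →L[ℝ] TangentSpace IK (θ y).1 :=
  mfderiv I IK (fun y => (θ y).1) y

variable (I) in
/-- The derivative of the second component of `θ`. -/
def dF (y : M) : TangentSpace I y →L[ℝ] TangentSpace 𝓘(ℝ, R4) (θ y).2 :=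
  mfderiv I 𝓘(ℝ, R4) (fun y => (θ y).2) y

variable (IK I) in
/-- The derivative of `θ.symm` in the first variable. -/
def incK (y : M) : TangentSpace IK (θ y).1 →L[ℝ] TangentSpace I y :=
  mfderiv IK I (fun p => θ.symm (p, (θ y).2)) (θ y).1

variable (I) in
/-- The derivative of `θ.symm` in the second variable. -/
def incF (y : M) : TangentSpace 𝓘(ℝ, R4) (θ y).2 →L[ℝ] TangentSpace I y :=
  mfderiv 𝓘(ℝ, R4) I (fun z => θ.symm ((θ y).1, z)) (θ y).2

variable {θ} {y : M}

omit [NormedAddCommGroup EK] [NormedSpace ℝ EK] [TopologicalSpace HK] [ChartedSpace HK K]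
  [NormedAddCommGroup E] [NormedSpace ℝ E] [TopologicalSpace H] [ChartedSpace H M] in
lemma eventually_symm_left (hy : y ∈ θ.source) : ∀ᶠ p in 𝓝 (θ y).1, (p, (θ y).2) ∈ θ.target := by
  have : ContinuousAt (fun p : K => (p, (θ y).2)) (θ y).1 := by fun_prop
  exact this.eventually (θ.open_target.mem_nhds (θ.map_source hy))

omit [NormedAddCommGroup EK] [NormedSpace ℝ EK] [TopologicalSpace HK] [ChartedSpace HK K]
  [NormedAddCommGroup E] [NormedSpace ℝ E] [TopologicalSpace H] [ChartedSpace H M] in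
lemma eventually_symm_right (hy : y ∈ θ.source) : ∀ᶠ z in 𝓝 (θ y).2, ((θ y).1, z) ∈ θ.target := by
  have : ContinuousAt (fun z : R4 => ((θ y).1, z)) (θ y).2 := by fun_prop
  exact this.eventually (θ.open_target.mem_nhds (θ.map_source hy))

variable (hθ : IsSmoothChart IK I θ) (hy : y ∈ θ.source)
include hθ hy

lemma contMDiffAt : ContMDiffAt I (IK.prod 𝓘(ℝ, R4)) ∞ θ y :=
  hθ.contMDiffOn.contMDiffAt (θ.open_source.mem_nhds hy)

lemma contMDiffAt_symm : ContMDiffAt (IK.prod 𝓘(ℝ, R4)) I ∞ θ.symm ((θ y).1, (θ y).2) :=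
  hθ.contMDiffOn_symm.contMDiffAt (θ.open_target.mem_nhds (θ.map_source hy))

lemma contMDiffAt_fst : ContMDiffAt I IK ∞ (fun y => (θ y).1) y :=
  _root_.contMDiffAt_fst.comp y (hθ.contMDiffAt hy)

lemma contMDiffAt_snd : ContMDiffAt I 𝓘(ℝ, R4) ∞ (fun y => (θ y).2) y :=
  _root_.contMDiffAt_snd.comp y (hθ.contMDiffAt hy)

lemma contMDiffAt_symm_left : ContMDiffAt IK I ∞ (fun p => θ.symm (p, (θ y).2)) (θ y).1 :=
  (hθ.contMDiffAt_symm hy).comp (θ y).1 (contMDiffAt_id.prodMk contMDiffAt_const)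

lemma contMDiffAt_symm_right :
    ContMDiffAt 𝓘(ℝ, R4) I ∞ (fun z => θ.symm ((θ y).1, z)) (θ y).2 :=
  (hθ.contMDiffAt_symm hy).comp (θ y).2 (contMDiffAt_const.prodMk contMDiffAt_id)

/-- This identity, the next three and `incK_dP_add_incF_dF` exhibit the tangent space at `y` as the
direct sum of a tangent space of `K` and `ℝ⁴`, with projections `dP`, `dF` and inclusions `incK`,
`incF`. -/
lemma dP_incK (w : TangentSpace IK (θ y).1) : dP IK I θ y (incK IK I θ y w) = w := by
  have h := mfderiv_apply_mfderiv_of_eventuallyEq (k := id)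
    ((hθ.contMDiffAt_fst hy).mdifferentiableAt (by simp))
    ((hθ.contMDiffAt_symm_left hy).mdifferentiableAt (by simp)) (θ.left_inv hy)
    (by filter_upwards [eventually_symm_left hy] with p hp; simp [θ.right_inv hp]) w
  rw [mfderiv_id] at h
  exact h

lemma dP_incF (w : TangentSpace 𝓘(ℝ, R4) (θ y).2) : dP IK I θ y (incF I θ y w) = 0 := by
  have h := mfderiv_apply_mfderiv_of_eventuallyEq (k := fun _ => (θ y).1)
    ((hθ.contMDiffAt_fst hy).mdifferentiableAt (by simp))
    ((hθ.contMDiffAt_symm_right hy).mdifferentiableAt (by simp)) (θ.left_inv hy)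
    (by filter_upwards [eventually_symm_right hy] with p hp; simp [θ.right_inv hp]) w
  rw [mfderiv_const] at h
  exact h

lemma dF_incK (w : TangentSpace IK (θ y).1) : dF I θ y (incK IK I θ y w) = 0 := by
  have h := mfderiv_apply_mfderiv_of_eventuallyEq (k := fun _ => (θ y).2)
    ((hθ.contMDiffAt_snd hy).mdifferentiableAt (by simp))
    ((hθ.contMDiffAt_symm_left hy).mdifferentiableAt (by simp)) (θ.left_inv hy)
    (by filter_upwards [eventually_symm_left hy] with p hp; simp [θ.right_inv hp]) w
  rw [mfderiv_const] at h
  exact h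

lemma dF_incF (w : TangentSpace 𝓘(ℝ, R4) (θ y).2) : dF I θ y (incF I θ y w) = w := by
  have h := mfderiv_apply_mfderiv_of_eventuallyEq (k := id)
    ((hθ.contMDiffAt_snd hy).mdifferentiableAt (by simp))
    ((hθ.contMDiffAt_symm_right hy).mdifferentiableAt (by simp)) (θ.left_inv hy)
    (by filter_upwards [eventually_symm_right hy] with p hp; simp [θ.right_inv hp]) w
  rw [mfderiv_id] at h
  exact h

lemma incK_dP_add_incF_dF (v : TangentSpace I y) :
    incK IK I θ y (dP IK I θ y v) + incF I θ y (dF I θ y v) = v := by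
  have hd := (hθ.contMDiffAt hy).mdifferentiableAt (by simp)
  have hs := (hθ.contMDiffAt_symm hy).mdifferentiableAt (by simp)
  have h := mfderiv_apply_mfderiv_of_eventuallyEq (k := id) hs hd rfl
    (by filter_upwards [θ.open_source.mem_nhds hy] with p hp; simp [θ.left_inv hp]) v
  rw [mfderiv_id, mfderiv_prod_eq_add_apply hs] at h
  have h1 : mfderiv I (IK.prod 𝓘(ℝ, R4)) θ y = (dP IK I θ y).prod (dF I θ y) :=
    mfderiv_prodMk ((hθ.contMDiffAt_fst hy).mdifferentiableAt (by simp))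
      ((hθ.contMDiffAt_snd hy).mdifferentiableAt (by simp))
  rw [h1] at h
  exact h

/-- Later identities between tangent vectors of `M` are checked on these two components. -/
lemma ext_dP_dF {v w : TangentSpace I y} (h1 : dP IK I θ y v = dP IK I θ y w)
    (h2 : dF I θ y v = dF I θ y w) : v = w := by
  rw [← hθ.incK_dP_add_incF_dF hy v, ← hθ.incK_dP_add_incF_dF hy w, h1, h2]

section

variable [IsManifold I ∞ M] [IsManifold IK ∞ K]

omit hθ hy [IsManifold IK ∞ K] [IsManifold I ∞ M] in
-- Needed because `θ.symm (θ x)` equals `x` only propositionally, while the type of the linear map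
-- depends on it.
lemma inCoordinates_congr [IsManifold I 1 M] [IsManifold IK 1 K] (a a' : K) (b : M) {c c' : M}
    (h : c = c') (φ : EK →L[ℝ] E) :
    ContinuousLinearMap.inCoordinates EK (TangentSpace IK) E (TangentSpace I) a a' b c φ
      = ContinuousLinearMap.inCoordinates EK (TangentSpace IK) E (TangentSpace I) a a' b c' φ := by
  subst h
  rfl

lemma contMDiffAt_dP : ContMDiffAt I 𝓘(ℝ, E →L[ℝ] EK) ∞
    (inTangentCoordinates I IK id (fun y => (θ y).1) (dP IK I θ) y) y :=
  (hθ.contMDiffAt_fst hy).mfderiv_const (by simp)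

omit [IsManifold IK ∞ K] in
lemma contMDiffAt_dF : ContMDiffAt I 𝓘(ℝ, E →L[ℝ] R4) ∞
    (inTangentCoordinates I 𝓘(ℝ, R4) id (fun y => (θ y).2) (dF I θ) y) y :=
  (hθ.contMDiffAt_snd hy).mfderiv_const (by simp)

/-- `incK` is a partial derivative of `θ.symm` with the other variable as a parameter, taken at the
moving point `(θ y).1`; smooth dependence of `mfderiv` on parameters applies. -/
lemma contMDiffAt_incK : ContMDiffAt I 𝓘(ℝ, EK →L[ℝ] E) ∞
    (inTangentCoordinates IK I (fun y => (θ y).1) id (incK IK I θ) y) y := by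
  have hf : ContMDiffAt (I.prod IK) I ∞
      (uncurry fun (y : M) (p : K) => θ.symm (p, (θ y).2)) (y, (θ y).1) :=
    (hθ.contMDiffAt_symm hy).comp_of_eq (_root_.contMDiffAt_snd.prodMk
      ((hθ.contMDiffAt_snd hy).comp_of_eq _root_.contMDiffAt_fst rfl)) rfl
  refine (hf.mfderiv _ _ (hθ.contMDiffAt_fst hy) (m := ∞) (by simp)).congr_of_eventuallyEq ?_
  filter_upwards [θ.open_source.mem_nhds hy] with x hx
  have e1 : θ.symm ((θ x).1, (θ x).2) = x := θ.left_inv hx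
  have e2 : θ.symm ((θ y).1, (θ y).2) = y := θ.left_inv hy
  simp only [inTangentCoordinates, e2]
  exact inCoordinates_congr _ _ _ e1.symm _

omit [IsManifold IK ∞ K] in
lemma contMDiffAt_incF : ContMDiffAt I 𝓘(ℝ, R4 →L[ℝ] E) ∞
    (inTangentCoordinates 𝓘(ℝ, R4) I (fun y => (θ y).2) id (incF I θ) y) y := by
  have hf : ContMDiffAt (I.prod 𝓘(ℝ, R4)) I ∞
      (uncurry fun (y : M) (z : R4) => θ.symm ((θ y).1, z)) (y, (θ y).2) :=
    (hθ.contMDiffAt_symm hy).comp_of_eq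
      (((hθ.contMDiffAt_fst hy).comp_of_eq _root_.contMDiffAt_fst rfl).prodMk
        _root_.contMDiffAt_snd) rfl
  refine (hf.mfderiv _ _ (hθ.contMDiffAt_snd hy) (m := ∞) (by simp)).congr_of_eventuallyEq ?_
  filter_upwards [θ.open_source.mem_nhds hy] with x hx
  have e1 : θ.symm ((θ x).1, (θ x).2) = x := θ.left_inv hx
  have e2 : θ.symm ((θ y).1, (θ y).2) = y := θ.left_inv hy
  simp only [inTangentCoordinates, e2]
  exact inCoordinates_congr _ _ _ e1.symm _

end

end IsSmoothChart

/-! ### The model tensors in a chart -/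

namespace IsSmoothChart

variable [IsManifold I ∞ M] [IsManifold IK ∞ K]

variable (I) in
/-- The complex structure induced by a chart: the product of the complex structure of `K` and of
the multiplication by `i` on `ℝ⁴`. -/
def localJ (S : KahlerStructure IK K) (θ : OpenPartialHomeomorph M (K × R4)) (s : ℝ) (y : M) :
    TangentSpace I y →L[ℝ] TangentSpace I y :=
  (incK IK I θ y).comp ((S.cplx.J (θ y).1).comp (dP IK I θ y))
    + (incF I θ y).comp ((show TangentSpace 𝓘(ℝ, R4) (θ y).2 →L[ℝ] TangentSpace 𝓘(ℝ, R4) (θ y).2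
        from R4.mulI s).comp (dF I θ y))

/-- The conformally flat metric on `ℝ⁴ \ {0}`. -/
def conformalMetric (z : R4) :
    TangentSpace 𝓘(ℝ, R4) z →L[ℝ] TangentSpace 𝓘(ℝ, R4) z →L[ℝ] ℝ :=
  show R4 →L[ℝ] R4 →L[ℝ] ℝ from (‖z‖ ^ 2)⁻¹ • innerSL ℝ

variable (I) in
/-- The metric induced by a chart: the product of the metric of `K` and of the metric
`|z|⁻² ⟪·, ·⟫`. -/
def localMetric (S : KahlerStructure IK K) (θ : OpenPartialHomeomorph M (K × R4)) (y : M) :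
    TangentSpace I y →L[ℝ] TangentSpace I y →L[ℝ] ℝ :=
  bilinPullback (S.metric.inner (θ y).1) (dP IK I θ y)
    + bilinPullback (conformalMetric (θ y).2) (dF I θ y)

variable {S : KahlerStructure IK K} {θ : OpenPartialHomeomorph M (K × R4)}

omit [IsManifold I ∞ M] in
lemma localMetric_apply (y : M) (v w : TangentSpace I y) :
    localMetric I S θ y v w = S.metric.inner (θ y).1 (dP IK I θ y v) (dP IK I θ y w)
      + (‖(θ y).2‖ ^ 2)⁻¹ * inner ℝ (show R4 from dF I θ y v) (show R4 from dF I θ y w) := rfl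

variable (hθ : IsSmoothChart IK I θ) {y : M} (hy : y ∈ θ.source) (s : ℝ)
include hθ hy

omit [IsManifold I ∞ M] in
lemma dP_localJ (v : TangentSpace I y) :
    dP IK I θ y (localJ I S θ s y v) = S.cplx.J (θ y).1 (dP IK I θ y v) := by
  have h1 := hθ.dP_incK hy (S.cplx.J (θ y).1 (dP IK I θ y v))
  have h2 := hθ.dP_incF hy (R4.mulI s (dF I θ y v))
  refine (map_add (dP IK I θ y) _ _).trans ?_
  exact (congrArg₂ (· + ·) h1 h2).trans (add_zero _)

omit [IsManifold I ∞ M] in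
lemma dF_localJ (v : TangentSpace I y) :
    dF I θ y (localJ I S θ s y v) = R4.mulI s (dF I θ y v) := by
  have h1 := hθ.dF_incK hy (S.cplx.J (θ y).1 (dP IK I θ y v))
  have h2 := hθ.dF_incF hy (R4.mulI s (dF I θ y v))
  refine (map_add (dF I θ y) _ _).trans ?_
  exact (congrArg₂ (· + ·) h1 h2).trans (zero_add _)

lemma contMDiffAt_localJ : ContMDiffAt I 𝓘(ℝ, E →L[ℝ] E) ∞
    (inTangentCoordinates I I id id (localJ I S θ s) y) y := by
  have hJ := (contMDiffAt_endomorphism_iff.1 (S.cplx.contMDiff (θ y).1)).comp y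
    (hθ.contMDiffAt_fst hy)
  have hP := hθ.contMDiffAt_dP hy
  have hF := hθ.contMDiffAt_dF hy
  have c1 := (hθ.contMDiffAt_fst hy).continuousAt
  have c2 := (hθ.contMDiffAt_snd hy).continuousAt
  have h1 : ContMDiffAt I 𝓘(ℝ, E →L[ℝ] EK) ∞
    (inTangentCoordinates I IK id (fun y => (θ y).1)
      (fun y => (S.cplx.J (θ y).1).comp (dP IK I θ y)) y) y :=
    ContMDiffAt.inTangentCoordinates_comp (g := fun y => (θ y).1)
      (χ := fun y => S.cplx.J (θ y).1) hJ hP c1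
  have h2 := ContMDiffAt.inTangentCoordinates_comp (hθ.contMDiffAt_incK hy) h1 c1
  have hL : ContMDiffAt I 𝓘(ℝ, R4 →L[ℝ] R4) ∞ (inTangentCoordinates 𝓘(ℝ, R4) 𝓘(ℝ, R4)
      (fun y => (θ y).2) (fun y => (θ y).2) (fun _ => R4.mulI s) y) y := by
    rw [inTangentCoordinates_model_space]
    exact contMDiffAt_const
  have h3 : ContMDiffAt I 𝓘(ℝ, E →L[ℝ] R4) ∞
    (inTangentCoordinates I 𝓘(ℝ, R4) id (fun y => (θ y).2)
      (fun y => (show TangentSpace 𝓘(ℝ, R4) (θ y).2 →L[ℝ] TangentSpace 𝓘(ℝ, R4) (θ y).2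
        from R4.mulI s).comp (dF I θ y)) y) y :=
    ContMDiffAt.inTangentCoordinates_comp (g := fun y => (θ y).2)
      (χ := fun y => R4.mulI s) hL hF c2
  have h4 := ContMDiffAt.inTangentCoordinates_comp (hθ.contMDiffAt_incF hy) h3 c2
  refine (h2.add h4).congr_of_eventuallyEq (Filter.Eventually.of_forall fun x => ?_)
  exact inTangentCoordinates_add (f := id) (g := id) _ _ y x

lemma contMDiffAt_localMetric : ContMDiffAt I 𝓘(ℝ, E →L[ℝ] E →L[ℝ] ℝ) ∞
    (bilinInCoordinates (localMetric I S θ) y) y := by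
  have h1 := contMDiffAt_bilinInCoordinates_pullback (P := fun y => (θ y).1)
    (contMDiffAt_bilin_iff.1 (S.metric.contMDiff (θ y).1)) (hθ.contMDiffAt_dP hy)
    (hθ.contMDiffAt_fst hy)
  have h0 : ContMDiffAt 𝓘(ℝ, R4) 𝓘(ℝ, R4 →L[ℝ] R4 →L[ℝ] ℝ) ∞
      (bilinInCoordinates conformalMetric (θ y).2) (θ y).2 := by
    have e : bilinInCoordinates conformalMetric (θ y).2
        = fun z : R4 => (‖z‖ ^ 2)⁻¹ • innerSL ℝ := by
      funext z
      ext u v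
      rw [bilinInCoordinates_apply]
      simp only [conformalMetric, TangentBundle.symmL_model_space]
      rfl
    rw [e]
    exact ((R4.contDiffAt_inv_norm_sq (hθ.ne_zero y hy)).smul contDiffAt_const).contMDiffAt
  have h2 := contMDiffAt_bilinInCoordinates_pullback (P := fun y => (θ y).2) h0 (hθ.contMDiffAt_dF hy)
    (hθ.contMDiffAt_snd hy)
  exact h1.add h2

end IsSmoothChart

end LocalModel

/-! ### Gluing the local tensors over an atlas. -/

section HopfAtlas

open Bundle

variable {EK : Type*} [NormedAddCommGroup EK] [NormedSpace ℝ EK] {HK : Type*} [TopologicalSpace HK]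
  {IK : ModelWithCorners ℝ EK HK} {K : Type*} [TopologicalSpace K] [ChartedSpace HK K]
  {E : Type*} [NormedAddCommGroup E] [NormedSpace ℝ E] {H : Type*} [TopologicalSpace H]
  {I : ModelWithCorners ℝ E H} {M : Type*} [TopologicalSpace M] [ChartedSpace H M]
  [IsManifold I ∞ M] [IsManifold IK ∞ K]

/-- A map that is holomorphic and isometric for a Kähler structure. -/
structure KahlerStructure.IsHolomorphicIsometricMap (S : KahlerStructure IK K) (g : K → K) :
    Prop where
  mdifferentiable : MDifferentiable IK IK g
  holomorphic (x : K) (v : TangentSpace IK x) :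
    mfderiv IK IK g x (S.cplx.J x v) = S.cplx.J (g x) (mfderiv IK IK g x v)
  isometry (x : K) (v w : TangentSpace IK x) :
    S.metric.inner (g x) (mfderiv IK IK g x v) (mfderiv IK IK g x w) = S.metric.inner x v w

omit [IsManifold I ∞ M] in
lemma KahlerStructure.J_congr (S : KahlerStructure IK K) {p q : K} (h : p = q) (v : EK) :
    (S.cplx.J p : EK →L[ℝ] EK) v = (S.cplx.J q : EK →L[ℝ] EK) v := by
  subst h; rfl

omit [IsManifold I ∞ M] in
lemma KahlerStructure.inner_congr (S : KahlerStructure IK K) {p q : K} (h : p = q) (v w : EK) :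
    (S.metric.inner p : EK →L[ℝ] EK →L[ℝ] ℝ) v w
      = (S.metric.inner q : EK →L[ℝ] EK →L[ℝ] ℝ) v w := by
  subst h; rfl

/-- An atlas of local diffeomorphisms from `M` to `K × (ℝ⁴ \ {0})`, whose coordinate changes are
products of holomorphic isometries and dilations. -/
structure HopfAtlas (I : ModelWithCorners ℝ E H) (M : Type*) [TopologicalSpace M]
    [ChartedSpace H M] [IsManifold I ∞ M] (S : KahlerStructure IK K) (ι : Type*) where
  chart : ι → OpenPartialHomeomorph M (K × R4)
  isSmooth (i : ι) : IsSmoothChart IK I (chart i)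
  index : M → ι
  mem_source (y : M) : y ∈ (chart (index y)).source
  compat (i j : ι) (y : M) (hi : y ∈ (chart i).source) (hj : y ∈ (chart j).source) :
    ∃ (g : K → K) (c : ℝ), c ≠ 0 ∧ S.IsHolomorphicIsometricMap g ∧
      ∀ᶠ y' in 𝓝 y, chart j y' = (g (chart i y').1, c • (chart i y').2)

namespace HopfAtlas

open IsSmoothChart

variable {S : KahlerStructure IK K} {ι : Type*} (A : HopfAtlas I M S ι)

section

variable {θ θ' : OpenPartialHomeomorph M (K × R4)} (hθ : IsSmoothChart IK I θ)
  (hθ' : IsSmoothChart IK I θ') {y : M} (hy : y ∈ θ.source) (hy' : y ∈ θ'.source)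
  {g : K → K} {c : ℝ} (hg : S.IsHolomorphicIsometricMap g)
  (h : ∀ᶠ y' in 𝓝 y, θ' y' = (g (θ y').1, c • (θ y').2))
include hθ hy h

omit [IsManifold I ∞ M] in
lemma dP_of_transition (hg : S.IsHolomorphicIsometricMap g) (v : E) :
    (dP IK I θ' y : E →L[ℝ] EK) v
      = (mfderiv IK IK g (θ y).1 : EK →L[ℝ] EK) ((dP IK I θ y : E →L[ℝ] EK) v) := by
  refine (mfderiv_apply_mfderiv_of_eventuallyEq (k := fun y => (θ' y).1)
    (hg.mdifferentiable (θ y).1) ((hθ.contMDiffAt_fst hy).mdifferentiableAt (by simp)) rfl ?_ v).symm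
  filter_upwards [h] with x hx
  simp [hx]

omit [IsManifold I ∞ M] [IsManifold IK ∞ K] in
lemma dF_of_transition (v : E) :
    (dF I θ' y : E →L[ℝ] R4) v = c • (dF I θ y : E →L[ℝ] R4) v := by
  have hm : MDifferentiableAt 𝓘(ℝ, R4) 𝓘(ℝ, R4) (fun z : R4 => c • z) (θ y).2 :=
    (differentiable_id.const_smul c).differentiableAt.mdifferentiableAt
  refine (mfderiv_apply_mfderiv_of_eventuallyEq (k := fun y => (θ' y).2)
    hm ((hθ.contMDiffAt_snd hy).mdifferentiableAt (by simp)) rfl ?_ v).symm.trans ?_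
  · filter_upwards [h] with x hx
    simp [hx]
  · have : (mfderiv 𝓘(ℝ, R4) 𝓘(ℝ, R4) (fun z : R4 => c • z) (θ y).2 : R4 →L[ℝ] R4)
        = c • ContinuousLinearMap.id ℝ R4 := by
      rw [mfderiv_eq_fderiv]
      exact (c • ContinuousLinearMap.id ℝ R4).fderiv
    rw [this]
    rfl

include hg

omit [IsManifold I ∞ M] in
include hθ' hy' in
-- The differential of `g` commutes with the complex structure of `K`, and a real dilation commutes
-- with the linear map `mulI s`; so both candidates have the same two components.
lemma localJ_eq_of_transition (s : ℝ) : localJ I S θ' s y = localJ I S θ s y := by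
  ext v
  have e0 : (θ' y).1 = g (θ y).1 := congrArg Prod.fst h.self_of_nhds
  apply hθ'.ext_dP_dF hy'
  · rw [hθ'.dP_localJ hy']
    have h1 := dP_of_transition hθ hy h hg v
    have h2 := dP_of_transition hθ hy h hg (localJ I S θ s y v)
    have h3 := hθ.dP_localJ (S := S) hy s v
    have h4 := hg.holomorphic (θ y).1 (dP IK I θ y v)
    refine Eq.trans ?_ h2.symm
    refine (S.J_congr e0 _).trans ?_
    refine (congrArg (S.cplx.J (g (θ y).1) : EK →L[ℝ] EK) h1).trans ?_
    refine h4.symm.trans ?_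
    exact congrArg (mfderiv IK IK g (θ y).1 : EK →L[ℝ] EK) h3.symm
  · rw [hθ'.dF_localJ hy']
    have h1 := dF_of_transition hθ hy h v
    have h2 := dF_of_transition hθ hy h (localJ I S θ s y v)
    have h3 := hθ.dF_localJ (S := S) hy s v
    refine Eq.trans ?_ h2.symm
    refine (congrArg (R4.mulI s) h1).trans ?_
    refine ((R4.mulI s).map_smul c _).trans ?_
    exact congrArg (fun z : R4 => c • z) h3.symm

omit [IsManifold I ∞ M] in
-- The `K` part is preserved because `g` is isometric, the `ℝ⁴` part by dilation invariance.
lemma localMetric_eq_of_transition (hc : c ≠ 0) : localMetric I S θ' y = localMetric I S θ y := by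
  ext v w
  have e0 : (θ' y).1 = g (θ y).1 := congrArg Prod.fst h.self_of_nhds
  have e1 : (θ' y).2 = c • (θ y).2 := congrArg Prod.snd h.self_of_nhds
  rw [localMetric_apply, localMetric_apply]
  congr 1
  · have h1 := dP_of_transition hθ hy h hg v
    have h2 := dP_of_transition hθ hy h hg w
    refine (S.inner_congr e0 _ _).trans ?_
    refine (congrArg₂ (fun a b => (S.metric.inner (g (θ y).1) : EK →L[ℝ] EK →L[ℝ] ℝ) a b)
      h1 h2).trans ?_
    exact hg.isometry _ _ _
  · have h1 := dF_of_transition hθ hy h v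
    have h2 := dF_of_transition hθ hy h w
    refine (congrArg₂ (fun a b : R4 => (‖(θ' y).2‖ ^ 2)⁻¹ * inner ℝ a b) h1 h2).trans ?_
    rw [e1]
    exact R4.inv_norm_sq_mul_inner_smul hc _ _ _

end

/-- The field of endomorphisms whose expression in the charts is the product of the complex
structure of `K` and of the multiplication by `i`. -/
def J (s : ℝ) (y : M) : TangentSpace I y →L[ℝ] TangentSpace I y :=
  localJ I S (A.chart (A.index y)) s y

/-- The metric whose expression in the charts is the product of the metric of `K` and of the
metric `|z|⁻² ⟪·, ·⟫`. -/
def inner (y : M) : TangentSpace I y →L[ℝ] TangentSpace I y →L[ℝ] ℝ :=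
  localMetric I S (A.chart (A.index y)) y

variable {i : ι} {y : M} (hy : y ∈ (A.chart i).source)
include hy

/-- `J` is defined with a chart chosen separately at each point; this identity is what allows
smoothness and derivatives to be examined in one fixed chart. -/
lemma J_eq (s : ℝ) : A.J s y = localJ I S (A.chart i) s y := by
  obtain ⟨g, c, hc, hg, h⟩ := A.compat i _ y hy (A.mem_source y)
  exact localJ_eq_of_transition (A.isSmooth _) (A.isSmooth _) hy (A.mem_source y) hg h s

lemma inner_eq : A.inner y = localMetric I S (A.chart i) y := by
  obtain ⟨g, c, hc, hg, h⟩ := A.compat i _ y hy (A.mem_source y)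
  exact localMetric_eq_of_transition (A.isSmooth _) hy hg h hc

lemma dP_J (s : ℝ) (v : TangentSpace I y) :
    dP IK I (A.chart i) y (A.J s y v) = S.cplx.J _ (dP IK I (A.chart i) y v) := by
  rw [A.J_eq hy, (A.isSmooth i).dP_localJ hy]

lemma dF_J (s : ℝ) (v : TangentSpace I y) :
    dF I (A.chart i) y (A.J s y v) = R4.mulI s (dF I (A.chart i) y v) := by
  rw [A.J_eq hy, (A.isSmooth i).dF_localJ hy]

lemma inner_apply (v w : TangentSpace I y) : A.inner y v w
    = S.metric.inner (A.chart i y).1 (dP IK I (A.chart i) y v) (dP IK I (A.chart i) y w)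
      + (‖(A.chart i y).2‖ ^ 2)⁻¹ * Inner.inner ℝ (show R4 from dF I (A.chart i) y v)
        (show R4 from dF I (A.chart i) y w) := by
  rw [A.inner_eq hy]
  rfl

omit hy

lemma J_J {s : ℝ} (hs : s * s = 1) (y : M) (v : TangentSpace I y) :
    A.J s y (A.J s y v) = -v := by
  have hy := A.mem_source y
  apply (A.isSmooth _).ext_dP_dF hy
  · rw [A.dP_J hy, A.dP_J hy, S.cplx.J_J, map_neg]
  · rw [A.dF_J hy, A.dF_J hy]
    refine (R4.mulI_mulI hs _).trans ?_
    exact (map_neg (dF I (A.chart (A.index y)) y) v).symm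

lemma inner_J_J {s : ℝ} (hs : s * s = 1) (y : M) (v w : TangentSpace I y) :
    A.inner y (A.J s y v) (A.J s y w) = A.inner y v w := by
  have hy := A.mem_source y
  rw [A.inner_apply hy, A.inner_apply hy, A.dP_J hy, A.dP_J hy, A.dF_J hy, A.dF_J hy, S.compatible]
  congr 2
  exact R4.inner_mulI_mulI hs _ _

lemma eventually_mem_source (y : M) : ∀ᶠ x in 𝓝 y, x ∈ (A.chart (A.index y)).source :=
  (A.chart _).open_source.mem_nhds (A.mem_source y)

lemma contMDiff_J (s : ℝ) : ContMDiff I (I.prod 𝓘(ℝ, E →L[ℝ] E)) ∞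
    (fun x => Bundle.TotalSpace.mk' (E →L[ℝ] E)
      (E := fun x : M => TangentSpace I x →L[ℝ] TangentSpace I x) x (A.J s x)) := by
  intro y
  rw [contMDiffAt_endomorphism_iff]
  refine ((A.isSmooth _).contMDiffAt_localJ (S := S) (A.mem_source y) s).congr_of_eventuallyEq ?_
  filter_upwards [A.eventually_mem_source y] with x hx
  simp only [inTangentCoordinates, A.J_eq hx]

lemma contMDiff_inner : ContMDiff I (I.prod 𝓘(ℝ, E →L[ℝ] E →L[ℝ] ℝ)) ∞
    (fun x => TotalSpace.mk' (E →L[ℝ] E →L[ℝ] ℝ)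
      (E := fun x : M => TangentSpace I x →L[ℝ] TangentSpace I x →L[ℝ] ℝ) x (A.inner x)) := by
  intro y
  rw [contMDiffAt_bilin_iff]
  refine ((A.isSmooth _).contMDiffAt_localMetric (S := S) (A.mem_source y)).congr_of_eventuallyEq ?_
  filter_upwards [A.eventually_mem_source y] with x hx
  simp only [bilinInCoordinates, A.inner_eq hx]

lemma inner_pos (y : M) (v : TangentSpace I y) (hv : v ≠ 0) : 0 < A.inner y v v := by
  have hy := A.mem_source y
  have hF := (A.isSmooth _).ne_zero y hy
  rw [A.inner_apply hy]
  set θ := A.chart (A.index y)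
  have h2 : 0 ≤ (‖(θ y).2‖ ^ 2)⁻¹ * Inner.inner ℝ (show R4 from dF I θ y v)
      (show R4 from dF I θ y v) := mul_nonneg (by positivity) real_inner_self_nonneg
  by_cases h : dP IK I θ y v = 0
  · have h3 : (show R4 from dF I θ y v) ≠ 0 := by
      intro h3
      apply hv
      apply (A.isSmooth _).ext_dP_dF hy
      · rw [map_zero]; exact h
      · rw [map_zero]; exact h3
    rw [h, map_zero]
    have : 0 < Inner.inner ℝ (show R4 from dF I θ y v) (show R4 from dF I θ y v) :=
      real_inner_self_pos.2 h3
    refine add_pos_of_nonneg_of_pos ?_ (mul_pos (by positivity) this)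
    exact le_refl _
  · exact add_pos_of_pos_of_nonneg (S.metric.pos _ _ h) h2

/-- Both terms of the metric are nonnegative, so a unit vector has both terms less than `1`. The
ball is thus contained in the sum of the images of the unit ball of `K` and of the Euclidean ball of
radius `|z|`. -/
lemma isVonNBounded_inner (y : M) :
    Bornology.IsVonNBounded ℝ {v : TangentSpace I y | A.inner y v v < 1} := by
  have hy := A.mem_source y
  have hF := (A.isSmooth _).ne_zero y hy
  set θ := A.chart (A.index y) with hθ
  have b1 := (S.metric.isVonNBounded (θ y).1).image (incK IK I θ y)
  have b2 : Bornology.IsVonNBounded ℝ (Metric.ball (0 : R4) ‖(θ y).2‖) :=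
    NormedSpace.isVonNBounded_ball ℝ _ _
  have b3 := Bornology.IsVonNBounded.image (E := R4) b2 (incF I θ y)
  refine (b1.add b3).subset ?_
  intro v hv
  rw [mem_ofPred_eq, A.inner_apply hy] at hv
  have h2 : 0 ≤ (‖(θ y).2‖ ^ 2)⁻¹ * Inner.inner ℝ (show R4 from dF I θ y v)
      (show R4 from dF I θ y v) := mul_nonneg (by positivity) real_inner_self_nonneg
  have h1 : 0 ≤ S.metric.inner (θ y).1 (dP IK I θ y v) (dP IK I θ y v) := by
    by_cases h : dP IK I θ y v = 0
    · rw [h, map_zero]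
    · exact (S.metric.pos _ _ h).le
  refine Set.mem_add.2 ⟨_, ⟨dP IK I θ y v, ?_, rfl⟩, _, ⟨dF I θ y v, ?_, rfl⟩,
    (A.isSmooth _).incK_dP_add_incF_dF hy v⟩
  · exact lt_of_le_of_lt (le_add_of_nonneg_right h2) hv
  · have h3 := lt_of_le_of_lt (le_add_of_nonneg_left h1) hv
    have h3' : (‖(θ y).2‖ ^ 2)⁻¹ * ‖(show R4 from dF I θ y v)‖ ^ 2 < 1 := by
      rwa [real_inner_self_eq_norm_sq] at h3
    rw [inv_mul_lt_one₀ (by positivity)] at h3'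
    have := lt_of_pow_lt_pow_left₀ 2 (norm_nonneg _) h3'
    exact mem_ball_zero_iff.2 this

/-- The Riemannian metric defined by the atlas. -/
def metric : SmoothMetric I M where
  inner := A.inner
  symm y v w := by
    have hy := A.mem_source y
    rw [A.inner_apply hy, A.inner_apply hy, S.metric.symm, real_inner_comm]
  pos := A.inner_pos
  isVonNBounded := A.isVonNBounded_inner
  contMDiff := A.contMDiff_inner

end HopfAtlas

end HopfAtlas

/-! ### Integrability, torsion and splitness. -/

section HopfAtlas

open Bundle

variable {EK : Type*} [NormedAddCommGroup EK] [NormedSpace ℝ EK] {HK : Type*} [TopologicalSpace HK]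
  {IK : ModelWithCorners ℝ EK HK} {K : Type*} [TopologicalSpace K] [ChartedSpace HK K]
  {E : Type*} [NormedAddCommGroup E] [NormedSpace ℝ E] {H : Type*} [TopologicalSpace H]
  {I : ModelWithCorners ℝ E H} {M : Type*} [TopologicalSpace M] [ChartedSpace H M]
  [IsManifold I ∞ M] [IsManifold IK ∞ K]

/-- A complex linear chart for `ℂⁿ × ℝ⁴`, where the complex structure of `ℝ⁴` is `R4.mulI s`. -/
lemma exists_complexCoordinates (n : ℕ) {s : ℝ} (hs : s * s = 1) :
    ∃ e : ((Fin n → ℂ) × R4) ≃L[ℝ] (Fin (n + 2) → ℂ),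
      ∀ a b, e (Complex.I • a, R4.mulI s b) = Complex.I • e (a, b) := by
  let l : ((Fin n → ℂ) × R4) →ₗ[ℝ] (Fin (n + 2) → ℂ) :=
    -- The last two complex coordinates are `x₀ + i x₁` and `x₂ + i s x₃`; the sign `s` turns `mulI
    -- s` into multiplication by `i`.
    { toFun := fun p => Fin.append p.1 ![⟨p.2 0, p.2 1⟩, ⟨p.2 2, s * p.2 3⟩]
      map_add' := by
        intro p q
        ext i : 1
        refine Fin.addCases (fun j => ?_) (fun j => ?_) i
        · simp
        · fin_cases j <;> apply Complex.ext <;> simp [mul_add]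
      map_smul' := by
        intro c p
        ext i : 1
        refine Fin.addCases (fun j => ?_) (fun j => ?_) i
        · simp
        · fin_cases j <;> apply Complex.ext <;> simp <;> ring }
  have hl : Injective l := by
    rw [← LinearMap.ker_eq_bot, LinearMap.ker_eq_bot']
    intro p hp
    have h1 : ∀ j, p.1 j = 0 := fun j => by
      have := congrFun hp (Fin.castAdd 2 j)
      simpa [l] using this
    have h2 := congrFun hp (Fin.natAdd n 0)
    have h3 := congrFun hp (Fin.natAdd n 1)
    simp only [l, LinearMap.coe_mk, AddHom.coe_mk, Fin.append_right, Pi.zero_apply] at h2 h3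
    have a0 := congrArg Complex.re h2
    have a1 := congrArg Complex.im h2
    have a2 := congrArg Complex.re h3
    have a3 := congrArg Complex.im h3
    simp at a0 a1 a2 a3
    have hs0 : s ≠ 0 := by rintro rfl; simp at hs
    refine Prod.ext (funext h1) (R4.ext4 a0 a1 a2 ?_)
    simpa [hs0] using a3
  have hd : Module.finrank ℝ ((Fin n → ℂ) × R4) = Module.finrank ℝ (Fin (n + 2) → ℂ) := by
    simp [Module.finrank_prod, Module.finrank_pi_fintype, Complex.finrank_real_complex]
    ring
  refine ⟨(LinearEquiv.ofInjectiveOfFinrankEq l hl hd).toContinuousLinearEquiv, fun a b => ?_⟩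
  change l _ = Complex.I • l _
  ext i : 1
  refine Fin.addCases (fun j => ?_) (fun j => ?_) i
  · simp [l]
  · fin_cases j
    · apply Complex.ext <;> simp [l]
    · apply Complex.ext
      · simp [l]
      · simp [l]
        linear_combination (b 2) * hs

namespace HopfAtlas

open IsSmoothChart

variable {S : KahlerStructure IK K} {ι : Type*} (A : HopfAtlas I M S ι)

/-- Holomorphic coordinates are obtained by combining those of `K` with the linear complex
coordinates of `ℝ⁴` adapted to `mulI s`. -/
lemma integrable_J {s : ℝ} (hs : s * s = 1) (x : M) :
    ∃ (n : ℕ) (φ : OpenPartialHomeomorph M (Fin n → ℂ)), x ∈ φ.source ∧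
    ContMDiffOn I 𝓘(ℝ, Fin n → ℂ) ∞ φ φ.source ∧
    ContMDiffOn 𝓘(ℝ, Fin n → ℂ) I ∞ φ.symm φ.target ∧
    ∀ y ∈ φ.source, ∀ v : TangentSpace I y,
      (mfderiv I 𝓘(ℝ, Fin n → ℂ) φ y (A.J s y v) : Fin n → ℂ)
        = Complex.I • (show Fin n → ℂ from mfderiv I 𝓘(ℝ, Fin n → ℂ) φ y v) := by
  have hx := A.mem_source x
  have hθ := A.isSmooth (A.index x)
  set θ := A.chart (A.index x) with hθdef
  obtain ⟨n, φ, hxφ, hφ, hφ', hJ⟩ := S.cplx.integrable (θ x).1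
  obtain ⟨e, he⟩ := exists_complexCoordinates n hs
  set ψ := (θ ≫ₕ φ.prod (OpenPartialHomeomorph.refl R4)) ≫ₕ
    e.toHomeomorph.toOpenPartialHomeomorph with hψ
  have hsrc : ∀ y, y ∈ ψ.source ↔ y ∈ θ.source ∧ (θ y).1 ∈ φ.source := by
    intro y
    simp [hψ]
  have hψe : ∀ y, ψ y = e (φ (θ y).1, (θ y).2) := fun y => rfl
  refine ⟨n + 2, ψ, (hsrc x).2 ⟨hx, hxφ⟩, ?_, ?_, ?_⟩
  · intro y hy
    obtain ⟨h1, h2⟩ := (hsrc y).1 hy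
    have a1 : ContMDiffAt I 𝓘(ℝ, Fin n → ℂ) ∞ (fun y => φ (θ y).1) y :=
      (hφ.contMDiffAt (φ.open_source.mem_nhds h2)).comp y (hθ.contMDiffAt_fst h1)
    have a2 := a1.prodMk_space (hθ.contMDiffAt_snd h1)
    exact (e.contDiff.contMDiff.contMDiffAt.comp y a2).contMDiffWithinAt
  · have hψs : ∀ w, ψ.symm w = θ.symm (φ.symm (e.symm w).1, (e.symm w).2) := fun w => rfl
    intro w hw
    have ht : (e.symm w).1 ∈ φ.target ∧ (φ.symm (e.symm w).1, (e.symm w).2) ∈ θ.target := by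
      simpa [hψ] using hw
    have b0 : ContMDiffAt 𝓘(ℝ, Fin (n + 2) → ℂ) 𝓘(ℝ, (Fin n → ℂ) × R4) ∞ e.symm w :=
      e.symm.contDiff.contMDiff.contMDiffAt
    have b1 : ContMDiffAt 𝓘(ℝ, Fin (n + 2) → ℂ) 𝓘(ℝ, Fin n → ℂ) ∞ (fun w => (e.symm w).1) w :=
      contDiff_fst.contMDiff.contMDiffAt.comp w b0
    have b2 : ContMDiffAt 𝓘(ℝ, Fin (n + 2) → ℂ) 𝓘(ℝ, R4) ∞ (fun w => (e.symm w).2) w :=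
      contDiff_snd.contMDiff.contMDiffAt.comp w b0
    have b3 := (hφ'.contMDiffAt (φ.open_target.mem_nhds ht.1)).comp w b1
    have b4 := hθ.contMDiffOn_symm.contMDiffAt (θ.open_target.mem_nhds ht.2)
    exact (b4.comp w (b3.prodMk b2)).contMDiffWithinAt
  · intro y hy
    obtain ⟨h1, h2⟩ := (hsrc y).1 hy
    have c1 : MDifferentiableAt I IK (fun y => (θ y).1) y :=
      (hθ.contMDiffAt_fst h1).mdifferentiableAt (by simp)
    have c2 : MDifferentiableAt IK 𝓘(ℝ, Fin n → ℂ) φ (θ y).1 :=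
      (hφ.contMDiffAt (φ.open_source.mem_nhds h2)).mdifferentiableAt (by simp)
    have c3 : MDifferentiableAt I 𝓘(ℝ, R4) (fun y => (θ y).2) y :=
      (hθ.contMDiffAt_snd h1).mdifferentiableAt (by simp)
    have key : ∀ v : E, (mfderiv I 𝓘(ℝ, Fin (n + 2) → ℂ) ψ y : E →L[ℝ] (Fin (n + 2) → ℂ)) v
        = e ((mfderiv IK 𝓘(ℝ, Fin n → ℂ) φ (θ y).1 : EK →L[ℝ] (Fin n → ℂ))
          ((dP IK I θ y : E →L[ℝ] EK) v), (dF I θ y : E →L[ℝ] R4) v) := by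
      intro v
      have d1 : HasMFDerivAt I 𝓘(ℝ, Fin n → ℂ) (fun y => φ (θ y).1) y
          ((mfderiv IK 𝓘(ℝ, Fin n → ℂ) φ (θ y).1).comp (dP IK I θ y)) :=
        c2.hasMFDerivAt.comp y c1.hasMFDerivAt
      have d2 : HasMFDerivAt I 𝓘(ℝ, (Fin n → ℂ) × R4) (fun y => (φ (θ y).1, (θ y).2)) y
          (((mfderiv IK 𝓘(ℝ, Fin n → ℂ) φ (θ y).1).comp (dP IK I θ y)).prod (dF I θ y)) :=
        ⟨d1.1.prodMk c3.hasMFDerivAt.1, d1.2.prodMk c3.hasMFDerivAt.2⟩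
      have d3 : HasMFDerivAt 𝓘(ℝ, (Fin n → ℂ) × R4) 𝓘(ℝ, Fin (n + 2) → ℂ) e
          (φ (θ y).1, (θ y).2) (e : ((Fin n → ℂ) × R4) →L[ℝ] (Fin (n + 2) → ℂ)) :=
        e.hasFDerivAt.hasMFDerivAt
      have d4 := (d3.comp y d2).mfderiv
      exact congrArg (fun f : E →L[ℝ] (Fin (n + 2) → ℂ) => f v) d4
    intro v
    have k1 := key (A.J s y v)
    have k2 := key v
    have hP := A.dP_J h1 s v
    have hF := A.dF_J h1 s v
    refine k1.trans ?_
    refine Eq.trans ?_ (congrArg (fun w : Fin (n + 2) → ℂ => Complex.I • w) k2).symm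
    refine Eq.trans ?_ (he _ _)
    refine congrArg e (Prod.ext ?_ hF)
    refine Eq.trans ?_ (hJ _ h2 (dP IK I θ y v))
    exact congrArg (mfderiv IK 𝓘(ℝ, Fin n → ℂ) φ (θ y).1 : EK →L[ℝ] (Fin n → ℂ)) hP

/-- The complex structures defined by the atlas. -/
def cplx {s : ℝ} (hs : s * s = 1) : ComplexStructure I M where
  J := A.J s
  J_J := A.J_J hs
  contMDiff := A.contMDiff_J s
  integrable := A.integrable_J hs

/-- The Hermitian structures defined by the atlas. -/
def hermitian {s : ℝ} (hs : s * s = 1) : HermitianStructure I M where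
  metric := A.metric
  cplx := A.cplx hs
  compatible := A.inner_J_J hs

variable [I.Boundaryless] [IK.Boundaryless] [FiniteDimensional ℝ E] [FiniteDimensional ℝ EK]

omit [I.Boundaryless] [IK.Boundaryless] [FiniteDimensional ℝ E] [FiniteDimensional ℝ EK] in
lemma fundamentalForm_eq {s : ℝ} (hs : s * s = 1) {i : ι} {y : M} (hy : y ∈ (A.chart i).source) :
    (A.hermitian hs).fundamentalForm y
      = DiffForm.pullback I (fun y => (A.chart i y).1) S.fundamentalForm y
        + DiffForm.pullback I (fun y => (A.chart i y).2) (DiffForm.ofFun (R4.conformalForm s)) y := by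
  ext v
  refine (A.inner_apply hy _ _).trans ?_
  refine congrArg₂ (· + ·) ?_ ?_
  · exact congrArg (fun w : EK => (S.metric.inner (A.chart i y).1 : EK →L[ℝ] EK →L[ℝ] ℝ) w
      (dP IK I (A.chart i) y (v 1))) (A.dP_J hy s (v 0))
  · exact congrArg (fun w : R4 => (‖(A.chart i y).2‖ ^ 2)⁻¹ *
      Inner.inner ℝ w (show R4 from dF I (A.chart i) y (v 1))) (A.dF_J hy s (v 0))

/-- The fundamental form is a sum of two pullbacks; the one from `K` is closed. This is the point
where the Kähler condition enters. -/
lemma extDeriv_fundamentalForm {s : ℝ} (hs : s * s = 1) {i : ι} {y : M}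
    (hy : y ∈ (A.chart i).source) :
    (A.hermitian hs).fundamentalForm.extDeriv y
      = DiffForm.pullback I (fun y => (A.chart i y).2)
        (DiffForm.ofFun (extDeriv (R4.conformalForm s))) y := by
  have hθ := A.isSmooth i
  have hS := S.contDiffAt_fundamentalForm_inChart (A.chart i y).1
  have hF := R4.contDiffAt_inChart_conformalForm s (hθ.ne_zero y hy)
  have h1 := DiffForm.contDiffAt_inChart_pullback (mem_extChartAt_source (I := I) y)
    (mem_extChartAt_source _) (hθ.contMDiffAt_fst hy) hS
  have h2 := DiffForm.contDiffAt_inChart_pullback (mem_extChartAt_source (I := I) y)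
    (mem_extChartAt_source _) (hθ.contMDiffAt_snd hy) hF
  have e : ∀ᶠ x in 𝓝 y, (A.hermitian hs).fundamentalForm x
      = (DiffForm.pullback I (fun y => (A.chart i y).1) S.fundamentalForm
        + DiffForm.pullback I (fun y => (A.chart i y).2)
          (DiffForm.ofFun (R4.conformalForm s))) x := by
    filter_upwards [(A.chart i).open_source.mem_nhds hy] with x hx
    exact A.fundamentalForm_eq hs hx
  rw [DiffForm.extDeriv_congr e, DiffForm.extDeriv_add_of_differentiableAt
    (h1.differentiableAt (by simp)) (h2.differentiableAt (by simp)),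
    DiffForm.extDeriv_pullback (hθ.contMDiffAt_fst hy) (hS.differentiableAt (by simp)),
    DiffForm.extDeriv_pullback (hθ.contMDiffAt_snd hy) (hF.differentiableAt (by simp)),
    S.closed, DiffForm.extDeriv_ofFun]
  exact zero_add _

/-- In the charts, the torsion is a multiple of the volume form of the three-sphere. -/
lemma dcFundamentalForm_eq {s : ℝ} (hs : s * s = 1) {i : ι} {y : M}
    (hy : y ∈ (A.chart i).source) :
    (A.hermitian hs).dcFundamentalForm y
      = s • DiffForm.pullback I (fun y => (A.chart i y).2) (DiffForm.ofFun R4.sphereForm) y := by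
  ext v
  have h := R4.extDeriv_conformalForm_mulI hs ((A.isSmooth i).ne_zero y hy)
    (fun j => dF I (A.chart i) y (v j))
  refine Eq.trans ?_ h
  simp only [HermitianStructure.dcFundamentalForm, A.extDeriv_fundamentalForm hs hy]
  refine congrArg Neg.neg ?_
  refine congrArg (extDeriv (R4.conformalForm s) (A.chart i y).2) (funext fun j => ?_)
  exact A.dF_J hy s (v j)

lemma extDeriv_dcFundamentalForm {s : ℝ} (hs : s * s = 1) :
    (A.hermitian hs).dcFundamentalForm.extDeriv = 0 := by
  funext y
  have hy := A.mem_source y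
  have hθ := A.isSmooth (A.index y)
  have e : ∀ᶠ x in 𝓝 y, (A.hermitian hs).dcFundamentalForm x
      = (s • DiffForm.pullback I (fun x => (A.chart (A.index y) x).2)
        (DiffForm.ofFun R4.sphereForm)) x := by
    filter_upwards [(A.chart (A.index y)).open_source.mem_nhds hy] with x hx
    exact A.dcFundamentalForm_eq hs hx
  have hd := (R4.contDiffAt_inChart_sphereForm (hθ.ne_zero y hy)).differentiableAt (by simp)
  rw [DiffForm.extDeriv_congr e, DiffForm.extDeriv_smul, Pi.smul_apply,
    DiffForm.extDeriv_pullback (hθ.contMDiffAt_snd hy) hd, DiffForm.extDeriv_ofFun]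
  ext v
  change s * (extDeriv R4.sphereForm (A.chart (A.index y) y).2) _ = 0
  rw [R4.extDeriv_sphereForm (hθ.ne_zero y hy)]
  exact mul_zero s

lemma isSmooth_dcFundamentalForm {s : ℝ} (hs : s * s = 1) :
    (A.hermitian hs).dcFundamentalForm.IsSmooth := by
  intro x₀ w hw
  refine ContDiffAt.contDiffWithinAt ?_
  set y := (extChartAt I x₀).symm w with hyw
  have hyx : y ∈ (extChartAt I x₀).source := (extChartAt I x₀).map_target hw
  have hwy : extChartAt I x₀ y = w := (extChartAt I x₀).right_inv hw
  have hy := A.mem_source y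
  have hθ := A.isSmooth (A.index y)
  have e : ∀ᶠ x in 𝓝 y, (A.hermitian hs).dcFundamentalForm x
      = (s • DiffForm.pullback I (fun x => (A.chart (A.index y) x).2)
        (DiffForm.ofFun R4.sphereForm)) x := by
    filter_upwards [(A.chart (A.index y)).open_source.mem_nhds hy] with x hx
    exact A.dcFundamentalForm_eq hs hx
  have hd := R4.contDiffAt_inChart_sphereForm (hθ.ne_zero y hy)
  have h := (DiffForm.contDiffAt_inChart_pullback hyx (mem_extChartAt_source _)
    (hθ.contMDiffAt_snd hy) hd).const_smul s
  rw [hwy] at h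
  refine h.congr_of_eventuallyEq ?_
  have := DiffForm.inChart_congr hyx e
  rw [hwy] at this
  exact this

/-- The generalized Kähler structure defined by the atlas. -/
def generalizedKahler : GeneralizedKahlerStructure I M where
  metric := A.metric
  Iplus := A.cplx (s := 1) (by norm_num)
  Iminus := A.cplx (s := -1) (by norm_num)
  compatible_plus := A.inner_J_J (by norm_num)
  compatible_minus := A.inner_J_J (by norm_num)
  dc_plus_eq := by
    funext y
    -- Both torsions are `s` times the same form, so they are opposite for `s = 1` and `s = -1`.
    have h1 := A.dcFundamentalForm_eq (s := 1) (by norm_num) (A.mem_source y)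
    have h2 := A.dcFundamentalForm_eq (s := -1) (by norm_num) (A.mem_source y)
    refine h1.trans ?_
    rw [neg_smul] at h2
    exact (neg_eq_iff_eq_neg.2 h2).symm
  ddc_plus := A.extDeriv_dcFundamentalForm (by norm_num)

lemma torsion_eq {i : ι} {y : M} (hy : y ∈ (A.chart i).source) :
    A.generalizedKahler.torsion y
      = DiffForm.pullback I (fun y => (A.chart i y).2) (DiffForm.ofFun R4.sphereForm) y :=
  (A.dcFundamentalForm_eq (s := 1) (by norm_num) hy).trans (one_smul _ _)

lemma torsion_mem_closedForms :
    A.generalizedKahler.torsion ∈ DiffForm.closedForms I M 3 :=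
  ⟨A.isSmooth_dcFundamentalForm (s := 1) (by norm_num),
    A.extDeriv_dcFundamentalForm (s := 1) (by norm_num)⟩

lemma isSplit_generalizedKahler : A.generalizedKahler.IsSplit := by
  intro y
  have hy := A.mem_source y
  have hθ := A.isSmooth (A.index y)
  have key : ∀ (s : ℝ) (z : R4), dF I (A.chart (A.index y)) y
      (A.J s y (incF I (A.chart (A.index y)) y z)) = R4.mulI s z := fun s z =>
    (A.dF_J hy s _).trans (congrArg (R4.mulI s) (hθ.dF_incF hy z))
  refine ⟨?_, fun h => ?_, fun h => ?_⟩
  · ext v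
    change A.J 1 y (A.J (-1) y v) = A.J (-1) y (A.J 1 y v)
    apply hθ.ext_dP_dF hy
    · rw [A.dP_J hy, A.dP_J hy, A.dP_J hy, A.dP_J hy]
    · rw [A.dF_J hy, A.dF_J hy, A.dF_J hy, A.dF_J hy]
      exact R4.mulI_comm _ _ _
  · have h' : A.J 1 y = A.J (-1) y := h
    -- On the plane `(x₂, x₃)` the two structures are opposite, hence not equal.
    have h1 := key 1 (WithLp.toLp 2 ![0, 0, 1, 0])
    rw [h'] at h1
    have h2 := h1.symm.trans (key (-1) _)
    have h3 : (1 : ℝ) * 1 = -1 * 1 := congrArg (fun z : R4 => z 3) h2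
    norm_num at h3
  · have h' : A.J 1 y = -A.J (-1) y := h
    -- On the plane `(x₀, x₁)` they agree, hence are not opposite.
    have h1 := key 1 (WithLp.toLp 2 ![1, 0, 0, 0])
    rw [h'] at h1
    have h2 : R4.mulI 1 _ = -R4.mulI (-1) _ := h1.symm.trans
      ((map_neg (dF I (A.chart (A.index y)) y) _).trans (congrArg Neg.neg (key (-1) _)))
    have h3 : (1 : ℝ) = -1 := congrArg (fun z : R4 => z 1) h2
    norm_num at h3

end HopfAtlas

end HopfAtlas

/-! ### Opposite orientations. -/

section Orientation

/-- A vector space with a complex structure has a real basis of the form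
`v₁, J v₁, …, vₙ, J vₙ`. -/
lemma exists_basis_of_complexStructure {V : Type*} [AddCommGroup V] [Module ℝ V]
    [FiniteDimensional ℝ V] (J : V →ₗ[ℝ] V) (hJ : ∀ v, J (J v) = -v) :
    ∃ (n : ℕ) (b : Module.Basis (Fin n × Fin 2) ℝ V), ∀ i, b (i, 1) = J (b (i, 0)) := by
  have hJ' : J * J = -1 := LinearMap.ext hJ
  -- `J` makes `V` a complex vector space; a complex basis tensored with the real basis `1, i` of
  -- `ℂ` is the required one.
  let φ : ℂ →ₐ[ℝ] Module.End ℝ V := Complex.lift ⟨J, hJ'⟩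
  let : Module ℂ V := Module.compHom V φ.toRingHom
  have hI : ∀ v : V, Complex.I • v = J v := fun v => by
    change φ Complex.I v = J v
    simp [φ]
  have : IsScalarTower ℝ ℂ V := ⟨fun r c v => by
    change φ (r • c) v = r • φ c v
    rw [map_smul]
    rfl⟩
  have : FiniteDimensional ℂ V := FiniteDimensional.right ℝ ℂ V
  let b := Module.finBasis ℂ V
  refine ⟨_, (Complex.basisOneI.smulTower b).reindex (Equiv.prodComm _ _), fun i => ?_⟩
  simp [Module.Basis.smulTower_apply, hI]

open Bundle

variable {EK : Type*} [NormedAddCommGroup EK] [NormedSpace ℝ EK] {HK : Type*} [TopologicalSpace HK]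
  {IK : ModelWithCorners ℝ EK HK} {K : Type*} [TopologicalSpace K] [ChartedSpace HK K]
  {E : Type*} [NormedAddCommGroup E] [NormedSpace ℝ E] {H : Type*} [TopologicalSpace H]
  {I : ModelWithCorners ℝ E H} {M : Type*} [TopologicalSpace M] [ChartedSpace H M]
  [IsManifold I ∞ M] [IsManifold IK ∞ K] [I.Boundaryless] [IK.Boundaryless]
  [FiniteDimensional ℝ E] [FiniteDimensional ℝ EK]

namespace HopfAtlas

open IsSmoothChart

variable {S : KahlerStructure IK K} {ι : Type*} (A : HopfAtlas I M S ι)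

omit [I.Boundaryless] [IK.Boundaryless] [FiniteDimensional ℝ E] [FiniteDimensional ℝ EK] in
-- The isomorphism `T` does not depend on `s`, so both complex structures are put in product form
-- simultaneously.
lemma exists_splitting (y : M) : ∃ (p : K) (T : (EK × R4) ≃ₗ[ℝ] TangentSpace I y),
    ∀ (s : ℝ) (a : EK) (b : R4),
      A.J s y (T (a, b)) = T ((S.cplx.J p : EK →L[ℝ] EK) a, R4.mulI s b) := by
  have hy := A.mem_source y
  have hθ := A.isSmooth (A.index y)
  set θ := A.chart (A.index y)
  let T : (EK × R4) →ₗ[ℝ] TangentSpace I y :=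
    (LinearMap.coprod (incK IK I θ y : EK →L[ℝ] E).toLinearMap
      (incF I θ y : R4 →L[ℝ] E).toLinearMap)
  have hT : ∀ a b, T (a, b) = incK IK I θ y a + incF I θ y b := fun a b => rfl
  have h1 : ∀ a b, (dP IK I θ y : E →L[ℝ] EK) (T (a, b)) = a := fun a b => by
    refine (map_add (dP IK I θ y) _ _).trans ?_
    exact (congrArg₂ (· + ·) (hθ.dP_incK hy a) (hθ.dP_incF hy b)).trans (add_zero _)
  have h2 : ∀ a b, (dF I θ y : E →L[ℝ] R4) (T (a, b)) = b := fun a b => by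
    refine (map_add (dF I θ y) _ _).trans ?_
    exact (congrArg₂ (· + ·) (hθ.dF_incK hy a) (hθ.dF_incF hy b)).trans (zero_add _)
  have hbij : Bijective T := by
    constructor
    · rintro ⟨a, b⟩ ⟨a', b'⟩ h
      refine Prod.ext ?_ ?_
      · have := congrArg (dP IK I θ y : E →L[ℝ] EK) h
        exact (h1 a b).symm.trans (this.trans (h1 a' b'))
      · have := congrArg (dF I θ y : E →L[ℝ] R4) h
        exact (h2 a b).symm.trans (this.trans (h2 a' b'))
    · intro v
      exact ⟨(dP IK I θ y v, dF I θ y v), hθ.incK_dP_add_incF_dF hy v⟩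
  refine ⟨(θ y).1, LinearEquiv.ofBijective T hbij, fun s a b => ?_⟩
  apply hθ.ext_dP_dF hy
  · rw [A.dP_J hy]
    exact (congrArg (S.cplx.J (θ y).1 : EK →L[ℝ] EK) (h1 a b)).trans (h1 _ _).symm
  · rw [A.dF_J hy]
    exact (congrArg (R4.mulI s) (h2 a b)).trans (h2 _ _).symm

lemma inducesOppositeOrientations_generalizedKahler :
    A.generalizedKahler.InducesOppositeOrientations := by
  intro y
  obtain ⟨p, T, hT⟩ := A.exists_splitting y
  let JK : EK →ₗ[ℝ] EK := (S.cplx.J p : EK →L[ℝ] EK).toLinearMap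
  obtain ⟨n, bK, hbK⟩ := exists_basis_of_complexStructure JK (S.cplx.J_J p)
  have hTF : ∀ s b, A.J s y (T (0, b)) = T (0, R4.mulI s b) := fun s b =>
    (hT s 0 b).trans (congrArg (fun a : EK => T (a, R4.mulI s b)) (map_zero JK))
  let bF : Module.Basis (Fin 2 × Fin 2) ℝ R4 :=
    (EuclideanSpace.basisFun (Fin (3 + 1)) ℝ).toBasis.reindex (finProdFinEquiv (m := 2) (n := 2)).symm
  let e : (Fin n × Fin 2) ⊕ (Fin 2 × Fin 2) ≃ Fin (n + 2) × Fin 2 :=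
    (Equiv.sumProdDistrib _ _ _).symm.trans (finSumFinEquiv.prodCongr (Equiv.refl _))
  let b : Module.Basis (Fin (n + 2) × Fin 2) ℝ (TangentSpace I y) :=
    ((bK.prod bF).map T).reindex e
  have b1 : ∀ i j, b (Fin.castAdd 2 i, j) = T (bK (i, j), 0) := fun i j => by
    have : e.symm (Fin.castAdd 2 i, j) = Sum.inl (i, j) := by
      rw [Equiv.symm_apply_eq]; rfl
    simp [b, this]
  have b2 : ∀ i j, b (Fin.natAdd n i, j) = T (0, bF (i, j)) := fun i j => by
    have : e.symm (Fin.natAdd n i, j) = Sum.inr (i, j) := by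
      rw [Equiv.symm_apply_eq]; rfl
    simp [b, this]
  have f1 : R4.mulI 1 (bF (0, 0)) = bF (0, 1) ∧ R4.mulI (-1) (bF (0, 0)) = bF (0, 1) := by
    constructor <;> apply R4.ext4 <;> simp [bF, finProdFinEquiv]
  -- Among the pairs of adapted basis vectors this is the only one on which the two structures
  -- differ.
  have f2 : R4.mulI 1 (bF (1, 0)) = bF (1, 1) ∧ R4.mulI (-1) (bF (1, 0)) = -bF (1, 1) := by
    constructor <;> apply R4.ext4 <;> simp [bF, finProdFinEquiv]
  refine ⟨n + 2, b.orientation, ⟨b, fun i => ?_, rfl⟩,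
    -- Changing the sign of the last vector makes the basis adapted to `I₋`, and a single sign
    -- change reverses the orientation.
    ⟨b.unitsSMul (Function.update 1 (Fin.natAdd n 1, 1) (-1)), fun i => ?_,
      b.orientation_neg_single _⟩⟩
  · change _ = A.J 1 y _
    refine Fin.addCases (fun j => ?_) (fun j => ?_) i
    · rw [b1, b1, hT, hbK, map_zero]
      rfl
    · rw [b2, b2, hTF]
      fin_cases j
      · exact congrArg (fun z => T (0, z)) f1.1.symm
      · exact congrArg (fun z => T (0, z)) f2.1.symm
  · change _ = A.J (-1) y _
    rw [Module.Basis.unitsSMul_apply, Module.Basis.unitsSMul_apply]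
    refine Fin.addCases (fun j => ?_) (fun j => ?_) i
    · have u : ∀ j', (Function.update (1 : Fin (n + 2) × Fin 2 → ℝˣ) (Fin.natAdd n 1, 1) (-1))
          (Fin.castAdd 2 j, j') = 1 := fun j' => by
        rw [Function.update_of_ne]
        · rfl
        · intro h
          have := congrArg (fun x => (x.1 : ℕ)) h
          simp at this
          omega
      rw [u, u, one_smul, one_smul, b1, b1, hT, hbK, map_zero]
      rfl
    · have u : ∀ j', (Function.update (1 : Fin (n + 2) × Fin 2 → ℝˣ) (Fin.natAdd n 1, 1) (-1))
          (Fin.natAdd n j, j') = if j = 1 ∧ j' = 1 then -1 else 1 := fun j' => by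
        simp [Function.update_apply, Prod.ext_iff, Fin.ext_iff]
      rw [u, u, b2, b2]
      fin_cases j
      · simp only [Fin.zero_eta, Fin.isValue, zero_ne_one, false_and, if_false, one_smul]
        rw [hTF]
        exact congrArg (fun z => T (0, z)) f1.2.symm
      · simp only [Fin.mk_one, Fin.isValue, zero_ne_one, and_false, if_false, and_self, if_true,
          one_smul, hTF, f2.2]
        rw [Units.neg_smul, one_smul, ← map_neg, Prod.neg_mk, neg_zero]

end HopfAtlas

end Orientation

/-! ### Smoothness of the covering `M × ℝ → M_f` and of its local inverses. -/

section MappingTorusSmooth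

variable {E : Type*} [NormedAddCommGroup E] [NormedSpace ℝ E] {H : Type*} [TopologicalSpace H]
  {I : ModelWithCorners ℝ E H} {M : Type*} [TopologicalSpace M] [ChartedSpace H M]

namespace MappingTorus

variable (f : M ≃ₘ⟮I, I⟯ M) [T2Space M] [LocallyCompactSpace M]

/-- The local inverse of the quotient map `M × ℝ → M_f` at a point. -/
abbrev localInverse (x : M × ℝ) : OpenPartialHomeomorph (MappingTorus f) (M × ℝ) :=
  (isLocalHomeomorph_mk f).localInverseAt x

lemma localInverse_symm (x : M × ℝ) : ⇑(localInverse f x).symm = mk f :=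
  (isLocalHomeomorph_mk f).localInverseAt_symm x

lemma mk_localInverse {x : M × ℝ} {y : MappingTorus f} (hy : y ∈ (localInverse f x).source) :
    mk f (localInverse f x y) = y :=
  (isLocalHomeomorph_mk f).apply_localInverseAt_of_mem hy

lemma contMDiffAt_localInverse_comp_mk {x y : M × ℝ} (hy : mk f y ∈ (localInverse f x).source) :
    ContMDiffAt (I.prod 𝓘(ℝ, ℝ)) (I.prod 𝓘(ℝ, ℝ)) ∞ (fun z => localInverse f x (mk f z)) y :=
  (contMDiffOn_localInverse_comp_mk f x).contMDiffAt
    (((localInverse f x).open_source.preimage (isLocalHomeomorph_mk f).continuous).mem_nhds hy)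

lemma extChartAt_eq (q y : MappingTorus f) : extChartAt (I.prod 𝓘(ℝ, ℝ)) q y
    = extChartAt (I.prod 𝓘(ℝ, ℝ)) (surjInv (surjective_mk f) q)
      (localInverse f (surjInv (surjective_mk f) q) y) := rfl

lemma mem_localInverse_surjInv_source (q : MappingTorus f) :
    q ∈ (localInverse f (surjInv (surjective_mk f) q)).source := by
  have := (isLocalHomeomorph_mk f).apply_self_mem_localInverseAt_source
    (x := surjInv (surjective_mk f) q)
  rwa [surjInv_eq (surjective_mk f)] at this

lemma localInverse_surjInv_self (q : MappingTorus f) :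
    localInverse f (surjInv (surjective_mk f) q) q = surjInv (surjective_mk f) q := by
  have := (isLocalHomeomorph_mk f).localInverseAt_apply_self (x := surjInv (surjective_mk f) q)
  rwa [surjInv_eq (surjective_mk f)] at this

variable [IsManifold I ∞ M] [I.Boundaryless]

omit [IsManifold I ∞ M] [I.Boundaryless] in
-- Read in a chart of the target, `mk` becomes a local inverse composed with `mk`, which is locally
-- a deck transformation.
lemma contMDiff_mk : ContMDiff (I.prod 𝓘(ℝ, ℝ)) (I.prod 𝓘(ℝ, ℝ)) ∞ (mk f) := by
  intro x
  rw [contMDiffAt_iff_target]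
  refine ⟨(isLocalHomeomorph_mk f).continuous.continuousAt, ?_⟩
  have h1 := contMDiffAt_localInverse_comp_mk f (mem_localInverse_surjInv_source f (mk f x))
  refine ContMDiffAt.comp x (g := extChartAt (I.prod 𝓘(ℝ, ℝ)) (surjInv (surjective_mk f) (mk f x)))
    ?_ h1
  have h2 := localInverse_surjInv_self f (mk f x)
  have h3 : ContMDiffAt (I.prod 𝓘(ℝ, ℝ)) 𝓘(ℝ, E × ℝ) ∞
      (extChartAt (I.prod 𝓘(ℝ, ℝ)) (surjInv (surjective_mk f) (mk f x)))
      (surjInv (surjective_mk f) (mk f x)) := contMDiffAt_extChartAt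
  exact (congrArg (ContMDiffAt (I.prod 𝓘(ℝ, ℝ)) 𝓘(ℝ, E × ℝ) ∞
    (extChartAt (I.prod 𝓘(ℝ, ℝ)) (surjInv (surjective_mk f) (mk f x)))) h2).mpr h3

/-- This is the branch used to define the chart at `q`, so near `q` it is that chart followed by an
inverse chart of `M × ℝ`. -/
lemma contMDiffAt_localInverse_surjInv (q : MappingTorus f) :
    ContMDiffAt (I.prod 𝓘(ℝ, ℝ)) (I.prod 𝓘(ℝ, ℝ)) ∞
      (localInverse f (surjInv (surjective_mk f) q)) q := by
  set r := surjInv (surjective_mk f) q with hr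
  have h1 : ContMDiffAt (I.prod 𝓘(ℝ, ℝ)) 𝓘(ℝ, E × ℝ) ∞ (extChartAt (I.prod 𝓘(ℝ, ℝ)) q) q :=
    contMDiffAt_extChartAt
  have h2 : ContMDiffAt 𝓘(ℝ, E × ℝ) (I.prod 𝓘(ℝ, ℝ)) ∞ (extChartAt (I.prod 𝓘(ℝ, ℝ)) r).symm
      (extChartAt (I.prod 𝓘(ℝ, ℝ)) q q) := by
    rw [extChartAt_eq, localInverse_surjInv_self]
    exact (contMDiffOn_extChartAt_symm r).contMDiffAt (extChartAt_target_mem_nhds r)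
  refine (h2.comp q h1).congr_of_eventuallyEq ?_
  have h3 : ContinuousAt (localInverse f r) q :=
    (localInverse f r).continuousAt (mem_localInverse_surjInv_source f q)
  have h4 : ∀ᶠ y in 𝓝 q, localInverse f r y ∈ (extChartAt (I.prod 𝓘(ℝ, ℝ)) r).source := by
    refine h3.preimage_mem_nhds ?_
    rw [localInverse_surjInv_self]
    exact extChartAt_source_mem_nhds r
  filter_upwards [h4] with y hy
  rw [comp_apply, extChartAt_eq, (extChartAt (I.prod 𝓘(ℝ, ℝ)) r).left_inv hy]

/-- An arbitrary branch is compared with the preferred one at `q`: going up by the latter, down by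
`mk` and up again by the former. -/
lemma contMDiffOn_localInverse (x : M × ℝ) :
    ContMDiffOn (I.prod 𝓘(ℝ, ℝ)) (I.prod 𝓘(ℝ, ℝ)) ∞ (localInverse f x)
      (localInverse f x).source := by
  intro q hq
  refine ContMDiffAt.contMDiffWithinAt ?_
  set r := surjInv (surjective_mk f) q with hr
  have hqr : mk f r = q := surjInv_eq _ _
  have h1 : ContMDiffAt (I.prod 𝓘(ℝ, ℝ)) (I.prod 𝓘(ℝ, ℝ)) ∞
      (fun z => localInverse f x (mk f z)) (localInverse f r q) := by
    apply contMDiffAt_localInverse_comp_mk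
    rwa [localInverse_surjInv_self, hqr]
  refine (h1.comp q (contMDiffAt_localInverse_surjInv f q)).congr_of_eventuallyEq ?_
  filter_upwards [(localInverse f r).open_source.mem_nhds (mem_localInverse_surjInv_source f q)]
    with y hy
  simp only [comp_apply, mk_localInverse f hy]

omit [IsManifold I ∞ M] [I.Boundaryless] in
-- At `y` the two lifts lie in one orbit, which fixes `n`. Nearby, the translate by `n` of the first
-- lift stays in the target of the second branch, on which `mk` is injective.
lemma exists_localInverse_eventuallyEq {x x' : M × ℝ} {y : MappingTorus f}
    (hy : y ∈ (localInverse f x).source) (hy' : y ∈ (localInverse f x').source) :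
    ∃ n : ℤ, ∀ᶠ z in 𝓝 y, localInverse f x' z
      = (((f.toEquiv ^ n : Equiv.Perm M) (localInverse f x z).1, (localInverse f x z).2 + n)
        : M × ℝ) := by
  let := suspensionAction f
  have h1 : mk f (localInverse f x' y) = mk f (localInverse f x y) := by
    rw [mk_localInverse f hy, mk_localInverse f hy']
  obtain ⟨n, hn⟩ := (isAddQuotientCoveringMap_mk f).apply_eq_iff_mem_orbit.mp h1
  have hn' : n +ᵥ localInverse f x y = localInverse f x' y := hn
  have h2 : ContinuousAt (fun z => n +ᵥ localInverse f x z) y :=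
    (contMDiff_vadd f n).continuous.continuousAt.comp ((localInverse f x).continuousAt hy)
  have h3 : ∀ᶠ z in 𝓝 y, n +ᵥ localInverse f x z ∈ (localInverse f x').target := by
    refine h2.preimage_mem_nhds ((localInverse f x').open_target.mem_nhds ?_)
    rw [hn']
    exact (localInverse f x').map_source hy'
  refine ⟨n, ?_⟩
  filter_upwards [h3, (localInverse f x).open_source.mem_nhds hy] with z hz hz'
  change _ = n +ᵥ localInverse f x z
  have h4 : mk f (n +ᵥ localInverse f x z) = z :=
    ((isAddQuotientCoveringMap_mk f).map_vadd n).trans (mk_localInverse f hz')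
  have h5 := (localInverse f x').right_inv hz
  rwa [localInverse_symm, h4] at h5

end MappingTorus

end MappingTorusSmooth

/-! ### Polar coordinates on `ℝ⁴ \ {0}`. -/

section PolarCoordinates

/-- The radial projection of `ℝ⁴ \ {0}` on the sphere. -/
def radialProjection (z : R4) : Sphere3 :=
  -- The value at the origin is arbitrary.
  if h : z = 0 then ⟨EuclideanSpace.single 0 1, by simp⟩
  else ⟨‖z‖⁻¹ • z, by simp [norm_smul, h]⟩

lemma coe_radialProjection {z : R4} (hz : z ≠ 0) : (radialProjection z : R4) = ‖z‖⁻¹ • z := by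
  rw [radialProjection, dif_neg hz]

/-- Restricting the codomain to the sphere is done for globally smooth maps into `ℝ⁴`, hence the
passage to the open submanifold `ℝ⁴ \ {0}`. -/
lemma contMDiffAt_radialProjection {z : R4} (hz : z ≠ 0) :
    ContMDiffAt 𝓘(ℝ, R4) (𝓡 3) ∞ radialProjection z := by
  let U : TopologicalSpace.Opens R4 := ⟨{0}ᶜ, isOpen_compl_singleton⟩
  have hU : ∀ x : U, (x : R4) ≠ 0 := fun x => x.2
  have h1 : ContMDiff 𝓘(ℝ, R4) 𝓘(ℝ, R4) ∞ (fun x : U => ‖(x : R4)‖⁻¹ • (x : R4)) := by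
    intro x
    have : ContDiffAt ℝ ∞ (fun x : R4 => ‖x‖⁻¹ • x) x :=
      ((contDiffAt_norm ℝ (hU x)).inv (norm_ne_zero_iff.2 (hU x))).smul contDiffAt_id
    exact contMDiffAt_subtype_iff.2 this.contMDiffAt
  have : Fact (Module.finrank ℝ R4 = 3 + 1) := ⟨finrank_euclideanSpace_fin⟩
  have h2 := h1.codRestrict_sphere (n := 3) (fun x => by
    simp [norm_smul, hU x])
  have h3 := h2 ⟨z, hz⟩
  rw [← contMDiffAt_subtype_iff (U := U) (x := ⟨z, hz⟩)]
  exact h3.congr_of_eventuallyEq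
    (Filter.Eventually.of_forall fun x => Subtype.ext (coe_radialProjection (hU x)))

variable {EK : Type*} [NormedAddCommGroup EK] [NormedSpace ℝ EK] {HK : Type*} [TopologicalSpace HK]
  {IK : ModelWithCorners ℝ EK HK} {K : Type*} [TopologicalSpace K] [ChartedSpace HK K]

lemma norm_exp_smul_sphere (t : ℝ) (q : Sphere3) : ‖Real.exp t • (q : R4)‖ = Real.exp t := by
  simp [norm_smul]

lemma exp_smul_sphere_ne_zero (t : ℝ) (q : Sphere3) : Real.exp t • (q : R4) ≠ 0 := by
  rw [← norm_ne_zero_iff, norm_exp_smul_sphere]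
  positivity

variable (K) in
/-- The identification of `K × S³ × ℝ` with `K × (ℝ⁴ \ {0})` by `(p, q, t) ↦ (p, eᵗ q)`. -/
def polarCoordinates : OpenPartialHomeomorph ((K × Sphere3) × ℝ) (K × R4) where
  toFun x := (x.1.1, Real.exp x.2 • (x.1.2 : R4))
  invFun y := ((y.1, radialProjection y.2), Real.log ‖y.2‖)
  source := univ
  target := {y | y.2 ≠ 0}
  map_source' x _ := exp_smul_sphere_ne_zero _ _
  map_target' _ _ := mem_univ _
  left_inv' := by
    rintro ⟨⟨p, q⟩, t⟩ -
    refine Prod.ext (Prod.ext rfl (Subtype.ext ?_)) ?_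
    · simp only
      rw [coe_radialProjection (exp_smul_sphere_ne_zero _ _), norm_exp_smul_sphere, smul_smul,
        inv_mul_cancel₀ (Real.exp_ne_zero _), one_smul]
    · simp only
      rw [norm_exp_smul_sphere, Real.log_exp]
  right_inv' := by
    rintro ⟨p, z⟩ (hz : z ≠ 0)
    refine Prod.ext rfl ?_
    simp only
    rw [coe_radialProjection hz, Real.exp_log (norm_pos_iff.2 hz), smul_smul,
      mul_inv_cancel₀ (norm_ne_zero_iff.2 hz), one_smul]
  open_source := isOpen_univ
  open_target := isOpen_compl_singleton.preimage continuous_snd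
  continuousOn_toFun := by fun_prop
  continuousOn_invFun := by
    rintro ⟨p, z⟩ (hz : z ≠ 0)
    refine ContinuousAt.continuousWithinAt ?_
    have h1 : ContinuousAt (fun y : K × R4 => radialProjection y.2) (p, z) :=
      ContinuousAt.comp (g := radialProjection) (f := Prod.snd)
        (contMDiffAt_radialProjection hz).continuousAt continuousAt_snd
    have h2 : ContinuousAt (fun y : K × R4 => Real.log ‖y.2‖) (p, z) :=
      continuousAt_snd.norm.log (norm_ne_zero_iff.2 hz)
    exact (continuousAt_fst.prodMk h1).prodMk h2

lemma polarCoordinates_apply (x : (K × Sphere3) × ℝ) :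
    polarCoordinates K x = (x.1.1, Real.exp x.2 • (x.1.2 : R4)) := rfl

lemma contMDiff_polarCoordinates :
    ContMDiff ((IK.prod (𝓡 3)).prod 𝓘(ℝ, ℝ)) (IK.prod 𝓘(ℝ, R4)) ∞ (polarCoordinates K) := by
  have : Fact (Module.finrank ℝ R4 = 3 + 1) := ⟨finrank_euclideanSpace_fin⟩
  have h0 : ContMDiff (𝓡 3) 𝓘(ℝ, R4) ∞ (Subtype.val : Sphere3 → R4) := contMDiff_coe_sphere
  have h1 : ContMDiff ((IK.prod (𝓡 3)).prod 𝓘(ℝ, ℝ)) 𝓘(ℝ, R4) ∞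
      (fun x : (K × Sphere3) × ℝ => (x.1.2 : R4)) :=
    h0.comp (contMDiff_snd.comp contMDiff_fst)
  have h2 : ContMDiff ((IK.prod (𝓡 3)).prod 𝓘(ℝ, ℝ)) 𝓘(ℝ, ℝ) ∞
      (fun x : (K × Sphere3) × ℝ => Real.exp x.2) :=
    Real.contDiff_exp.contMDiff.comp contMDiff_snd
  exact (contMDiff_fst.comp contMDiff_fst).prodMk (h2.smul h1)

lemma contMDiffOn_polarCoordinates_symm :
    ContMDiffOn (IK.prod 𝓘(ℝ, R4)) ((IK.prod (𝓡 3)).prod 𝓘(ℝ, ℝ)) ∞ (polarCoordinates K).symm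
      (polarCoordinates K).target := by
  rintro ⟨p, z⟩ (hz : z ≠ 0)
  refine ContMDiffAt.contMDiffWithinAt ?_
  have h1 : ContMDiffAt (IK.prod 𝓘(ℝ, R4)) (𝓡 3) ∞ (fun y : K × R4 => radialProjection y.2) (p, z) :=
    (contMDiffAt_radialProjection hz).comp (p, z) contMDiffAt_snd
  have h2 : ContDiffAt ℝ ∞ (fun z : R4 => Real.log ‖z‖) z :=
    (contDiffAt_norm ℝ hz).log (norm_ne_zero_iff.2 hz)
  have h3 : ContMDiffAt (IK.prod 𝓘(ℝ, R4)) 𝓘(ℝ, ℝ) ∞ (fun y : K × R4 => Real.log ‖y.2‖) (p, z) :=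
    h2.contMDiffAt.comp (p, z) contMDiffAt_snd
  exact (contMDiffAt_fst.prodMk h1).prodMk h3

end PolarCoordinates

/-! ### The Hopf atlas of the mapping torus. -/

section MappingTorusAtlas

variable {EK : Type*} [NormedAddCommGroup EK] [NormedSpace ℝ EK] {HK : Type*} [TopologicalSpace HK]
  {IK : ModelWithCorners ℝ EK HK} {K : Type*} [TopologicalSpace K] [ChartedSpace HK K]
  [IsManifold IK ∞ K]

namespace KahlerStructure

variable {S : KahlerStructure IK K}

namespace IsHolomorphicIsometricMap

lemma id : S.IsHolomorphicIsometricMap (fun x => x) where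
  mdifferentiable := mdifferentiable_id
  holomorphic x v := by
    have h : mfderiv IK IK (fun x : K => x) x = ContinuousLinearMap.id ℝ _ := mfderiv_id
    rw [h]
    rfl
  isometry x v w := by
    have h : mfderiv IK IK (fun x : K => x) x = ContinuousLinearMap.id ℝ _ := mfderiv_id
    rw [h]
    rfl

lemma comp {g g' : K → K} (hg : S.IsHolomorphicIsometricMap g)
    (hg' : S.IsHolomorphicIsometricMap g') : S.IsHolomorphicIsometricMap (fun x => g (g' x)) where
  mdifferentiable := hg.mdifferentiable.comp hg'.mdifferentiable
  holomorphic x v := by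
    have h : mfderiv IK IK (fun x => g (g' x)) x
        = (mfderiv IK IK g (g' x)).comp (mfderiv IK IK g' x) :=
      mfderiv_comp x (hg.mdifferentiable _) (hg'.mdifferentiable _)
    rw [h]
    exact (congrArg (mfderiv IK IK g (g' x)) (hg'.holomorphic x v)).trans (hg.holomorphic _ _)
  isometry x v w := by
    have h : mfderiv IK IK (fun x => g (g' x)) x
        = (mfderiv IK IK g (g' x)).comp (mfderiv IK IK g' x) :=
      mfderiv_comp x (hg.mdifferentiable _) (hg'.mdifferentiable _)
    rw [h]
    exact (hg.isometry _ _ _).trans (hg'.isometry x v w)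

/-- The differentials of `g` and `g'` are mutually inverse, so the identities for `g` at `g' x` can
be inverted. -/
lemma of_leftInverse_rightInverse {g g' : K → K} (hg : S.IsHolomorphicIsometricMap g)
    (hg' : MDifferentiable IK IK g') (h : LeftInverse g' g) (h' : RightInverse g' g) :
    S.IsHolomorphicIsometricMap g' := by
  have h1 : ∀ x v, mfderiv IK IK g (g' x) (mfderiv IK IK g' x v) = (show EK from v) := fun x v =>
    (mfderiv_apply_mfderiv_of_eventuallyEq (k := fun x => x) (hg.mdifferentiable _) (hg' x) rfl
      (Filter.Eventually.of_forall h') v).trans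
        (congrArg (fun L : EK →L[ℝ] EK => L v) (mfderiv_id (I := IK) (x := x)))
  have h2 : ∀ x v, mfderiv IK IK g' x (mfderiv IK IK g (g' x) v) = (show EK from v) := fun x v =>
    (mfderiv_apply_mfderiv_of_eventuallyEq (k := fun x => x) (hg' x) (hg.mdifferentiable (g' x))
      (h' x) (Filter.Eventually.of_forall h) v).trans
        (congrArg (fun L : EK →L[ℝ] EK => L v) (mfderiv_id (I := IK) (x := g' x)))
  refine ⟨hg', fun x v => ?_, fun x v w => ?_⟩
  · have h3 := hg.holomorphic (g' x) (mfderiv IK IK g' x v)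
    have h4 := congrArg (S.cplx.J (g (g' x)) : EK →L[ℝ] EK) (h1 x v)
    have h5 := S.J_congr (h' x) v
    have h6 := congrArg (mfderiv IK IK g' x : EK →L[ℝ] EK) (h3.trans (h4.trans h5))
    exact h6.symm.trans (h2 x _)
  · have h3 := hg.isometry (g' x) (mfderiv IK IK g' x v) (mfderiv IK IK g' x w)
    have h4 := congrArg₂ (fun a b => (S.metric.inner (g (g' x)) : EK →L[ℝ] EK →L[ℝ] ℝ) a b)
      (h1 x v) (h1 x w)
    exact h3.symm.trans (h4.trans (S.inner_congr (h' x) v w))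

end IsHolomorphicIsometricMap

lemma IsHolomorphicIsometry.zpow {ψ : K ≃ₘ⟮IK, IK⟯ K} (hψ : S.IsHolomorphicIsometry ψ) (n : ℤ) :
    S.IsHolomorphicIsometricMap ((ψ.toEquiv ^ n : Equiv.Perm K) : K → K) := by
  have h1 : S.IsHolomorphicIsometricMap (ψ.toEquiv : K → K) :=
    ⟨ψ.mdifferentiable (by simp), hψ.holomorphic, hψ.isometry⟩
  have h2 : S.IsHolomorphicIsometricMap (ψ.toEquiv.symm : K → K) :=
    h1.of_leftInverse_rightInverse (ψ.symm.mdifferentiable (by simp)) ψ.toEquiv.left_inv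
      ψ.toEquiv.right_inv
  induction n with
  | zero => exact IsHolomorphicIsometricMap.id
  | succ n ih =>
    rw [zpow_add_one]
    exact ih.comp h1
  | pred n ih =>
    rw [zpow_sub_one]
    exact ih.comp h2

end KahlerStructure

omit [IsManifold IK ∞ K] in
lemma zpow_prodCongr_refl_apply (ψ : K ≃ₘ⟮IK, IK⟯ K) (n : ℤ) (x : K × Sphere3) :
    ((ψ.prodCongr (Diffeomorph.refl (𝓡 3) Sphere3 ∞)).toEquiv ^ n : Equiv.Perm (K × Sphere3)) x
      = ((ψ.toEquiv ^ n : Equiv.Perm K) x.1, x.2) := by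
  induction n generalizing x with
  | zero => rfl
  | succ n ih =>
    rw [zpow_add_one, zpow_add_one, Equiv.Perm.mul_apply, ih]
    rfl
  | pred n ih =>
    rw [zpow_sub_one, zpow_sub_one, Equiv.Perm.mul_apply, ih]
    rfl

variable [T2Space K] [LocallyCompactSpace K] [IK.Boundaryless]

/-- The coordinates of the mapping torus of `(ψ, id)` with values in `K × (ℝ⁴ \ {0})`. -/
def MappingTorus.hopfAtlas (S : KahlerStructure IK K) {ψ : K ≃ₘ⟮IK, IK⟯ K}
    (hψ : S.IsHolomorphicIsometry ψ) :
    HopfAtlas ((IK.prod (𝓡 3)).prod 𝓘(ℝ, ℝ))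
      (MappingTorus (ψ.prodCongr (Diffeomorph.refl (𝓡 3) Sphere3 ∞))) S ((K × Sphere3) × ℝ) where
  chart x := (MappingTorus.localInverse _ x).trans (polarCoordinates K)
  isSmooth x :=
    { contMDiffOn := contMDiff_polarCoordinates.comp_contMDiffOn
        ((MappingTorus.contMDiffOn_localInverse _ x).mono inter_subset_left)
      contMDiffOn_symm := by
        have h := (MappingTorus.contMDiff_mk
          (ψ.prodCongr (Diffeomorph.refl (𝓡 3) Sphere3 ∞))).comp_contMDiffOn
            (contMDiffOn_polarCoordinates_symm (IK := IK) (K := K))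
        refine (h.mono inter_subset_left).congr fun y hy => ?_
        simp [OpenPartialHomeomorph.trans_symm_eq_symm_trans_symm]
      ne_zero := fun y _ => exp_smul_sphere_ne_zero _ _ }
  index := surjInv (MappingTorus.surjective_mk _)
  mem_source y := ⟨MappingTorus.mem_localInverse_surjInv_source _ y, mem_univ _⟩
  compat x x' y hy hy' := by
    obtain ⟨n, hn⟩ := MappingTorus.exists_localInverse_eventuallyEq _ hy.1 hy'.1
    -- Adding `n` to `t` multiplies `eᵗ q` by `eⁿ`, while the sphere component is fixed by the
    -- diffeomorphism.
    refine ⟨_, Real.exp n, Real.exp_ne_zero _, hψ.zpow n, ?_⟩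
    filter_upwards [hn] with z hz
    simp only [OpenPartialHomeomorph.coe_trans, comp_apply, polarCoordinates_apply]
    rw [hz, zpow_prodCongr_refl_apply, smul_smul, ← Real.exp_add, add_comm (n : ℝ)]

/-- The branch through `x` inverts `mk` near `x`. At `t = 0` the second coordinate is the point of
the sphere itself, which serves the computation on a slice. -/
lemma MappingTorus.hopfAtlas_chart_mk_eventuallyEq (S : KahlerStructure IK K) {ψ : K ≃ₘ⟮IK, IK⟯ K}
    (hψ : S.IsHolomorphicIsometry ψ) (x : (K × Sphere3) × ℝ) :
    ∀ᶠ y in 𝓝 x, (MappingTorus.hopfAtlas S hψ).chart x (MappingTorus.mk _ y)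
      = (y.1.1, Real.exp y.2 • (y.1.2 : R4)) := by
  have h := (localInverse (ψ.prodCongr (Diffeomorph.refl (𝓡 3) Sphere3 ∞)) x).open_target.mem_nhds
    ((isLocalHomeomorph_mk _).self_mem_localInverseAt_target)
  filter_upwards [h] with y hy
  have h1 := (localInverse (ψ.prodCongr (Diffeomorph.refl (𝓡 3) Sphere3 ∞)) x).right_inv hy
  rw [localInverse_symm] at h1
  exact congrArg (polarCoordinates K) h1

end MappingTorusAtlas

/-! ### Stokes' theorem on a box. -/

section BoxStokes

open MeasureTheory

/-- The integral over a box of the exterior derivative of a form vanishes if the restrictions of the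
form to opposite faces agree. -/
lemma integral_extDeriv_eq_zero {n : ℕ} {a b : Fin (n + 1) → ℝ} (hle : a ≤ b)
    {η : (Fin (n + 1) → ℝ) → (Fin (n + 1) → ℝ) [⋀^Fin n]→L[ℝ] ℝ} (hη : ContDiff ℝ 1 η)
    (hface : ∀ (i : Fin (n + 1)) (y : Fin n → ℝ),
      η (i.insertNth (b i) y) (fun j => Pi.single (i.succAbove j) 1)
        = η (i.insertNth (a i) y) (fun j => Pi.single (i.succAbove j) 1)) :
    ∫ x in Icc a b, extDeriv η x (fun i => Pi.single i 1) = 0 := by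
  -- Composed with `η`, these functionals are the components of a vector field whose divergence is
  -- the coefficient of `dη`.
  let ev (i : Fin (n + 1)) : ((Fin (n + 1) → ℝ) [⋀^Fin n]→L[ℝ] ℝ) →L[ℝ] ℝ :=
    (-1 : ℝ) ^ (i : ℕ) • ContinuousAlternatingMap.apply ℝ _ _ (fun j => Pi.single (i.succAbove j) 1)
  have hev : ∀ i ζ, ev i ζ = (-1 : ℝ) ^ (i : ℕ) * ζ (fun j => Pi.single (i.succAbove j) 1) :=
    fun i ζ => rfl
  have hd : ∀ x, DifferentiableAt ℝ η x := fun x => hη.differentiable (by simp) x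
  have hsum : ∀ x, extDeriv η x (fun i => Pi.single i 1)
      = ∑ i, ((ev i).comp (fderiv ℝ η x)) (Pi.single i 1) := fun x => by
    rw [extDeriv_apply (hd x)]
    refine Finset.sum_congr rfl fun i _ => ?_
    have h := ((ContinuousAlternatingMap.apply ℝ (Fin (n + 1) → ℝ) ℝ
      (i.removeNth fun j : Fin (n + 1) => (Pi.single j 1 : Fin (n + 1) → ℝ))).hasFDerivAt
        (x := η x)).comp x (hd x).hasFDerivAt
    rw [zsmul_eq_mul, Int.cast_pow, Int.cast_neg, Int.cast_one]
    exact congrArg (fun L : (Fin (n + 1) → ℝ) →L[ℝ] ℝ => (-1 : ℝ) ^ (i : ℕ) * L (Pi.single i 1))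
      h.fderiv
  have hcont : Continuous (fun x => ∑ i, ((ev i).comp (fderiv ℝ η x)) (Pi.single i 1)) :=
    continuous_finsetSum _ fun i _ =>
      (ev i).continuous.comp ((hη.continuous_fderiv (by simp)).clm_apply continuous_const)
  simp_rw [hsum]
  rw [integral_divergence_of_hasFDerivAt_off_countable' a b hle (fun i x => ev i (η x))
    (fun i x => (ev i).comp (fderiv ℝ η x)) ∅ countable_empty
    (fun i => ((ev i).continuous.comp hη.continuous).continuousOn)
    (fun x _ i => (ev i).hasFDerivAt.comp x (hd x).hasFDerivAt)
    (hcont.continuousOn.integrableOn_compact isCompact_Icc)]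
  refine Finset.sum_eq_zero fun i _ => ?_
  simp_rw [hev, hface, sub_self]

end BoxStokes

/-! ### A parametrization of `S³` by a box. -/

section SphereParametrization

open Real

/-- The parametrization `(cos a e^{ib}, sin a e^{ic})` of `S³`. -/
def sphereParam (u : Fin 3 → ℝ) : R4 :=
  WithLp.toLp 2 ![cos (u 0) * cos (u 1), cos (u 0) * sin (u 1), sin (u 0) * cos (u 2),
    sin (u 0) * sin (u 2)]

lemma norm_sq_sphereParam (u : Fin 3 → ℝ) : ‖sphereParam u‖ ^ 2 = 1 := by
  rw [R4.norm_sq_eq]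
  simp only [sphereParam]
  simp
  have h0 := sin_sq_add_cos_sq (u 0)
  have h1 := sin_sq_add_cos_sq (u 1)
  have h2 := sin_sq_add_cos_sq (u 2)
  linear_combination h0 + cos (u 0) ^ 2 * h1 + sin (u 0) ^ 2 * h2

lemma norm_sphereParam (u : Fin 3 → ℝ) : ‖sphereParam u‖ = 1 :=
  (pow_eq_one_iff_of_nonneg (norm_nonneg _) two_ne_zero).1 (norm_sq_sphereParam u)

lemma contDiff_sphereParam : ContDiff ℝ ∞ sphereParam := by
  rw [contDiff_euclidean]
  intro i
  have h : ∀ j : Fin 3, ContDiff ℝ ∞ (fun u : Fin 3 → ℝ => u j) := fun j => contDiff_apply ℝ ℝ j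
  fin_cases i
  · exact (h 0).cos.mul (h 1).cos
  · exact (h 0).cos.mul (h 1).sin
  · exact (h 0).sin.mul (h 2).cos
  · exact (h 0).sin.mul (h 2).sin

lemma fderiv_sphereParam_apply (u v : Fin 3 → ℝ) (i : Fin 4) :
    fderiv ℝ sphereParam u v i = fderiv ℝ (fun u => sphereParam u i) u v := by
  have h := (contDiff_sphereParam.differentiable (by simp) u).hasFDerivAt
  have h' := ((EuclideanSpace.proj (𝕜 := ℝ) i).hasFDerivAt (x := sphereParam u)).comp u h
  exact (congrArg (fun L => L v) h'.fderiv).symm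

lemma fderiv_sphereParam (u v : Fin 3 → ℝ) : fderiv ℝ sphereParam u v = WithLp.toLp 2
    ![-sin (u 0) * v 0 * cos (u 1) - cos (u 0) * (sin (u 1) * v 1),
      -sin (u 0) * v 0 * sin (u 1) + cos (u 0) * (cos (u 1) * v 1),
      cos (u 0) * v 0 * cos (u 2) - sin (u 0) * (sin (u 2) * v 2),
      cos (u 0) * v 0 * sin (u 2) + sin (u 0) * (cos (u 2) * v 2)] := by
  have h : ∀ j : Fin 3, HasFDerivAt (fun u : Fin 3 → ℝ => u j)
    (ContinuousLinearMap.proj (R := ℝ) (φ := fun _ : Fin 3 => ℝ) j) u := fun j => hasFDerivAt_apply j u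
  apply R4.ext4
  · refine (fderiv_sphereParam_apply u v 0).trans ?_
    refine (congrArg (fun L : (Fin 3 → ℝ) →L[ℝ] ℝ => L v) ((h 0).cos.mul (h 1).cos).fderiv).trans ?_
    simp
    ring
  · refine (fderiv_sphereParam_apply u v 1).trans ?_
    refine (congrArg (fun L : (Fin 3 → ℝ) →L[ℝ] ℝ => L v) ((h 0).cos.mul (h 1).sin).fderiv).trans ?_
    simp
    ring
  · refine (fderiv_sphereParam_apply u v 2).trans ?_
    refine (congrArg (fun L : (Fin 3 → ℝ) →L[ℝ] ℝ => L v) ((h 0).sin.mul (h 2).cos).fderiv).trans ?_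
    simp
    ring
  · refine (fderiv_sphereParam_apply u v 3).trans ?_
    refine (congrArg (fun L : (Fin 3 → ℝ) →L[ℝ] ℝ => L v) ((h 0).sin.mul (h 2).sin).fderiv).trans ?_
    simp
    ring

/-- This density is positive in the interior of `[0, π/2] × [0, 2π]²`, and no more than that is
used. -/
lemma sphereForm_sphereParam (u : Fin 3 → ℝ) :
    R4.sphereForm (sphereParam u) (fun i => fderiv ℝ sphereParam u (Pi.single i 1))
      = 2 * (sin (u 0) * cos (u 0)) := by
  rw [R4.sphereForm_apply, R4.detForm_eq, norm_sq_sphereParam]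
  simp only [fderiv_sphereParam, sphereParam]
  simp
  have h0 := sin_sq_add_cos_sq (u 0)
  have h1 := sin_sq_add_cos_sq (u 1)
  have h2 := sin_sq_add_cos_sq (u 2)
  linear_combination 2 * sin (u 0) * cos (u 0) * ((sin (u 1) ^ 2 + cos (u 1) ^ 2)
    * (sin (u 2) ^ 2 + cos (u 2) ^ 2) * h0 + (sin (u 2) ^ 2 + cos (u 2) ^ 2) * h1 + h2)

lemma sphereParam_add_two_pi (u : Fin 3 → ℝ) {i : Fin 3} (hi : i ≠ 0) :
    sphereParam (u + Pi.single i (2 * π)) = sphereParam u := by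
  have h : i = 1 ∨ i = 2 := by fin_cases i <;> simp_all
  rcases h with rfl | rfl <;> simp [sphereParam]

/-- On the face `a = 0` the circle of the angle `c` collapses to a point; in the next lemma, on `a =
π/2`, the circle of the angle `b` does. -/
lemma sphereParam_add_of_sin_eq_zero {u : Fin 3 → ℝ} (hu : sin (u 0) = 0) (t : ℝ) :
    sphereParam (u + t • Pi.single 2 1) = sphereParam u := by
  simp [sphereParam, hu]

lemma sphereParam_add_of_cos_eq_zero {u : Fin 3 → ℝ} (hu : cos (u 0) = 0) (t : ℝ) :
    sphereParam (u + t • Pi.single 1 1) = sphereParam u := by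
  simp [sphereParam, hu]

/-- The parametrization of `S³`, as a map to the sphere. -/
def sphereParam' : (Fin 3 → ℝ) → Sphere3 :=
  codRestrict sphereParam _ fun u => mem_sphere_zero_iff_norm.2 (norm_sphereParam u)

lemma contMDiff_sphereParam' : ContMDiff 𝓘(ℝ, Fin 3 → ℝ) (𝓡 3) ∞ sphereParam' := by
  have : Fact (Module.finrank ℝ R4 = 3 + 1) := ⟨finrank_euclideanSpace_fin⟩
  exact contDiff_sphereParam.contMDiff.codRestrict_sphere _

open MeasureTheory in
lemma integral_sin_mul_cos_pos :
    0 < ∫ u in Icc (0 : Fin 3 → ℝ) ![π / 2, 2 * π, 2 * π], 2 * (sin (u 0) * cos (u 0)) := by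
  have hπ := pi_pos
  have hc : Continuous fun u : Fin 3 → ℝ => 2 * (sin (u 0) * cos (u 0)) := by fun_prop
  rw [setIntegral_pos_iff_support_of_nonneg_ae]
  · have h1 : 0 < volume (pi univ fun i => Ioo ((0 : Fin 3 → ℝ) i)
        ((![π / 2, 2 * π, 2 * π] : Fin 3 → ℝ) i)) := by
      rw [Real.volume_pi_Ioo]
      simp [Fin.prod_univ_three, hπ]
    refine h1.trans_le (measure_mono fun u hu => ⟨?_, ?_⟩)
    · have h := hu 0 (mem_univ _)
      have h1 : 0 < u 0 := h.1
      have h2 : u 0 < π / 2 := h.2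
      have s1 := sin_pos_of_pos_of_lt_pi h1 (by linarith)
      have s2 := cos_pos_of_mem_Ioo ⟨(by linarith : -(π / 2) < u 0), h2⟩
      exact (by positivity : 2 * (sin (u 0) * cos (u 0)) ≠ 0)
    · exact ⟨fun i => (hu i (mem_univ _)).1.le, fun i => (hu i (mem_univ _)).2.le⟩
  · refine (ae_restrict_iff' measurableSet_Icc).2 (Filter.Eventually.of_forall fun u hu => ?_)
    have h1 : 0 ≤ u 0 := hu.1 0
    have h2 : u 0 ≤ π / 2 := hu.2 0
    have s1 := sin_nonneg_of_nonneg_of_le_pi h1 (by linarith)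
    have s2 := cos_nonneg_of_mem_Icc ⟨(by linarith : -(π / 2) ≤ u 0), h2⟩
    exact (by positivity : 0 ≤ 2 * (sin (u 0) * cos (u 0)))
  · exact hc.continuousOn.integrableOn_compact isCompact_Icc

end SphereParametrization

/-! ### The torsion is not exact. -/

section Twisted

variable {E : Type*} [NormedAddCommGroup E] [NormedSpace ℝ E] {H : Type*} [TopologicalSpace H]
  {I : ModelWithCorners ℝ E H} {M : Type*} [TopologicalSpace M] [ChartedSpace H M]
  [IsManifold I ∞ M] [I.Boundaryless]

open DiffForm

section

variable {F : Type*} [NormedAddCommGroup F] [NormedSpace ℝ F] {n : ℕ}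

omit [IsManifold I ∞ M] [I.Boundaryless] in
/-- The pullback of a form under a map on a vector space that is invariant under a translation. -/
lemma DiffForm.pullback_add_of_invariant {Φ : F → M} (hΦ : MDifferentiable 𝓘(ℝ, F) I Φ) {c : F}
    (hc : ∀ x, Φ (x + c) = Φ x) (α : DiffForm I M n) (x : F) (v : Fin n → F) :
    (pullback 𝓘(ℝ, F) Φ α (x + c) : F [⋀^Fin n]→L[ℝ] ℝ) v
      = (pullback 𝓘(ℝ, F) Φ α x : F [⋀^Fin n]→L[ℝ] ℝ) v := by
  have hτ : HasFDerivAt (fun x : F => x + c) (ContinuousLinearMap.id ℝ F) x :=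
    (hasFDerivAt_id x).add_const c
  have h1 := pullback_comp (I := 𝓘(ℝ, F)) (α := α) (f := fun x : F => x + c) (x := x)
    (hΦ _) hτ.differentiableAt.mdifferentiableAt
  have h2 : (fun y => Φ (y + c)) = Φ := funext hc
  rw [h2] at h1
  have h3 : mfderiv 𝓘(ℝ, F) 𝓘(ℝ, F) (fun x : F => x + c) x = ContinuousLinearMap.id ℝ F := by
    rw [mfderiv_eq_fderiv]
    exact hτ.fderiv
  refine Eq.trans ?_ (congrArg (fun L : F [⋀^Fin n]→L[ℝ] ℝ => L v) h1).symm
  exact congrArg (fun L : F →L[ℝ] F => (pullback 𝓘(ℝ, F) Φ α (x + c) : F [⋀^Fin n]→L[ℝ] ℝ)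
    (fun i => L (v i))) h3.symm

omit [IsManifold I ∞ M] [I.Boundaryless] in
/-- The pullback of a form under a map vanishes on families containing a direction in which the map
is constant. -/
lemma DiffForm.pullback_eq_zero_of_const {Φ : F → M} (hΦ : MDifferentiable 𝓘(ℝ, F) I Φ) {x : F}
    {v : Fin n → F} {j : Fin n} (hj : ∀ t : ℝ, Φ (x + t • v j) = Φ x) (α : DiffForm I M n) :
    (pullback 𝓘(ℝ, F) Φ α x : F [⋀^Fin n]→L[ℝ] ℝ) v = 0 := by
  -- The line through `x` in the direction `v j` has constant image, so the differential of `Φ`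
  -- kills `v j`.
  have hγ : HasFDerivAt (fun t : ℝ => x + t • v j) ((ContinuousLinearMap.id ℝ ℝ).smulRight (v j))
      (0 : ℝ) := ((hasFDerivAt_id (0 : ℝ)).smul_const (v j)).const_add x
  have h1 := mfderiv_apply_mfderiv_of_eventuallyEq (k := fun _ : ℝ => Φ x) (hΦ x)
    hγ.differentiableAt.mdifferentiableAt (by simp) (Filter.Eventually.of_forall hj) (1 : ℝ)
  have h2 : mfderiv 𝓘(ℝ, ℝ) 𝓘(ℝ, F) (fun t : ℝ => x + t • v j) (0 : ℝ) (1 : ℝ) = v j := by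
    rw [mfderiv_eq_fderiv, hγ.fderiv]
    exact one_smul ℝ (v j)
  have h3 : (mfderiv 𝓘(ℝ, F) I Φ x : F →L[ℝ] E) (v j) = 0 := by
    refine (congrArg (mfderiv 𝓘(ℝ, F) I Φ x : F →L[ℝ] E) h2).symm.trans (h1.trans ?_)
    exact congrArg (fun L : ℝ →L[ℝ] E => L 1) (mfderiv_const (I := 𝓘(ℝ, ℝ)) (I' := I))
  exact ContinuousAlternatingMap.map_coord_zero (α (Φ x) : E [⋀^Fin n]→L[ℝ] ℝ) j h3

/-- The pullback of a smooth form to a finite-dimensional vector space is smooth. -/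
lemma DiffForm.contDiff_pullback [FiniteDimensional ℝ F] {Φ : F → M} (hΦ : ContMDiff 𝓘(ℝ, F) I ∞ Φ)
    {α : DiffForm I M n} (hα : α.IsSmooth) :
    ContDiff ℝ ∞ (E := F) (F := F [⋀^Fin n]→L[ℝ] ℝ) (fun x => pullback 𝓘(ℝ, F) Φ α x) := by
  refine contDiff_iff_contDiffAt.2 fun x => ?_
  have h := contDiffAt_inChart_pullback (I := 𝓘(ℝ, F)) (mem_extChartAt_source x)
    (mem_extChartAt_source (Φ x)) (hΦ x) ((hα (Φ x)).contDiffAt (extChartAt_target_mem_nhds (Φ x)))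
  have e : (pullback 𝓘(ℝ, F) Φ α).inChart x = (pullback 𝓘(ℝ, F) Φ α : F → F [⋀^Fin n]→L[ℝ] ℝ) :=
    inChart_ofFun (E := F) (fun x => (pullback 𝓘(ℝ, F) Φ α x : F [⋀^Fin n]→L[ℝ] ℝ)) x
  rw [e, extChartAt_model_space_eq_id] at h
  exact h

lemma DiffForm.extDeriv_pullback_apply {Φ : F → M} (hΦ : ContMDiff 𝓘(ℝ, F) I ∞ Φ)
    {α : DiffForm I M n} (hα : α.IsSmooth) (x : F) (v : Fin (n + 1) → F) :
    _root_.extDeriv (fun x => (pullback 𝓘(ℝ, F) Φ α x : F [⋀^Fin n]→L[ℝ] ℝ)) x v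
      = pullback 𝓘(ℝ, F) Φ α.extDeriv x v := by
  have h1 := extDeriv_ofFun (fun x => (pullback 𝓘(ℝ, F) Φ α x : F [⋀^Fin n]→L[ℝ] ℝ))
  have h2 := DiffForm.extDeriv_pullback (I := 𝓘(ℝ, F)) (hΦ x) (hα.differentiableAt (Φ x))
  exact congrArg (fun L : F [⋀^Fin (n + 1)]→L[ℝ] ℝ => L v) ((congrFun h1 x).symm.trans h2)

end

variable {EK : Type*} [NormedAddCommGroup EK] [NormedSpace ℝ EK] {HK : Type*} [TopologicalSpace HK]
  {IK : ModelWithCorners ℝ EK HK} {K : Type*} [TopologicalSpace K] [ChartedSpace HK K]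
  [IsManifold IK ∞ K] [IK.Boundaryless] [FiniteDimensional ℝ E] [FiniteDimensional ℝ EK]
  {S : KahlerStructure IK K} {ι : Type*} (A : HopfAtlas I M S ι)

namespace HopfAtlas

/-- A primitive of the torsion, pulled back to the box through `σ`, would make the integral of a
positive density vanish by Stokes. The hypothesis `hA` says that in suitable charts `σ` is the
inclusion of the unit sphere in the `ℝ⁴` component. -/
lemma isTwisted_generalizedKahler {σ : Sphere3 → M} (hσ : ContMDiff (𝓡 3) I ∞ σ)
    (hA : ∀ q, ∃ i, σ q ∈ (A.chart i).source ∧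
      ∀ᶠ q' in 𝓝 q, (A.chart i (σ q')).2 = (q' : R4)) :
    A.generalizedKahler.IsTwisted := by
  refine ⟨A.torsion_mem_closedForms, fun h0 => ?_⟩
  rw [Submodule.Quotient.mk_eq_zero, Submodule.mem_comap] at h0
  obtain ⟨α, hα, hαT⟩ := h0
  replace hαT : α.extDeriv = A.generalizedKahler.torsion := hαT
  set Φ : (Fin 3 → ℝ) → M := fun u => σ (sphereParam' u) with hΦdef
  have hΦ : ContMDiff 𝓘(ℝ, Fin 3 → ℝ) I ∞ Φ := hσ.comp contMDiff_sphereParam'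
  have hΦd : MDifferentiable 𝓘(ℝ, Fin 3 → ℝ) I Φ := hΦ.mdifferentiable (by simp)
  have hΦ_congr : ∀ {u v}, sphereParam u = sphereParam v → Φ u = Φ v := fun h =>
    congrArg σ (Subtype.ext h)
  have key : ∀ u : Fin 3 → ℝ, _root_.extDeriv (fun x => (pullback 𝓘(ℝ, Fin 3 → ℝ) Φ α x :
      (Fin 3 → ℝ) [⋀^Fin 2]→L[ℝ] ℝ)) u (fun i => Pi.single i 1)
        = 2 * (Real.sin (u 0) * Real.cos (u 0)) := by
    intro u
    obtain ⟨i, hi, hi'⟩ := hA (sphereParam' u)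
    rw [DiffForm.extDeriv_pullback_apply hΦ hα, hαT, ← sphereForm_sphereParam]
    -- The next three identities rewrite the pulled back torsion as the pullback of `R4.sphereForm`
    -- by `sphereParam`.
    have e1 : pullback 𝓘(ℝ, Fin 3 → ℝ) Φ A.generalizedKahler.torsion u
        = pullback 𝓘(ℝ, Fin 3 → ℝ) Φ
          (pullback I (fun y => (A.chart i y).2) (ofFun R4.sphereForm)) u := by
      rw [pullback, pullback, A.torsion_eq hi]
    have e2 : pullback 𝓘(ℝ, Fin 3 → ℝ) Φ
          (pullback I (fun y => (A.chart i y).2) (ofFun R4.sphereForm)) u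
        = pullback 𝓘(ℝ, Fin 3 → ℝ) (fun u => (A.chart i (Φ u)).2) (ofFun R4.sphereForm) u :=
      (pullback_comp (f := Φ) (x := u) (((A.isSmooth i).contMDiffAt_snd hi).mdifferentiableAt (by simp))
        (hΦd u)).symm
    have e3 : pullback 𝓘(ℝ, Fin 3 → ℝ) (fun u => (A.chart i (Φ u)).2) (ofFun R4.sphereForm) u
        = pullback 𝓘(ℝ, Fin 3 → ℝ) sphereParam (ofFun R4.sphereForm) u :=
      pullback_congr ((contMDiff_sphereParam'.continuous.tendsto u).eventually hi')
    rw [e1, e2, e3]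
    exact congrArg (fun L : (Fin 3 → ℝ) →L[ℝ] R4 =>
      R4.sphereForm (sphereParam u) (fun i => L (Pi.single i 1))) mfderiv_eq_fderiv
  have hπ := Real.pi_pos
  have hint := integral_extDeriv_eq_zero (a := 0) (b := ![Real.pi / 2, 2 * Real.pi, 2 * Real.pi])
    (fun i => by fin_cases i <;> simp <;> positivity)
    ((DiffForm.contDiff_pullback hΦ hα).of_le (by simp)) fun i y => ?_
  · simp_rw [key] at hint
    exact integral_sin_mul_cos_pos.ne' hint
  by_cases hi : i = 0
  · subst hi
    -- The faces `a = π/2` and `a = 0` need not match pointwise: each restriction is zero because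
    -- one of the two tangent directions is collapsed, the first (`b`) where `cos a = 0` and the
    -- second (`c`) where `sin a = 0`.
    refine Eq.trans (b := (0 : ℝ)) ?_ (Eq.symm ?_)
    · refine DiffForm.pullback_eq_zero_of_const hΦd (j := 0) (fun t => hΦ_congr ?_) α
      exact sphereParam_add_of_cos_eq_zero (by simp) t
    · refine DiffForm.pullback_eq_zero_of_const hΦd (j := 1) (fun t => hΦ_congr ?_) α
      exact sphereParam_add_of_sin_eq_zero (by simp) t
  -- The remaining opposite faces differ by a period `2π` of the parametrization.
  · have e : (i.insertNth ((![Real.pi / 2, 2 * Real.pi, 2 * Real.pi] : Fin 3 → ℝ) i) y :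
        Fin 3 → ℝ) = i.insertNth ((0 : Fin 3 → ℝ) i) y + Pi.single i (2 * Real.pi) := by
      ext j
      refine Fin.succAboveCases i ?_ (fun j => ?_) j
      · fin_cases i <;> simp_all
      · simp
    rw [e]
    exact DiffForm.pullback_add_of_invariant hΦd
      (fun u => hΦ_congr (sphereParam_add_two_pi u hi)) α _ _

end HopfAtlas

end Twisted

theorem mainTheorem5 (k : ℕ) (K : Type*) [TopologicalSpace K]
    [ChartedSpace (EuclideanSpace ℝ (Fin (2 * k))) K] [IsManifold (𝓡 (2 * k)) ∞ K]
    [T2Space K] [CompactSpace K] [Nonempty K]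
    (S : KahlerStructure (𝓡 (2 * k)) K) (ψ : K ≃ₘ⟮𝓡 (2 * k), 𝓡 (2 * k)⟯ K)
    (hψ : S.IsHolomorphicIsometry ψ) :
    ∃ G : GeneralizedKahlerStructure (((𝓡 (2 * k)).prod (𝓡 3)).prod 𝓘(ℝ, ℝ))
        (MappingTorus (ψ.prodCongr (Diffeomorph.refl (𝓡 3) Sphere3 ∞))),
      G.IsSplit ∧ G.IsTwisted ∧ G.InducesOppositeOrientations := by
  obtain ⟨p⟩ := ‹Nonempty K›
  let A := MappingTorus.hopfAtlas S hψ
  refine ⟨A.generalizedKahler, A.isSplit_generalizedKahler, ?_,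
    A.inducesOppositeOrientations_generalizedKahler⟩
  have hσ : ContMDiff (𝓡 3) (((𝓡 (2 * k)).prod (𝓡 3)).prod 𝓘(ℝ, ℝ)) ∞
      (fun q : Sphere3 => (((p, q), 0) : (K × Sphere3) × ℝ)) :=
    (contMDiff_const.prodMk contMDiff_id).prodMk contMDiff_const
  -- The test sphere is the slice `{p} × S³ × {0}`, whose existence uses that `K` is nonempty.
  refine A.isTwisted_generalizedKahler (σ := fun q => MappingTorus.mk _ ((p, q), 0))
    ((MappingTorus.contMDiff_mk _).comp hσ) fun q => ⟨((p, q), 0), ?_, ?_⟩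
  · exact ⟨(MappingTorus.isLocalHomeomorph_mk _).apply_self_mem_localInverseAt_source, mem_univ _⟩
  · filter_upwards [(hσ.continuous.tendsto q).eventually
      (MappingTorus.hopfAtlas_chart_mk_eventuallyEq S hψ ((p, q), 0))] with q' hq'
    refine (congrArg Prod.snd hq').trans ?_
    simp
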